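/- Let $(\mathcal M,g)$ be a smooth connected complete Riemannian manifold, $o\in\mathcal M$ and $r(x)=d(o,x)$. Let $E_1,\dots,E_D$ be smooth vector fields on $\mathcal M$ with $\operatorname{Span}(E_1(x),\dots,E_D(x))=T_x\mathcal M$ for all $x$, and let $F=\sum_{d=1}^D f^dE_d$ with given coordinate functions $f^d$. For a vector field $V$ write $V[\phi]=d\phi(V)$. Let $\mathcal C^\infty_P(\mathcal M)$ be the set of smooth $\phi:\mathcal M\to\mathbb R$ such that for every word $(d_1,\dots,d_k)$, $k\ge 0$, there are $C,\kappa$ with $|E_{d_k}[\dots E_{d_1}[\phi]\dots]|\le C(1+r^\kappa)$ on $\mathcal M$. **Assumptions.** 1. The $E_d$ are bounded, $|E_d|\le C$; $f^d\in\mathcal C^\infty_P(\mathcal M)$ and $|df^d|\le C$ for all $d$; there are $\nu\ge1$, $\lambda\in\mathbb R$ with $\mathcal L r^2\le \nu+\lambda r^2$ on $\mathcal M\setminus \mathrm{Cut}_o$, where $\mathcal L\phi=F[\phi]+\sum_{d=1}^D E_d[E_d[\phi]]$ and $\mathrm{Cut}_o$ is the cut locus of $o$. 2. $|E_{d_1}[E_{d_1}[f^{d}]]|\le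 C$ on $\mathcal M$ for all $d_1,d$. 3. For arbitrarily large real $q$, the function $r^q$ is of class $\mathcal C^4$ on $\mathcal M$ and there is $C$ (depending on $q$) with $|E_{d_k}[\dots E_{d_1}[r^q]\dots]|\le C(1+r^{q-k})$ on $\mathcal M$ for all $0\le k\le4$ and all $d_1,\dots,d_k$. **Methods.** Write $\exp(V)y$ for the time-one flow of the vector field $V$ started at $y$. For a step size $h>0$, a point $x$ and random variables $\xi^{d,l}$ ($1\le d\le D$, $1\le l\le L$), the explicit frozen flow method $\Phi_h$ with $s$ stages and $K$ exponentials per stage is $$H^i=\exp\Big(\sum_{d}\big(h\sum_{j<i}Z^0_{i,j,K}f^d(H^j)+\sqrt h\,Z^d_{i,K}\big)E_d\Big)\cdots\exp\Big(\sum_{d}\big(h\sum_{j<i}Z^0_{i,j,1}f^d(H^j)+\sqrt h\,Z^d_{i,1}\big)E_d\Big)x,$$ $$\Phi_h(x)=\exp\Big(\sum_{d}\big(h\sum_{i=1}^sz^0_{i,K}f^d(H^i)+\sqrt h\,z^d_{K}\big)E_d\Big)\cdots\exp\Big(\sum_{d}\big(h\sum_{i=1}^sz^0_{i,1}f^d(H^i)+\sqrt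 h\,z^d_{1}\big)E_d\Big)x,$$ with deterministic $Z^0_{i,j,k},z^0_{i,k}$ and $Z^d_{i,k}=\sum_l\hat Z_{i,k,l}\xi^{d,l}$, $z^d_k=\sum_l\hat z_{k,l}\xi^{d,l}$. It is consistent with $dX=F(X)\,dt+\sqrt2\sum_dE_d(X)\circ dW_d$ if $\sum_{i,k}z^0_{i,k}=1$ and $\sum_l(\sum_k\hat z_{k,l})^2=2$. The numerical trajectory is $X_{n+1}=\Phi_h(X_n)$, where step $n$ uses the variables $\xi_n^{d,l}$; all the $\xi^{d,l}_n$ are independent, the law of $\xi_n^{d,l}$ does not depend on $n$, they have finite moments of all orders, vanishing odd moments, and the same first $2p$ moments as a standard Gaussian variable, for a given integer $p\ge1$ (for instance, they are standard Gaussian). **Proposition.** Under Assumptions 1–3, every consistent explicit frozen flow method satisfies: (i) (Bounded moments.) For every random initial value $X_0$ with finite moments $\mathbb E[r(X_0)^k]$, $k\in\mathbb N$, independent of $(\xi_n^{d,l})$, and for all real $\kappa\ge0$, $T>0$, there is $C$ such that for all integers $N\ge1$, with $h=T/N$, $$\sup_{n=0,\dots,N}\mathbb E[r(X_n)^\kappa]\le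 C.$$ (ii) (Talay–Tubaro expansion.) There are $h_0>0$ and linear differential operators $\mathcal A_j$ (of finite order, with smooth coefficients, independent of $h$) such that for every $\phi\in\mathcal C^\infty_P(\mathcal M)$ there are $C,\kappa$ such that for all $x\in\mathcal M$ and $0<h\le h_0$, $\phi(X_1)$ is integrable when $X_0=x$ and $$\mathbb E[\phi(X_1)\mid X_0=x]=\phi(x)+\sum_{j=1}^ph^j\mathcal A_j\phi(x)+h^{p+1}R_p^h(\phi,x),\qquad |R_p^h(\phi,x)|\le C(1+r(x)^\kappa).$$ -/

import Mathlib

open scoped Manifold ContDiff Bundle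

namespace FrozenFlow

noncomputable section

open MeasureTheory ProbabilityTheory

/-! ## Frames, iterated frame derivatives, and the generator -/

section Geometry

variable {n : ℕ} {M : Type*} [MetricSpace M] [ChartedSpace (EuclideanSpace ℝ (Fin n)) M]

/-- The differential `dφ(x)(v)` of a real function at `x`, applied to a tangent vector. -/
def dAt (φ : M → ℝ) (x : M) (v : TangentSpace (𝓡 n) x) : ℝ :=
  mfderiv (𝓡 n) 𝓘(ℝ, ℝ) φ x v

/-- The derivative `V[φ](x) = dφ(x)(V(x))` of a function in the direction of a vector field. -/
def lieD (V : (x : M) → TangentSpace (𝓡 n) x) (φ : M → ℝ) (x : M) : ℝ :=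
  dAt φ x (V x)

/-- Iterated frame derivatives: `iterD E [d_k, …, d_1] φ = E_{d_k}[… E_{d_1}[φ] …]`. -/
def iterD {D : ℕ} (E : Fin D → (x : M) → TangentSpace (𝓡 n) x) :
    List (Fin D) → (M → ℝ) → (M → ℝ)
  | [], φ => φ
  | d :: w, φ => lieD (E d) (iterD E w φ)

/-- A frame: smooth vector fields that span every tangent space (possibly redundantly). -/
structure IsFrame [IsManifold (𝓡 n) ∞ M] {D : ℕ}
    (E : Fin D → (x : M) → TangentSpace (𝓡 n) x) : Prop where
  smooth : ∀ d, ContMDiff (𝓡 n) (𝓡 n).tangent ∞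
    (fun x => (⟨x, E d x⟩ : TangentBundle (𝓡 n) M))
  span_eq_top : ∀ x, Submodule.span ℝ (Set.range fun d => E d x) = ⊤

/-- Smooth functions all of whose iterated frame derivatives have polynomial growth in
`r(x) = dist o x`. -/
def PolyGrowth {D : ℕ} (E : Fin D → (x : M) → TangentSpace (𝓡 n) x) (o : M) (φ : M → ℝ) : Prop :=
  ContMDiff (𝓡 n) 𝓘(ℝ, ℝ) ∞ φ ∧
    ∀ w : List (Fin D), ∃ (C : ℝ) (K : ℕ), ∀ x, |iterD E w φ x| ≤ C * (1 + dist o x ^ K)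

/-- The vector field `∑ d, f d • E d` is frozen at coefficients `c`: `x ↦ ∑ d, c d • E d x`. -/
def frozenField {D : ℕ} (E : Fin D → (x : M) → TangentSpace (𝓡 n) x) (c : Fin D → ℝ) (x : M) :
    TangentSpace (𝓡 n) x :=
  ∑ d, c d • E d x

/-- The vector field `F = ∑ d, f d • E d` with coordinate functions `f d`. -/
def drift {D : ℕ} (E : Fin D → (x : M) → TangentSpace (𝓡 n) x) (f : Fin D → M → ℝ) (x : M) :
    TangentSpace (𝓡 n) x :=
  ∑ d, f d x • E d x

/-- The generator `L φ = F[φ] + ∑ d, E_d[E_d[φ]]`. -/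
def generator {D : ℕ} (E : Fin D → (x : M) → TangentSpace (𝓡 n) x) (f : Fin D → M → ℝ)
    (φ : M → ℝ) (x : M) : ℝ :=
  lieD (drift E f) φ x + ∑ d, iterD E [d, d] φ x

/-- The cut locus of `o`: the points `y ≠ o` beyond which no (unit speed) minimising geodesic
from `o` to `y` can be extended as a minimising geodesic. -/
def cutLocus {M : Type*} [MetricSpace M] (o : M) : Set M :=
  {y | y ≠ o ∧ ¬ ∃ (γ : ℝ → M) (b : ℝ), dist o y < b ∧ γ 0 = o ∧ γ (dist o y) = y ∧
    ∀ s ∈ Set.Icc 0 b, ∀ t ∈ Set.Icc 0 b, dist (γ s) (γ t) = |s - t|}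

/-- The regularity assumption on the frame `E` and on the coordinates `f` of the drift: the frame
is bounded for the Riemannian norm, each `f d` has bounded differential and polynomially growing
iterated frame derivatives, and `L r² ≤ ν + λ r²` off the cut locus of `o`. -/
structure Regular [Bundle.RiemannianBundle (fun x : M => TangentSpace (𝓡 n) x)] {D : ℕ}
    (E : Fin D → (x : M) → TangentSpace (𝓡 n) x) (f : Fin D → M → ℝ) (o : M) : Prop where
  frame_bdd : ∃ C : ℝ, ∀ d x, ‖E d x‖ ≤ C
  coord_poly : ∀ d, PolyGrowth E o (f d)
  coord_lip : ∃ C : ℝ, ∀ d x, ∀ v : TangentSpace (𝓡 n) x,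
    |dAt (f d) x v| ≤ C * ‖v‖
  lyapunov : ∃ ν lam : ℝ, 1 ≤ ν ∧ ∀ x, x ∉ cutLocus o →
    generator E f (fun y => dist o y ^ 2) x ≤ ν + lam * dist o x ^ 2

/-- For arbitrarily large exponents `q`, the function `r ^ q` is of class `C⁴` and its iterated
frame derivatives of order `k ≤ 4` are bounded by `C (1 + r ^ (q - k))`. -/
def DistPowerBounds {D : ℕ} (E : Fin D → (x : M) → TangentSpace (𝓡 n) x) (o : M) : Prop :=
  ∀ Q : ℝ, ∃ q : ℝ, Q ≤ q ∧
    ContMDiff (𝓡 n) 𝓘(ℝ, ℝ) 4 (fun x => dist o x ^ q) ∧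
    ∃ C : ℝ, ∀ w : List (Fin D), w.length ≤ 4 → ∀ x,
      |iterD E w (fun y => dist o y ^ q) x| ≤ C * (1 + dist o x ^ (q - (w.length : ℝ)))

/-- Linear differential operators (of finite order, with smooth coefficients), written in the
frame: `A φ = ∑ w ∈ W, a w · E_{w}[φ]` with `W` a finite set of words. -/
def IsLinDiffOp {D : ℕ} (E : Fin D → (x : M) → TangentSpace (𝓡 n) x)
    (A : (M → ℝ) → (M → ℝ)) : Prop :=
  ∃ (W : Finset (List (Fin D))) (a : List (Fin D) → M → ℝ),
    (∀ w ∈ W, ContMDiff (𝓡 n) 𝓘(ℝ, ℝ) ∞ (a w)) ∧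
    ∀ φ : M → ℝ, ContMDiff (𝓡 n) 𝓘(ℝ, ℝ) ∞ φ → ∀ x, A φ x = ∑ w ∈ W, a w x * iterD E w φ x

open Classical in
/-- The time-one flow `exp(V) p` of a complete vector field: the value at time `1` of the solution
of `y' = V(y)`, `y(0) = p` (with the convention `exp(V) p = p` if there is no global solution,
which does not occur for a bounded smooth vector field on a complete manifold). -/
def expFlow (V : (x : M) → TangentSpace (𝓡 n) x) (p : M) : M :=
  if h : ∃ γ : ℝ → M, γ 0 = p ∧ IsMIntegralCurve (I := 𝓡 n) γ V then h.choose 1 else p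

/-- The composition `exp(∑ d, c K d • E d) ∘ ⋯ ∘ exp(∑ d, c 1 d • E d)` of frozen flows
(the factor with the smallest index acts first). -/
def flowProd {D K : ℕ} (E : Fin D → (x : M) → TangentSpace (𝓡 n) x)
    (c : Fin K → Fin D → ℝ) (p : M) : M :=
  Fin.foldl K (fun y k => expFlow (frozenField E (c k)) y) p

end Geometry

/-! ## Stochastic frozen flow methods -/

/-- The deterministic coefficients of a stochastic frozen flow method with `s` stages, `K`
exponentials per stage and `L` random variables per frame direction. The random coefficients are
`Z^d_{i,k} = ∑ l, Zhat i k l * ξ^{d,l}` and `z^d_k = ∑ l, zhat k l * ξ^{d,l}`. -/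
structure Tableau (s K L : ℕ) where
  Z0 : Fin s → Fin s → Fin K → ℝ
  Zhat : Fin s → Fin K → Fin L → ℝ
  z0 : Fin s → Fin K → ℝ
  zhat : Fin K → Fin L → ℝ

namespace Tableau

variable {s K L : ℕ}

/-- Explicit methods: the `i`-th stage only uses the stages `j < i`. -/
def IsExplicit (m : Tableau s K L) : Prop := ∀ i j k, i ≤ j → m.Z0 i j k = 0

/-- Consistency with `dX = F dt + √2 ∑ d, E_d ∘ dW_d`: the total drift weight is `1`, and the
total noise increment `√h ∑ k, z^d_k` in each direction has variance `2 h`. -/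
def IsConsistent (m : Tableau s K L) : Prop :=
  ∑ i, ∑ k, m.z0 i k = 1 ∧ ∑ l, (∑ k, m.zhat k l) ^ 2 = 2

variable {n D : ℕ} {M : Type*} [MetricSpace M] [ChartedSpace (EuclideanSpace ℝ (Fin n)) M]

/-- The internal stages `H^i` of an explicit method, computed successively, with time step `h`,
from the point `x` and the realisation `ξ` of the noise. -/
def stage (m : Tableau s K L) (E : Fin D → (x : M) → TangentSpace (𝓡 n) x)
    (f : Fin D → M → ℝ) (h : ℝ) (x : M) (ξ : Fin D → Fin L → ℝ) (i : Fin s) : M :=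
  flowProd E (fun k d =>
    h * (∑ j : Fin s, if _hj : j < i then m.Z0 i j k * f d (stage m E f h x ξ j) else 0)
      + √h * ∑ l, m.Zhat i k l * ξ d l) x
termination_by i

/-- For an explicit method, the stages satisfy the stage equations with the full sum over `j`. -/
theorem stage_eq (m : Tableau s K L) (hm : m.IsExplicit)
    (E : Fin D → (x : M) → TangentSpace (𝓡 n) x)
    (f : Fin D → M → ℝ) (h : ℝ) (x : M) (ξ : Fin D → Fin L → ℝ) (i : Fin s) :
    m.stage E f h x ξ i = flowProd E (fun k d =>
      h * (∑ j, m.Z0 i j k * f d (m.stage E f h x ξ j))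
        + √h * ∑ l, m.Zhat i k l * ξ d l) x := by
  rw [stage]
  congr 1
  funext k d
  congr 2
  refine Finset.sum_congr rfl fun j _ => ?_
  by_cases hj : j < i
  · simp [hj]
  · simp [hj, hm i j k (not_lt.mp hj)]

/-- One step of the method: the random map `x ↦ Φ_h(x)` for the realisation `ξ` of the noise. -/
def step (m : Tableau s K L) (E : Fin D → (x : M) → TangentSpace (𝓡 n) x)
    (f : Fin D → M → ℝ) (h : ℝ) (x : M) (ξ : Fin D → Fin L → ℝ) : M :=
  flowProd E (fun k d =>
    h * (∑ i, m.z0 i k * f d (m.stage E f h x ξ i)) + √h * ∑ l, m.zhat k l * ξ d l) x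

/-- The numerical trajectory `X_{N+1} = Φ_h(X_N)`, driven by the noise `ξ_N` at the `N`-th step. -/
def traj (m : Tableau s K L) (E : Fin D → (x : M) → TangentSpace (𝓡 n) x)
    (f : Fin D → M → ℝ) (h : ℝ) (x : M) (ξ : ℕ → Fin D → Fin L → ℝ) : ℕ → M
  | 0 => x
  | N + 1 => m.step E f h (m.traj E f h x ξ N) (ξ N)

end Tableau

/-- The driving noise of a method of order parameter `p`: the `ξ N d l` are mutually independent,
with the same laws at every step `N`, have finite moments of all orders, vanishing odd moments,
and the same first `2 p` moments as a standard Gaussian variable. Independent standard Gaussian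
variables satisfy this for every `p`. -/
structure IsNoise {Ω : Type*} [MeasurableSpace Ω] (P : Measure Ω) (p : ℕ) {D L : ℕ}
    (ξ : ℕ → Fin D → Fin L → Ω → ℝ) : Prop where
  measurable : ∀ N d l, Measurable (ξ N d l)
  indep : iIndepFun (fun a : ℕ × Fin D × Fin L => ξ a.1 a.2.1 a.2.2) P
  identDistrib : ∀ N d l, IdentDistrib (ξ N d l) (ξ 0 d l) P P
  integrable : ∀ N d l (k : ℕ), Integrable (fun η => ξ N d l η ^ k) P
  odd_moment : ∀ N d l (k : ℕ), Odd k → ∫ η, ξ N d l η ^ k ∂P = 0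
  gaussian_moment : ∀ N d l (k : ℕ), k ≤ 2 * p →
    ∫ η, ξ N d l η ^ k ∂P = ∫ y, y ^ k ∂(gaussianReal 0 1)

end

end FrozenFlow

/-!
Both claims rest on Taylor's formula along a single frozen flow. On a complete Riemannian manifold
a bounded smooth vector field is complete (`exists_global_integralCurve`), a frozen flow moves
points by at most `B ∑ |c d|`, and it depends continuously on its coefficients and its starting
point (`continuous_expFlow`). Differentiating `φ` along the integral curve only produces frame
derivatives, so
`φ(exp(∑ c d E_d) p) = ∑ k < m, 1 / k! ∑ |w| = k, c_{w_1} ⋯ c_{w_k} E_w[φ](p) + remainder`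
(`abs_expFlow_sub_wordSum_le`), the remainder being controlled by the frame derivatives of order
`m` along the curve. Differentiability of the flow in its coefficients is never needed. With
`ε = √h`, all coefficients occurring in a step are bounded by `C ε (1 + r(x)) (1 + ‖ξ‖)`, because
the coordinates of the drift are Lipschitz and the stages grow linearly (`step_incr_growth`).

*Bounded moments.* For `ψ = r ^ q`, each frame derivative lowers the degree of growth by one, while
each coefficient raises it by one. The second-order Taylor formula thus shows that `ψ` changes in
one step by a linear form in the noise, of order `ε`, up to `C ε² (1 + r) ^ q (1 + ‖ξ‖) ^ q`
(`step_rpow_dist`). The linear form is centred, so `E[1 + ψ(X₁)] ≤ (1 + C h) (1 + ψ(x))`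
(`integral_step_rpow_le`). The position `X_j` is independent of the noise of step `j`, and
the estimate is iterated at most `T / h` times (`bounded_moments`).

*Talay–Tubaro expansion.* Symbols are the linear combinations of `ε ^ k g(x) ξ ^ α` with `g` smooth
of polynomial growth and `k + |α|` even. Up to `O(ε ^ m)` with polynomial growth in `x` and `ξ`,
every test function composed with a stage or with the step is given by a differential operator in
the frame with symbols as coefficients. This propagates through compositions of frozen flows by
Taylor's formula (`Expands.expFlow`), and through the stages because the coordinates of the drift
are themselves test functions (`expands_step`). The expectation of a monomial with odd `k` vanishes
since `|α|` is odd as well, and what remains is a polynomial in `h = ε²` whose coefficients are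
differential operators (`hasMeanExpansion_of_mem`). Taking `m = 2 p + 2` gives the expansion, and
setting `ε = 0` identifies its zeroth term (`talay_tubaro`).
-/

namespace FrozenFlow

open MeasureTheory ProbabilityTheory Set Filter Topology

/-! ### Smoothness of frame derivatives and the chain rule along integral curves -/

section Smoothness

variable {n : ℕ} {M : Type*} [MetricSpace M] [ChartedSpace (EuclideanSpace ℝ (Fin n)) M]
  [IsManifold (𝓡 n) ∞ M]

/-- Smoothness of a vector field, as a section of the tangent bundle. -/
abbrev SmoothField (V : (x : M) → TangentSpace (𝓡 n) x) : Prop :=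
  ContMDiff (𝓡 n) (𝓡 n).tangent ∞ (fun x => (⟨x, V x⟩ : TangentBundle (𝓡 n) M))

/-- Differentiating along a smooth vector field loses one degree of smoothness. -/
theorem contMDiffOn_mfderiv_apply {F : Type*} [NormedAddCommGroup F] [NormedSpace ℝ F]
    {φ : M → F} {u : Set M} (hu : IsOpen u) {k m : ℕ∞ω}
    (hφ : ContMDiffOn (𝓡 n) 𝓘(ℝ, F) k φ u) (hmk : m + 1 ≤ k) (hm : m ≤ ∞)
    {V : (x : M) → TangentSpace (𝓡 n) x} (hV : SmoothField V) :
    ContMDiffOn (𝓡 n) 𝓘(ℝ, F) m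
      (fun x => (mfderiv (𝓡 n) 𝓘(ℝ, F) φ x (V x) : F)) u := by
  have h1 := hφ.contMDiffOn_tangentMapWithin hmk hu.uniqueMDiffOn
  have h2 : ContMDiffOn (𝓡 n) 𝓘(ℝ, F).tangent m
      (fun x => tangentMapWithin (𝓡 n) 𝓘(ℝ, F) φ u ⟨x, V x⟩) u :=
    h1.comp (hV.of_le hm).contMDiffOn (fun x hx => hx)
  have h3 := (contMDiff_snd_tangentBundle_modelSpace (n := m) F 𝓘(ℝ, F)).comp_contMDiffOn h2
  refine h3.congr fun x hx => ?_
  show _ = (mfderivWithin (𝓡 n) 𝓘(ℝ, F) φ u x (V x) : F)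
  rw [mfderivWithin_of_isOpen hu hx]

theorem lieD_contMDiff {V : (x : M) → TangentSpace (𝓡 n) x} (hV : SmoothField V) {φ : M → ℝ}
    {k m : ℕ∞ω} (hφ : ContMDiff (𝓡 n) 𝓘(ℝ, ℝ) k φ) (hmk : m + 1 ≤ k) (hm : m ≤ ∞) :
    ContMDiff (𝓡 n) 𝓘(ℝ, ℝ) m (lieD V φ) := by
  rw [← contMDiffOn_univ] at hφ ⊢
  exact contMDiffOn_mfderiv_apply isOpen_univ hφ hmk hm hV

variable {D : ℕ} {E : Fin D → (x : M) → TangentSpace (𝓡 n) x}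

theorem iterD_contMDiff_infty (hE : IsFrame E) {φ : M → ℝ} (hφ : ContMDiff (𝓡 n) 𝓘(ℝ, ℝ) ∞ φ)
    (w : List (Fin D)) : ContMDiff (𝓡 n) 𝓘(ℝ, ℝ) ∞ (iterD E w φ) := by
  induction w with
  | nil => exact hφ
  | cons d w ih => exact lieD_contMDiff (hE.smooth d) ih (by simp) le_rfl

theorem iterD_contMDiff_nat (hE : IsFrame E) {φ : M → ℝ} {k : ℕ}
    (hφ : ContMDiff (𝓡 n) 𝓘(ℝ, ℝ) k φ) (w : List (Fin D)) {m : ℕ} (hm : w.length + m ≤ k) :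
    ContMDiff (𝓡 n) 𝓘(ℝ, ℝ) m (iterD E w φ) := by
  induction w generalizing m with
  | nil => exact hφ.of_le (by simpa using hm)
  | cons d w ih =>
    have h := ih (m := m + 1) (by simp at hm; omega)
    exact lieD_contMDiff (hE.smooth d) h (by push_cast; rfl) (mod_cast le_top)

theorem frozenField_smooth (hE : IsFrame E) (c : Fin D → ℝ) : SmoothField (frozenField E c) := by
  unfold SmoothField frozenField
  exact ContMDiff.sum_section fun d _ => ContMDiff.smul_section contMDiff_const (hE.smooth d)

theorem SmoothField.neg {V : (x : M) → TangentSpace (𝓡 n) x} (hV : SmoothField V) :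
    SmoothField (-V) :=
  ContMDiff.neg_section hV

omit [IsManifold (𝓡 n) ∞ M] in
/-- Chain rule along a curve with velocity `V`. -/
theorem hasDerivAt_comp_curve {V : (x : M) → TangentSpace (𝓡 n) x} {γ : ℝ → M} {t : ℝ}
    (hγ : HasMFDerivAt 𝓘(ℝ, ℝ) (𝓡 n) γ t ((1 : ℝ →L[ℝ] ℝ).smulRight (V (γ t))))
    {F : Type*} [NormedAddCommGroup F] [NormedSpace ℝ F] {φ : M → F}
    (hφ : MDifferentiableAt (𝓡 n) 𝓘(ℝ, F) φ (γ t)) :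
    HasDerivAt (fun s => φ (γ s)) (mfderiv (𝓡 n) 𝓘(ℝ, F) φ (γ t) (V (γ t)) : F) t := by
  have h := HasMFDerivAt.comp t hφ.hasMFDerivAt hγ
  rw [hasMFDerivAt_iff_hasFDerivAt] at h
  have key : ∀ L : ℝ →L[ℝ] F, HasFDerivAt (fun s => φ (γ s)) L t →
      HasDerivAt (fun s => φ (γ s)) (L 1) t := fun L hL => hL.hasDerivAt
  have h3 : (mfderiv (𝓡 n) 𝓘(ℝ, F) φ (γ t) (V (γ t)) : F)
      = mfderiv (𝓡 n) 𝓘(ℝ, F) φ (γ t) (((1 : ℝ →L[ℝ] ℝ) 1) • (V (γ t))) := by simp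
  rw [h3]
  exact key _ h

omit [IsManifold (𝓡 n) ∞ M] in
theorem hasDerivAt_comp_frozen {c : Fin D → ℝ} {γ : ℝ → M}
    (hγ : IsMIntegralCurve (I := 𝓡 n) γ (frozenField E c)) {φ : M → ℝ}
    (hφ : ContMDiff (𝓡 n) 𝓘(ℝ, ℝ) 1 φ) (t : ℝ) :
    HasDerivAt (fun s => φ (γ s)) (∑ d, c d * lieD (E d) φ (γ t)) t := by
  have h := hasDerivAt_comp_curve (hγ t) (hφ.mdifferentiable one_ne_zero (γ t))
  convert h using 1
  simp only [frozenField, lieD, dAt, map_sum, map_smul]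
  rfl

end Smoothness

/-! ### Curves of bounded speed -/

section Curves

variable {n : ℕ} {M : Type*} [MetricSpace M] [ChartedSpace (EuclideanSpace ℝ (Fin n)) M]
  [IsManifold (𝓡 n) ∞ M]

/-- The velocity of a curve following `V`, read in the chart at `p`, as a function of the position
on the manifold. -/
noncomputable def chartVelocity (p : M) (V : (x : M) → TangentSpace (𝓡 n) x) (x : M) :
    EuclideanSpace ℝ (Fin n) :=
  mfderiv (𝓡 n) 𝓘(ℝ, EuclideanSpace ℝ (Fin n)) (extChartAt (𝓡 n) p) x (V x)

theorem chartVelocity_contMDiffOn (p : M) {V : (x : M) → TangentSpace (𝓡 n) x}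
    (hV : SmoothField V) :
    ContMDiffOn (𝓡 n) 𝓘(ℝ, EuclideanSpace ℝ (Fin n)) ∞ (chartVelocity p V)
      (extChartAt (𝓡 n) p).source := by
  refine contMDiffOn_mfderiv_apply (k := ∞) (isOpen_extChartAt_source p) ?_ (by simp) le_rfl hV
  have := contMDiffOn_extChartAt (I := 𝓡 n) (n := ∞) (x := p)
  rwa [← extChartAt_source (𝓡 n)] at this

theorem hasDerivAt_chart_comp {V : (x : M) → TangentSpace (𝓡 n) x} {γ : ℝ → M} {t : ℝ} {p : M}
    (hγ : HasMFDerivAt 𝓘(ℝ, ℝ) (𝓡 n) γ t ((1 : ℝ →L[ℝ] ℝ).smulRight (V (γ t))))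
    (hp : γ t ∈ (extChartAt (𝓡 n) p).source) :
    HasDerivAt (fun s => extChartAt (𝓡 n) p (γ s)) (chartVelocity p V (γ t)) t := by
  refine hasDerivAt_comp_curve hγ (mdifferentiableAt_extChartAt ?_)
  rwa [extChartAt_source] at hp

/-- A curve following a smooth vector field is of class `C¹`, so that its Riemannian length bounds
the distance between its end points. -/
theorem contMDiffOn_of_velocity {V : (x : M) → TangentSpace (𝓡 n) x} (hV : SmoothField V)
    {γ : ℝ → M} {J : Set ℝ} (hJ : IsOpen J)
    (hγ : ∀ t ∈ J, HasMFDerivAt 𝓘(ℝ, ℝ) (𝓡 n) γ t ((1 : ℝ →L[ℝ] ℝ).smulRight (V (γ t)))) :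
    ContMDiffOn 𝓘(ℝ, ℝ) (𝓡 n) 1 γ J := by
  intro t₀ ht₀
  refine ContMDiffAt.contMDiffWithinAt ?_
  have hcont : ContinuousOn γ J := fun t ht => (hγ t ht).continuousAt.continuousWithinAt
  rw [contMDiffAt_iff_target]
  refine ⟨(hγ t₀ ht₀).continuousAt, ?_⟩
  rw [contMDiffAt_iff_contDiffAt, contDiffAt_one_iff]
  set S := (extChartAt (𝓡 n) (γ t₀)).source
  refine ⟨fun t => ContinuousLinearMap.toSpanSingleton ℝ (chartVelocity (γ t₀) V (γ t)),
    J ∩ γ ⁻¹' S, ?_, ?_, ?_⟩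
  · exact (hcont.isOpen_inter_preimage hJ (isOpen_extChartAt_source _)).mem_nhds
      ⟨ht₀, mem_extChartAt_source (I := 𝓡 n) (γ t₀)⟩
  · have h1 : ContinuousOn (fun t => chartVelocity (γ t₀) V (γ t)) (J ∩ γ ⁻¹' S) :=
      (chartVelocity_contMDiffOn (γ t₀) hV).continuousOn.comp (hcont.mono inter_subset_left)
        fun t ht => ht.2
    exact (ContinuousLinearMap.toSpanSingletonCLE (𝕜 := ℝ)
      (E := EuclideanSpace ℝ (Fin n))).continuous.comp_continuousOn h1
  · intro t ht
    exact (hasDerivAt_chart_comp (hγ t ht.1) ht.2).hasFDerivAt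

variable [Bundle.RiemannianBundle (fun x : M => TangentSpace (𝓡 n) x)]
  [IsRiemannianManifold (𝓡 n) M]

/-- A curve of speed at most `B` is `B`-Lipschitz. -/
theorem dist_le_of_velocity {V : (x : M) → TangentSpace (𝓡 n) x} (hV : SmoothField V)
    {B : ℝ} (hB : ∀ x, ‖V x‖ ≤ B) {γ : ℝ → M} {J : Set ℝ} (hJ : IsOpen J)
    (hγ : ∀ t ∈ J, HasMFDerivAt 𝓘(ℝ, ℝ) (𝓡 n) γ t ((1 : ℝ →L[ℝ] ℝ).smulRight (V (γ t))))
    {a b : ℝ} (hab : a ≤ b) (h : Icc a b ⊆ J) : dist (γ a) (γ b) ≤ B * (b - a) := by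
  have hB0 : 0 ≤ B := (norm_nonneg _).trans (hB (γ a))
  have h1 : edist (γ a) (γ b) ≤ Manifold.pathELength (𝓡 n) γ a b := by
    rw [IsRiemannianManifold.out (I := 𝓡 n) (γ a) (γ b)]
    exact Manifold.riemannianEDist_le_pathELength ((contMDiffOn_of_velocity hV hJ hγ).mono h)
      rfl rfl hab
  have h2 : Manifold.pathELength (𝓡 n) γ a b ≤ ENNReal.ofReal (B * (b - a)) := by
    rw [Manifold.pathELength_eq_lintegral_mfderiv_Icc]
    calc _ ≤ ∫⁻ _ in Icc a b, ENNReal.ofReal B := by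
          refine setLIntegral_mono measurable_const fun t ht => ?_
          rw [(hγ t (h ht)).mfderiv]
          have : (((1 : ℝ →L[ℝ] ℝ).smulRight (V (γ t))) (1 : ℝ) : TangentSpace (𝓡 n) (γ t))
            = V (γ t) := by simp
          erw [this]
          rw [← ofReal_norm]
          exact ENNReal.ofReal_le_ofReal (hB _)
      _ = _ := by
          simp [ENNReal.ofReal_mul hB0]
  have h3 := h1.trans h2
  rw [edist_dist] at h3
  exact (ENNReal.ofReal_le_ofReal_iff (mul_nonneg hB0 (sub_nonneg.2 hab))).1 h3

end Curves

/-! ### Completeness of bounded vector fields -/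

section GlobalCurves

variable {n : ℕ} {M : Type*} [MetricSpace M] [ChartedSpace (EuclideanSpace ℝ (Fin n)) M]
  [IsManifold (𝓡 n) ∞ M]

theorem chartVelocity_self (V : (x : M) → TangentSpace (𝓡 n) x) (p : M) :
    chartVelocity p V p = V p := by
  unfold chartVelocity
  have h : p ∈ (chartAt (EuclideanSpace ℝ (Fin n)) p).source := mem_chart_source _ p
  have h1 : mfderiv (𝓡 n) 𝓘(ℝ, EuclideanSpace ℝ (Fin n)) (extChartAt (𝓡 n) p) p
      = tangentCoordChange (𝓡 n) p p p := mfderiv_chartAt_eq_tangentCoordChange h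
  refine (congrArg (fun L => L (V p)) h1).trans ?_
  exact tangentCoordChange_self (I := 𝓡 n) (mem_extChartAt_source (I := 𝓡 n) p)

/-- A continuous curve which follows `V` on both sides of `t₀` follows it at `t₀` as well. -/
theorem hasMFDerivAt_of_eventually_ne {V : (x : M) → TangentSpace (𝓡 n) x} (hV : SmoothField V)
    {γ : ℝ → M} {t₀ : ℝ} (hc : ContinuousAt γ t₀)
    (hγ : ∀ᶠ t in 𝓝[≠] t₀,
      HasMFDerivAt 𝓘(ℝ, ℝ) (𝓡 n) γ t ((1 : ℝ →L[ℝ] ℝ).smulRight (V (γ t)))) :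
    HasMFDerivAt 𝓘(ℝ, ℝ) (𝓡 n) γ t₀ ((1 : ℝ →L[ℝ] ℝ).smulRight (V (γ t₀))) := by
  set p := γ t₀ with hp
  set f : ℝ → EuclideanSpace ℝ (Fin n) := fun t => extChartAt (𝓡 n) p (γ t) with hf
  have hsrc : ∀ᶠ t in 𝓝 t₀, γ t ∈ (extChartAt (𝓡 n) p).source :=
    hc.preimage_mem_nhds (extChartAt_source_mem_nhds p)
  have hd : ∀ᶠ t in 𝓝[≠] t₀, HasDerivAt f (chartVelocity p V (γ t)) t := by
    filter_upwards [hγ, hsrc.filter_mono nhdsWithin_le_nhds] with t h1 h2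
    exact hasDerivAt_chart_comp h1 h2
  have hfc : ContinuousAt f t₀ :=
    ContinuousAt.comp (g := extChartAt (𝓡 n) p) (continuousAt_extChartAt p) hc
  have hvel : Tendsto (fun t => chartVelocity p V (γ t)) (𝓝 t₀) (𝓝 (chartVelocity p V p)) :=
    ContinuousAt.comp (g := chartVelocity p V) (f := γ)
      ((chartVelocity_contMDiffOn p hV).continuousOn.continuousAt (extChartAt_source_mem_nhds p)) hc
  rw [eventually_nhdsWithin_iff, Metric.eventually_nhds_iff] at hd
  obtain ⟨δ, hδ, hd⟩ := hd
  have hR : ∀ t ∈ Ioo t₀ (t₀ + δ), HasDerivAt f (chartVelocity p V (γ t)) t := fun t ht =>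
    hd (by rw [Real.dist_eq, abs_lt]; constructor <;> linarith [ht.1, ht.2]) ht.1.ne'
  have hL : ∀ t ∈ Ioo (t₀ - δ) t₀, HasDerivAt f (chartVelocity p V (γ t)) t := fun t ht =>
    hd (by rw [Real.dist_eq, abs_lt]; constructor <;> linarith [ht.1, ht.2]) ht.2.ne
  have hRm : Ioo t₀ (t₀ + δ) ∈ 𝓝[>] t₀ := Ioo_mem_nhdsGT (by linarith)
  have hLm : Ioo (t₀ - δ) t₀ ∈ 𝓝[<] t₀ := Ioo_mem_nhdsLT (by linarith)
  have A : HasDerivWithinAt f (chartVelocity p V p) (Ici t₀) t₀ := by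
    refine hasDerivWithinAt_Ici_of_tendsto_deriv (s := Ioo t₀ (t₀ + δ))
      (fun t ht => (hR t ht).differentiableAt.differentiableWithinAt) hfc.continuousWithinAt hRm ?_
    refine (hvel.mono_left nhdsWithin_le_nhds).congr' ?_
    filter_upwards [hRm] with t ht using (hR t ht).deriv.symm
  have B : HasDerivWithinAt f (chartVelocity p V p) (Iic t₀) t₀ := by
    refine hasDerivWithinAt_Iic_of_tendsto_deriv (s := Ioo (t₀ - δ) t₀)
      (fun t ht => (hL t ht).differentiableAt.differentiableWithinAt) hfc.continuousWithinAt hLm ?_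
    refine (hvel.mono_left nhdsWithin_le_nhds).congr' ?_
    filter_upwards [hLm] with t ht using (hL t ht).deriv.symm
  have key : HasDerivAt f (chartVelocity p V p) t₀ := by simpa using B.union A
  rw [chartVelocity_self] at key
  have key2 : ∀ v : EuclideanSpace ℝ (Fin n), HasDerivAt f v t₀ →
      HasFDerivWithinAt f ((1 : ℝ →L[ℝ] ℝ).smulRight v) univ t₀ :=
    fun v hv => hv.hasFDerivAt.hasFDerivWithinAt
  refine ⟨hc, ?_⟩
  simp only [mfld_simps]
  exact key2 _ key

variable [Bundle.RiemannianBundle (fun x : M => TangentSpace (𝓡 n) x)]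
  [IsRiemannianManifold (𝓡 n) M] [CompleteSpace M]

/-- A curve of bounded speed defined on `(a, b)` has a limit at `b`. -/
theorem exists_tendsto_of_velocity {V : (x : M) → TangentSpace (𝓡 n) x} (hV : SmoothField V)
    {B : ℝ} (hB : ∀ x, ‖V x‖ ≤ B) {γ : ℝ → M} {a b : ℝ} (hab : a < b)
    (hγ : IsMIntegralCurveOn (I := 𝓡 n) γ V (Ioo a b)) :
    ∃ p, Tendsto γ (𝓝[<] b) (𝓝 p) := by
  have hB0 : 0 ≤ B := (norm_nonneg _).trans (hB (γ a))
  have hγ' : ∀ t ∈ Ioo a b,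
      HasMFDerivAt 𝓘(ℝ, ℝ) (𝓡 n) γ t ((1 : ℝ →L[ℝ] ℝ).smulRight (V (γ t))) :=
    fun t ht => (hγ t ht).hasMFDerivAt (isOpen_Ioo.mem_nhds ht)
  have hlip : ∀ s ∈ Ioo a b, ∀ t ∈ Ioo a b, s ≤ t → dist (γ s) (γ t) ≤ B * (t - s) :=
    fun s hs t ht hst => dist_le_of_velocity hV hB isOpen_Ioo hγ' hst
      fun u hu => ⟨hs.1.trans_le hu.1, hu.2.trans_lt ht.2⟩
  rw [← cauchy_map_iff_exists_tendsto, Metric.cauchy_iff]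
  refine ⟨inferInstance, fun ε hε => ?_⟩
  have hη : 0 < ε / (B + 1) := by positivity
  refine ⟨γ '' (Ioo (max a (b - ε / (B + 1))) b),
    image_mem_map (Ioo_mem_nhdsLT (by simp [hab, hη])), ?_⟩
  have hB1 : B * (ε / (B + 1)) < ε := by
    rw [mul_div_assoc', div_lt_iff₀ (by positivity)]; nlinarith
  have main : ∀ s ∈ Ioo (max a (b - ε / (B + 1))) b, ∀ t ∈ Ioo (max a (b - ε / (B + 1))) b,
      s ≤ t → dist (γ s) (γ t) < ε := by
    intro s hs t ht hst
    have h1 := max_lt_iff.1 hs.1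
    have h2 := max_lt_iff.1 ht.1
    refine (hlip s ⟨h1.1, hs.2⟩ t ⟨h2.1, ht.2⟩ hst).trans_lt (lt_of_le_of_lt ?_ hB1)
    exact mul_le_mul_of_nonneg_left (by linarith [ht.2]) hB0
  rintro _ ⟨s, hs, rfl⟩ _ ⟨t, ht, rfl⟩
  rcases le_total s t with hst | hst
  · exact main s hs t ht hst
  · rw [dist_comm]; exact main t ht s hs hst

/-- An integral curve of a bounded field on `(a, b)` extends beyond `b`. -/
theorem exists_extension_right {V : (x : M) → TangentSpace (𝓡 n) x} (hV : SmoothField V)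
    {B : ℝ} (hB : ∀ x, ‖V x‖ ≤ B) {γ : ℝ → M} {a b : ℝ} (hab : a < b)
    (hγ : IsMIntegralCurveOn (I := 𝓡 n) γ V (Ioo a b)) :
    ∃ ε > 0, ∃ η : ℝ → M, IsMIntegralCurveOn (I := 𝓡 n) η V (Ioo a (b + ε)) ∧
      EqOn η γ (Iio b) := by
  obtain ⟨p, hp⟩ := exists_tendsto_of_velocity hV hB hab hγ
  obtain ⟨δ, hδb, hδ⟩ := exists_isMIntegralCurveAt_of_contMDiffAt_boundaryless (I := 𝓡 n)
    (v := V) b (x₀ := p) ((hV.of_le (by simp)).contMDiffAt)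
  obtain ⟨ε, hε, hδ⟩ := isMIntegralCurveAt_iff'.1 hδ
  have hδ' : ∀ t ∈ Metric.ball b ε,
      HasMFDerivAt 𝓘(ℝ, ℝ) (𝓡 n) δ t ((1 : ℝ →L[ℝ] ℝ).smulRight (V (δ t))) :=
    fun t ht => (hδ t ht).hasMFDerivAt (Metric.isOpen_ball.mem_nhds ht)
  have hγ' : ∀ t ∈ Ioo a b,
      HasMFDerivAt 𝓘(ℝ, ℝ) (𝓡 n) γ t ((1 : ℝ →L[ℝ] ℝ).smulRight (V (γ t))) :=
    fun t ht => (hγ t ht).hasMFDerivAt (isOpen_Ioo.mem_nhds ht)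
  set η : ℝ → M := fun t => if t < b then γ t else δ t with hη
  have hηγ : ∀ t < b, η t = γ t := fun t ht => if_pos ht
  have hηδ : ∀ t, b ≤ t → η t = δ t := fun t ht => if_neg (not_lt.2 ht)
  have hleft : ∀ t ∈ Ioo a b,
      HasMFDerivAt 𝓘(ℝ, ℝ) (𝓡 n) η t ((1 : ℝ →L[ℝ] ℝ).smulRight (V (η t))) := by
    intro t ht
    rw [hηγ t ht.2]
    exact (hγ' t ht).congr_of_eventuallyEq
      (by filter_upwards [Iio_mem_nhds ht.2] with s hs using hηγ s hs)
  have hright : ∀ t ∈ Ioo b (b + ε),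
      HasMFDerivAt 𝓘(ℝ, ℝ) (𝓡 n) η t ((1 : ℝ →L[ℝ] ℝ).smulRight (V (η t))) := by
    intro t ht
    rw [hηδ t ht.1.le]
    exact (hδ' t (by rw [Real.ball_eq_Ioo]; constructor <;> linarith [ht.1, ht.2])
      ).congr_of_eventuallyEq
      (by filter_upwards [Ioi_mem_nhds ht.1] with s hs using hηδ s (le_of_lt hs))
  have hmid : HasMFDerivAt 𝓘(ℝ, ℝ) (𝓡 n) η b ((1 : ℝ →L[ℝ] ℝ).smulRight (V (η b))) := by
    refine hasMFDerivAt_of_eventually_ne hV ?_ ?_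
    · have hb : η b = p := by rw [hηδ b le_rfl, hδb]
      rw [continuousAt_iff_continuous_left'_right', ContinuousWithinAt, ContinuousWithinAt, hb]
      refine ⟨hp.congr' ?_, ?_⟩
      · filter_upwards [self_mem_nhdsWithin] with s hs using (hηγ s hs).symm
      · have h1 : Tendsto δ (𝓝[>] b) (𝓝 p) := by
          rw [← hδb]
          exact (hδ' b (Metric.mem_ball_self hε)).continuousAt.tendsto.mono_left nhdsWithin_le_nhds
        refine h1.congr' ?_
        filter_upwards [self_mem_nhdsWithin] with s hs using (hηδ s (le_of_lt hs)).symm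
    · rw [eventually_nhdsWithin_iff]
      filter_upwards [Ioo_mem_nhds hab (show b < b + ε by linarith)] with s hs hsb
      rcases lt_or_gt_of_ne hsb with h | h
      · exact hleft s ⟨hs.1, h⟩
      · exact hright s ⟨h, hs.2⟩
  refine ⟨ε, hε, η, fun t ht => HasMFDerivAt.hasMFDerivWithinAt ?_, fun t ht => hηγ t ht⟩
  rcases lt_trichotomy t b with h | h | h
  · exact hleft t ⟨ht.1, h⟩
  · rw [h]; exact hmid
  · exact hright t ⟨h, ht.2⟩

/-- An integral curve of a bounded field on a symmetric interval extends to a larger one. -/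
theorem exists_extension_symm {V : (x : M) → TangentSpace (𝓡 n) x} (hV : SmoothField V)
    {B : ℝ} (hB : ∀ x, ‖V x‖ ≤ B) {γ : ℝ → M} {a : ℝ} (ha : 0 < a)
    (hγ : IsMIntegralCurveOn (I := 𝓡 n) γ V (Ioo (-a) a)) :
    ∃ a' > a, ∃ η : ℝ → M, IsMIntegralCurveOn (I := 𝓡 n) η V (Ioo (-a') a') ∧ η 0 = γ 0 := by
  obtain ⟨ε₁, hε₁, γ₁, h₁, he₁⟩ := exists_extension_right hV hB (by linarith) hγ
  -- time reversal turns the left end of the interval into a right end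
  have h₁' : IsMIntegralCurveOn (I := 𝓡 n) (γ₁ ∘ (· * (-1))) (-V) (Ioo (-(a + ε₁)) a) := by
    have h := h₁.comp_mul (-1)
    rw [neg_one_smul] at h
    refine h.mono fun t ht => ?_
    simp only [mem_Ioo, mem_ofPred_eq] at ht ⊢
    constructor <;> linarith [ht.1, ht.2]
  obtain ⟨ε₂, hε₂, γ₂, h₂, he₂⟩ := exists_extension_right hV.neg (B := B)
    (fun x => by simpa using hB x) (by linarith) h₁'
  have h₂' : IsMIntegralCurveOn (I := 𝓡 n) (γ₂ ∘ (· * (-1))) V (Ioo (-(a + ε₂)) (a + ε₁)) := by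
    have h := h₂.comp_mul (-1)
    rw [neg_one_smul, neg_neg] at h
    refine h.mono fun t ht => ?_
    simp only [mem_Ioo, mem_ofPred_eq] at ht ⊢
    constructor <;> linarith [ht.1, ht.2]
  refine ⟨a + min ε₁ ε₂, by simp [hε₁, hε₂], _, h₂'.mono (Ioo_subset_Ioo ?_ ?_), ?_⟩
  · simp
  · simp
  · have e₂ := he₂ (show (0 : ℝ) ∈ Iio a from ha)
    have e₁ := he₁ (show (0 : ℝ) ∈ Iio a from ha)
    simpa [e₁] using e₂

/-- On a complete Riemannian manifold, a bounded smooth vector field is complete. -/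
theorem exists_global_integralCurve {V : (x : M) → TangentSpace (𝓡 n) x} (hV : SmoothField V)
    {B : ℝ} (hB : ∀ x, ‖V x‖ ≤ B) (x : M) :
    ∃ γ : ℝ → M, γ 0 = x ∧ IsMIntegralCurve (I := 𝓡 n) γ V := by
  have hV1 : ContMDiff (𝓡 n) (𝓡 n).tangent 1 (fun x => (⟨x, V x⟩ : TangentBundle (𝓡 n) M)) :=
    hV.of_le (by simp)
  let s : Set ℝ := {a | ∃ γ : ℝ → M, γ 0 = x ∧ IsMIntegralCurveOn (I := 𝓡 n) γ V (Ioo (-a) a)}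
  suffices hbdd : ¬ BddAbove s by
    rw [not_bddAbove_iff] at hbdd
    rw [exists_isMIntegralCurve_iff_exists_isMIntegralCurveOn_Ioo hV1]
    intro a
    obtain ⟨y, ⟨γ, hγ1, hγ2⟩, hlt⟩ := hbdd a
    exact ⟨γ, hγ1, hγ2.mono <| Ioo_subset_Ioo (neg_le_neg hlt.le) hlt.le⟩
  intro hbdd
  obtain ⟨γ₀, hγ₀, hi⟩ := exists_isMIntegralCurveAt_of_contMDiffAt_boundaryless (I := 𝓡 n)
    (v := V) 0 (x₀ := x) hV1.contMDiffAt
  obtain ⟨ε, hε, hi⟩ := isMIntegralCurveAt_iff'.1 hi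
  have hεs : ε ∈ s := ⟨γ₀, hγ₀, by rwa [Real.ball_eq_Ioo, zero_sub, zero_add] at hi⟩
  set A := sSup s with hA
  have hA0 : 0 < A := hε.trans_le (le_csSup hbdd hεs)
  have hex : ∀ a < A, ∃ γ : ℝ → M, γ 0 = x ∧
      IsMIntegralCurveOn (I := 𝓡 n) γ V (Ioo (-a) a) := by
    intro a ha
    obtain ⟨b, ⟨γ, h0, hγ⟩, hab⟩ := exists_lt_of_lt_csSup ⟨ε, hεs⟩ ha
    exact ⟨γ, h0, hγ.mono (Ioo_subset_Ioo (neg_le_neg hab.le) hab.le)⟩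
  have : Nonempty M := ⟨x⟩
  choose! Γ hΓ0 hΓ using hex
  have huniq : ∀ a < A, ∀ b < A, a ≤ b → EqOn (Γ a) (Γ b) (Ioo (-a) a) := by
    intro a ha b hb hab t ht
    have ha0 : 0 < a := by linarith [ht.1, ht.2]
    exact isMIntegralCurveOn_Ioo_eqOn_of_contMDiff_boundaryless (t₀ := 0)
      ⟨by linarith, ha0⟩ hV1 (hΓ a ha) ((hΓ b hb).mono (Ioo_subset_Ioo (by linarith) hab))
      (by rw [hΓ0 a ha, hΓ0 b hb]) ht
  -- the curves on the intervals `(-a, a)`, `a < A`, agree and define a curve on `(-A, A)`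
  set γ : ℝ → M := fun t => Γ ((|t| + A) / 2) t with hγ
  have hγΓ : ∀ a < A, EqOn γ (Γ a) (Ioo (-a) a) := by
    intro a ha t ht
    have h1 : |t| < a := abs_lt.2 ht
    have h2 : (|t| + A) / 2 < A := by linarith
    have h3 : t ∈ Ioo (-((|t| + A) / 2)) ((|t| + A) / 2) := by
      rw [mem_Ioo, ← abs_lt]; linarith
    rcases le_total ((|t| + A) / 2) a with h | h
    · exact huniq _ h2 _ ha h h3
    · exact (huniq _ ha _ h2 h ht).symm
  have hγi : IsMIntegralCurveOn (I := 𝓡 n) γ V (Ioo (-A) A) := by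
    intro t ht
    obtain ⟨a, h1, h2⟩ := exists_between (abs_lt.2 ht)
    have hta : t ∈ Ioo (-a) a := abs_lt.1 h1
    have hm : Ioo (-a) a ∈ 𝓝 t := Ioo_mem_nhds hta.1 hta.2
    refine HasMFDerivAt.hasMFDerivWithinAt ?_
    rw [hγΓ a h2 hta]
    exact ((hΓ a h2 t hta).hasMFDerivAt hm).congr_of_eventuallyEq
      (by filter_upwards [hm] with u hu using hγΓ a h2 hu)
  obtain ⟨A', hA', η, hη, hη0⟩ := exists_extension_symm hV hB hA0 hγi
  have : A' ∈ s := ⟨η, by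
    rw [hη0, hγΓ (A / 2) (by linarith) ⟨by linarith, by linarith⟩, hΓ0 _ (by linarith)], hη⟩
  exact absurd (le_csSup hbdd this) (not_le.2 hA')

variable {D : ℕ} {E : Fin D → (x : M) → TangentSpace (𝓡 n) x}

omit [IsManifold (𝓡 n) ∞ M] [IsRiemannianManifold (𝓡 n) M] [CompleteSpace M] in
theorem norm_frozenField_le {B : ℝ} (hB : ∀ d x, ‖E d x‖ ≤ B) (c : Fin D → ℝ) (x : M) :
    ‖frozenField E c x‖ ≤ B * ∑ d, |c d| := by
  unfold frozenField
  refine (norm_sum_le _ _).trans ?_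
  rw [Finset.mul_sum]
  refine Finset.sum_le_sum fun d _ => ?_
  rw [norm_smul, Real.norm_eq_abs, mul_comm]
  exact mul_le_mul_of_nonneg_right (hB d x) (abs_nonneg _)

/-- The frozen flow `exp(∑ d, c d • E d) p` is the time-one value of an integral curve. -/
theorem exists_curve_expFlow (hE : IsFrame E) {B : ℝ} (hB : ∀ d x, ‖E d x‖ ≤ B) (c : Fin D → ℝ)
    (p : M) : ∃ γ : ℝ → M, γ 0 = p ∧ IsMIntegralCurve (I := 𝓡 n) γ (frozenField E c) ∧
      expFlow (frozenField E c) p = γ 1 := by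
  have h := exists_global_integralCurve (frozenField_smooth hE c) (norm_frozenField_le hB c) p
  refine ⟨h.choose, h.choose_spec.1, h.choose_spec.2, ?_⟩
  rw [expFlow, dif_pos h]

omit [CompleteSpace M] in
theorem dist_frozen_curve_le (hE : IsFrame E) {B : ℝ} (hB : ∀ d x, ‖E d x‖ ≤ B) {c : Fin D → ℝ}
    {γ : ℝ → M} (hγ : IsMIntegralCurve (I := 𝓡 n) γ (frozenField E c)) (s t : ℝ) :
    dist (γ s) (γ t) ≤ B * (∑ d, |c d|) * |t - s| := by
  have key : ∀ s t, s ≤ t → dist (γ s) (γ t) ≤ B * (∑ d, |c d|) * (t - s) := fun s t hst =>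
    dist_le_of_velocity (frozenField_smooth hE c) (norm_frozenField_le hB c) isOpen_univ
      (fun t _ => hγ t) hst (subset_univ _)
  rcases le_total s t with h | h
  · rw [abs_of_nonneg (by linarith)]; exact key s t h
  · rw [abs_of_nonpos (by linarith), dist_comm, neg_sub]; exact key t s h

end GlobalCurves

/-! ### Lipschitz functions and continuity of the frozen flow -/

section Lipschitz

variable {n : ℕ} {M : Type*} [MetricSpace M] [ChartedSpace (EuclideanSpace ℝ (Fin n)) M]
  [Bundle.RiemannianBundle (fun x : M => TangentSpace (𝓡 n) x)] [IsRiemannianManifold (𝓡 n) M]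

/-- A function with differential bounded by `C` is `C`-Lipschitz for the Riemannian distance. -/
theorem abs_sub_le_of_dAt_le {φ : M → ℝ} (hφ : ContMDiff (𝓡 n) 𝓘(ℝ, ℝ) 1 φ) {C : ℝ}
    (hC : 0 ≤ C) (h : ∀ x, ∀ v : TangentSpace (𝓡 n) x, |dAt φ x v| ≤ C * ‖v‖) (x y : M) :
    |φ x - φ y| ≤ C * dist x y := by
  have key : edist (φ x) (φ y) ≤ ENNReal.ofReal C * edist x y := by
    rw [IsRiemannianManifold.out (I := 𝓡 n) x y]
    refine ENNReal.le_of_forall_pos_le_add fun ε hε hlt => ?_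
    have hCC : 0 < C + 1 := by linarith
    have hne : Manifold.riemannianEDist (𝓡 n) x y ≠ ⊤ := by
      rw [← IsRiemannianManifold.out (I := 𝓡 n) x y]; exact edist_ne_top x y
    have hr : Manifold.riemannianEDist (𝓡 n) x y <
        Manifold.riemannianEDist (𝓡 n) x y + ENNReal.ofReal (ε / (C + 1)) :=
      ENNReal.lt_add_right hne (by simp; positivity)
    obtain ⟨γ, h0, h1, hγ, hlen, -⟩ :=
      Manifold.exists_lt_locally_constant_of_riemannianEDist_lt hr zero_lt_one
    have hle : edist (φ x) (φ y) ≤ Manifold.pathELength 𝓘(ℝ, ℝ) (φ ∘ γ) 0 1 := by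
      rw [IsRiemannianManifold.out (I := 𝓘(ℝ, ℝ)) (φ x) (φ y)]
      exact Manifold.riemannianEDist_le_pathELength (hφ.comp hγ).contMDiffOn
        (by simp [h0]) (by simp [h1]) zero_le_one
    have hle2 : Manifold.pathELength 𝓘(ℝ, ℝ) (φ ∘ γ) 0 1 ≤
        ENNReal.ofReal C * Manifold.pathELength (𝓡 n) γ 0 1 := by
      rw [Manifold.pathELength_eq_lintegral_mfderiv_Icc,
        Manifold.pathELength_eq_lintegral_mfderiv_Icc,
        ← lintegral_const_mul' _ _ ENNReal.ofReal_ne_top]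
      refine lintegral_mono fun t => ?_
      rw [mfderiv_comp t (hφ.mdifferentiable one_ne_zero _) (hγ.mdifferentiable one_ne_zero _)]
      have e1 : ‖((mfderiv (𝓡 n) 𝓘(ℝ, ℝ) φ (γ t)).comp (mfderiv 𝓘(ℝ, ℝ) (𝓡 n) γ t)) (1 : ℝ)‖ₑ
          = ENNReal.ofReal |dAt φ (γ t) (mfderiv 𝓘(ℝ, ℝ) (𝓡 n) γ t (1 : ℝ))| := by
        rw [← ofReal_norm, norm_tangentSpace_vectorSpace]
        rfl
      refine e1.le.trans ?_
      rw [← ofReal_norm, ← ENNReal.ofReal_mul hC]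
      exact ENNReal.ofReal_le_ofReal (h _ _)
    calc edist (φ x) (φ y) ≤ ENNReal.ofReal C * Manifold.pathELength (𝓡 n) γ 0 1 := hle.trans hle2
      _ ≤ ENNReal.ofReal C *
          (Manifold.riemannianEDist (𝓡 n) x y + ENNReal.ofReal (ε / (C + 1))) := by
          gcongr
      _ ≤ ENNReal.ofReal C * Manifold.riemannianEDist (𝓡 n) x y + ε := by
          rw [mul_add, ← ENNReal.ofReal_mul hC]
          gcongr
          rw [← ENNReal.ofReal_coe_nnreal]
          apply ENNReal.ofReal_le_ofReal
          rw [mul_div_assoc', div_le_iff₀ hCC]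
          nlinarith [ε.2]
  rw [edist_dist, edist_dist, ← ENNReal.ofReal_mul hC,
    ENNReal.ofReal_le_ofReal_iff (by positivity), Real.dist_eq] at key
  exact key

end Lipschitz

section ChartFields

variable {n : ℕ} {M : Type*} [MetricSpace M] [ChartedSpace (EuclideanSpace ℝ (Fin n)) M]
  {D : ℕ} {E : Fin D → (x : M) → TangentSpace (𝓡 n) x}

theorem chartVelocity_frozen (p : M) (c : Fin D → ℝ) (x : M) :
    chartVelocity p (frozenField E c) x = ∑ d, c d • chartVelocity p (E d) x := by
  simp only [chartVelocity, frozenField, map_sum, map_smul]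
  rfl

variable [IsManifold (𝓡 n) ∞ M]

/-- In the chart at `p`, near `p`, the frame fields are bounded and Lipschitz. -/
theorem exists_ball_chart_lipschitz (hE : IsFrame E) (p : M) :
    ∃ R > 0, ∃ (K : NNReal) (A : ℝ), Metric.ball p R ⊆ (extChartAt (𝓡 n) p).source ∧
      (∀ d, ∀ x ∈ Metric.ball p R, ‖chartVelocity p (E d) x‖ ≤ A) ∧
      ∀ d, LipschitzOnWith K (fun z => chartVelocity p (E d) ((extChartAt (𝓡 n) p).symm z))
        (extChartAt (𝓡 n) p '' Metric.ball p R) := by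
  set e := extChartAt (𝓡 n) p with he
  have hsrc : ∀ᶠ x in 𝓝 p, x ∈ e.source := extChartAt_source_mem_nhds p
  have hsm : ∀ d, ContDiffAt ℝ 1 (fun z => chartVelocity p (E d) (e.symm z)) (e p) := by
    intro d
    rw [← contMDiffAt_iff_contDiffAt]
    have h1 : ContMDiffAt 𝓘(ℝ, EuclideanSpace ℝ (Fin n)) (𝓡 n) 1 e.symm (e p) :=
      (contMDiffOn_extChartAt_symm (I := 𝓡 n) (n := 1) p).contMDiffAt
        (extChartAt_target_mem_nhds p)
    have h2 : ContMDiffAt (𝓡 n) 𝓘(ℝ, EuclideanSpace ℝ (Fin n)) 1 (chartVelocity p (E d))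
        (e.symm (e p)) := by
      rw [extChartAt_to_inv]
      exact ((chartVelocity_contMDiffOn p (hE.smooth d)).contMDiffAt
        (extChartAt_source_mem_nhds p)).of_le (by simp)
    exact h2.comp _ h1
  have hlip := fun d => (hsm d).exists_lipschitzOnWith
  choose K s hs hK using hlip
  have hbd : ∀ᶠ x in 𝓝 p, ∀ d,
      ‖chartVelocity p (E d) x‖ ≤ ∑ d, (‖chartVelocity p (E d) p‖ + 1) := by
    rw [eventually_all]
    intro d
    have hc : ContinuousAt (fun x => ‖chartVelocity p (E d) x‖) p :=
      ((chartVelocity_contMDiffOn p (hE.smooth d)).continuousOn.continuousAt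
        (extChartAt_source_mem_nhds p)).norm
    filter_upwards [hc.eventually_lt_const (lt_add_one _)] with x hx
    refine hx.le.trans ?_
    exact Finset.single_le_sum (f := fun d => ‖chartVelocity p (E d) p‖ + 1)
      (fun i _ => by positivity) (Finset.mem_univ d)
  have hss : ∀ᶠ x in 𝓝 p, ∀ d, e x ∈ s d := by
    rw [eventually_all]
    exact fun d => (continuousAt_extChartAt (I := 𝓡 n) p).preimage_mem_nhds (hs d)
  obtain ⟨R, hR, hball⟩ := Metric.eventually_nhds_iff_ball.1 (hsrc.and (hbd.and hss))
  refine ⟨R, hR, ∑ d, K d, _, fun x hx => (hball x hx).1, fun d x hx => (hball x hx).2.1 d,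
    fun d => ((hK d).mono ?_).weaken
      (Finset.single_le_sum (fun _ _ => zero_le) (Finset.mem_univ d))⟩
  rintro _ ⟨x, hx, rfl⟩
  exact (hball x hx).2.2 d

end ChartFields

section FlowContinuity

variable {n : ℕ} {M : Type*} [MetricSpace M] [ChartedSpace (EuclideanSpace ℝ (Fin n)) M]
  [IsManifold (𝓡 n) ∞ M] [Bundle.RiemannianBundle (fun x : M => TangentSpace (𝓡 n) x)]
  [IsRiemannianManifold (𝓡 n) M]
  {D : ℕ} {E : Fin D → (x : M) → TangentSpace (𝓡 n) x}

theorem tendsto_gronwallBound_zero {ι : Type*} {l : Filter ι} {u v : ι → ℝ} (K x : ℝ)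
    (hu : Tendsto u l (𝓝 0)) (hv : Tendsto v l (𝓝 0)) :
    Tendsto (fun i => gronwallBound (u i) K (v i) x) l (𝓝 0) := by
  by_cases hK : K = 0
  · subst hK
    simp only [gronwallBound_K0]
    simpa using hu.add (hv.mul_const x)
  · simp only [gronwallBound_of_K_ne_0 hK]
    simpa using (hu.mul_const (Real.exp (K * x))).add
      ((hv.div_const K).mul_const (Real.exp (K * x) - 1))

/-- Convergence of frozen integral curves propagates forward through a neighbourhood of any given
time: the speed bound keeps all curves in one chart, where Grönwall's inequality applies. -/
theorem exists_tendsto_propagation (hE : IsFrame E) {B : ℝ} (hB : ∀ d x, ‖E d x‖ ≤ B)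
    {ι : Type*} {l : Filter ι} {c : ι → Fin D → ℝ} {c₀ : Fin D → ℝ} (hc : Tendsto c l (𝓝 c₀))
    {γ : ι → ℝ → M} {γ₀ : ℝ → M}
    (hγ : ∀ i, IsMIntegralCurve (I := 𝓡 n) (γ i) (frozenField E (c i)))
    (hγ₀ : IsMIntegralCurve (I := 𝓡 n) γ₀ (frozenField E c₀)) (t₀ : ℝ) :
    ∃ δ > 0, ∀ s t, t₀ - δ < s → s ≤ t → t < t₀ + δ →
      Tendsto (fun i => γ i s) l (𝓝 (γ₀ s)) → Tendsto (fun i => γ i t) l (𝓝 (γ₀ t)) := by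
  obtain ⟨R, hR, K, A, hsub, hA, hK⟩ := exists_ball_chart_lipschitz hE (γ₀ t₀)
  set p := γ₀ t₀ with hp
  set e := extChartAt (𝓡 n) p with he
  set S : ℝ := (|B| + 1) * ((∑ d, |c₀ d|) + 1) with hS
  have hsum : 0 ≤ ∑ d, |c₀ d| := Finset.sum_nonneg fun _ _ => abs_nonneg _
  have hS0 : 0 < S := by positivity
  have hδ0 : 0 < R / (4 * S) := by positivity
  refine ⟨R / (4 * S), hδ0, fun s t hs hst ht hconv => ?_⟩
  have hSδ : S * (R / (4 * S)) = R / 4 := by field_simp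
  have hspeed : ∀ c' : Fin D → ℝ, ∑ d, |c' d| ≤ (∑ d, |c₀ d|) + 1 → ∀ η : ℝ → M,
      IsMIntegralCurve (I := 𝓡 n) η (frozenField E c') → ∀ a b, dist (η a) (η b) ≤ S * |b - a| := by
    intro c' hc' η hη a b
    refine (dist_frozen_curve_le hE hB hη a b).trans ?_
    refine mul_le_mul_of_nonneg_right ?_ (abs_nonneg _)
    have : 0 ≤ ∑ d, |c' d| := Finset.sum_nonneg fun _ _ => abs_nonneg _
    exact mul_le_mul (by linarith [le_abs_self B]) hc' this (by positivity)
  have hγ₀p : ∀ τ, t₀ - R / (4 * S) < τ → τ < t₀ + R / (4 * S) → dist (γ₀ τ) p < R / 4 := by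
    intro τ h1 h2
    have h3 := hspeed c₀ (by linarith) γ₀ hγ₀ τ t₀
    have h4 : |t₀ - τ| < R / (4 * S) := by rw [abs_lt]; constructor <;> linarith
    calc dist (γ₀ τ) p ≤ S * |t₀ - τ| := h3
      _ < S * (R / (4 * S)) := by gcongr
      _ = R / 4 := hSδ
  have hc1 : ∀ᶠ i in l, ∑ d, |c i d| ≤ (∑ d, |c₀ d|) + 1 := by
    have : Tendsto (fun i => ∑ d, |c i d|) l (𝓝 (∑ d, |c₀ d|)) :=
      tendsto_finsetSum _ fun d _ => ((tendsto_pi_nhds.1 hc) d).abs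
    filter_upwards [this.eventually_lt_const (lt_add_one _)] with i hi using hi.le
  have hs1 : ∀ᶠ i in l, dist (γ i s) (γ₀ s) < R / 4 :=
    (tendsto_iff_dist_tendsto_zero.1 hconv).eventually_lt_const (by positivity)
  have hballi : ∀ᶠ i in l, ∀ τ ∈ Icc s t, γ i τ ∈ Metric.ball p R := by
    filter_upwards [hc1, hs1] with i h1 h2 τ hτ
    have h3 := hspeed (c i) h1 (γ i) (hγ i) τ s
    have h4 : |s - τ| < 2 * (R / (4 * S)) := by
      rw [abs_lt]; constructor <;> linarith [hτ.1, hτ.2]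
    have h5 : S * |s - τ| < R / 2 := by
      calc S * |s - τ| < S * (2 * (R / (4 * S))) := by gcongr
        _ = R / 2 := by rw [mul_left_comm, hSδ]; ring
    have h6 := hγ₀p s hs (by linarith)
    rw [Metric.mem_ball]
    linarith [dist_triangle4 (γ i τ) (γ i s) (γ₀ s) p]
  have hball0 : ∀ τ ∈ Icc s t, γ₀ τ ∈ Metric.ball p R := fun τ hτ => by
    rw [Metric.mem_ball]
    linarith [hγ₀p τ (by linarith [hτ.1]) (by linarith [hτ.2])]
  have hder : ∀ c' : Fin D → ℝ, ∀ η : ℝ → M,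
      IsMIntegralCurve (I := 𝓡 n) η (frozenField E c') → ∀ τ, η τ ∈ Metric.ball p R →
      HasDerivAt (fun u => e (η u)) (∑ d, c' d • chartVelocity p (E d) (η τ)) τ := by
    intro c' η hη τ hτ
    rw [← chartVelocity_frozen]
    exact hasDerivAt_chart_comp (hη τ) (hsub hτ)
  set v : EuclideanSpace ℝ (Fin n) → EuclideanSpace ℝ (Fin n) :=
    fun z => ∑ d, c₀ d • chartVelocity p (E d) (e.symm z) with hv
  have hvlip : LipschitzOnWith (∑ d, ‖c₀ d‖₊ * K) v (e '' Metric.ball p R) := by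
    refine LipschitzOnWith.of_dist_le_mul fun x hx y hy => ?_
    rw [hv]
    refine (dist_sum_sum_le _ _ _).trans ?_
    push_cast
    rw [Finset.sum_mul]
    refine Finset.sum_le_sum fun d _ => ?_
    rw [dist_smul₀, mul_assoc]
    exact mul_le_mul_of_nonneg_left ((hK d).dist_le_mul x hx y hy) (norm_nonneg _)
  have hinv : ∀ x ∈ Metric.ball p R, e.symm (e x) = x := fun x hx => e.left_inv (hsub hx)
  have hgron : ∀ᶠ i in l, dist (e (γ i t)) (e (γ₀ t)) ≤
      gronwallBound (dist (e (γ i s)) (e (γ₀ s))) (∑ d, ‖c₀ d‖₊ * K : NNReal)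
        ((∑ d, |c i d - c₀ d|) * A + 0) (t - s) := by
    filter_upwards [hballi] with i hi
    have hd1 := fun τ hτ => hder (c i) (γ i) (hγ i) τ (hi τ hτ)
    have hd0 := fun τ hτ => hder c₀ γ₀ hγ₀ τ (hball0 τ hτ)
    refine dist_le_of_approx_trajectories_ODE_of_mem (v := fun _ => v)
      (s := fun _ => e '' Metric.ball p R)
      (f := fun τ => e (γ i τ)) (g := fun τ => e (γ₀ τ))
      (f' := fun τ => ∑ d, c i d • chartVelocity p (E d) (γ i τ))
      (g' := fun τ => ∑ d, c₀ d • chartVelocity p (E d) (γ₀ τ))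
      (fun τ _ => hvlip)
      (fun τ hτ => (hd1 τ hτ).continuousAt.continuousWithinAt)
      (fun τ hτ => (hd1 τ (Ico_subset_Icc_self hτ)).hasDerivWithinAt) ?_
      (fun τ hτ => mem_image_of_mem _ (hi τ (Ico_subset_Icc_self hτ)))
      (fun τ hτ => (hd0 τ hτ).continuousAt.continuousWithinAt)
      (fun τ hτ => (hd0 τ (Ico_subset_Icc_self hτ)).hasDerivWithinAt) ?_
      (fun τ hτ => mem_image_of_mem _ (hball0 τ (Ico_subset_Icc_self hτ))) le_rfl t ⟨hst, le_rfl⟩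
    · intro τ hτ
      have hτ' := Ico_subset_Icc_self hτ
      simp only [hv]
      rw [hinv _ (hi τ hτ'), Finset.sum_mul]
      refine (dist_sum_sum_le _ _ _).trans (Finset.sum_le_sum fun d _ => ?_)
      rw [dist_eq_norm, ← sub_smul, norm_smul, Real.norm_eq_abs]
      exact mul_le_mul_of_nonneg_left (hA d _ (hi τ hτ')) (abs_nonneg _)
    · intro τ hτ
      have hτ' := Ico_subset_Icc_self hτ
      simp only [hv]
      rw [hinv _ (hball0 τ hτ'), dist_self]
  have hst' : s ∈ Icc s t := ⟨le_rfl, hst⟩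
  have htt' : t ∈ Icc s t := ⟨hst, le_rfl⟩
  have hes : Tendsto (fun i => dist (e (γ i s)) (e (γ₀ s))) l (𝓝 0) := by
    rw [← tendsto_iff_dist_tendsto_zero]
    exact ContinuousAt.tendsto (continuousAt_extChartAt' (I := 𝓡 n)
      (hsub (hball0 s hst'))) |>.comp hconv
  have hcs : Tendsto (fun i => (∑ d, |c i d - c₀ d|) * A + 0) l (𝓝 0) := by
    have h1 : Tendsto (fun i => ∑ d, |c i d - c₀ d|) l (𝓝 (∑ d : Fin D, |c₀ d - c₀ d|)) :=
      tendsto_finsetSum _ fun d _ => (((tendsto_pi_nhds.1 hc) d).sub_const _).abs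
    simpa using h1.mul_const A
  have het : Tendsto (fun i => e (γ i t)) l (𝓝 (e (γ₀ t))) := by
    rw [tendsto_iff_dist_tendsto_zero]
    exact squeeze_zero' (Eventually.of_forall fun _ => dist_nonneg) hgron
      (tendsto_gronwallBound_zero _ _ hes hcs)
  have hfin : Tendsto (fun i => e.symm (e (γ i t))) l (𝓝 (e.symm (e (γ₀ t)))) :=
    (continuousAt_extChartAt_symm' (I := 𝓡 n) (hsub (hball0 t htt'))).tendsto.comp het
  rw [hinv _ (hball0 t htt')] at hfin
  refine hfin.congr' ?_
  filter_upwards [hballi] with i hi using hinv _ (hi t htt')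

/-- Convergence of the initial points and of the coefficients implies convergence of the integral
curves at all later times, by a continuation argument on `[0, ∞)`. -/
theorem tendsto_frozen_curve (hE : IsFrame E) {B : ℝ} (hB : ∀ d x, ‖E d x‖ ≤ B)
    {ι : Type*} {l : Filter ι} {c : ι → Fin D → ℝ} {c₀ : Fin D → ℝ} (hc : Tendsto c l (𝓝 c₀))
    {γ : ι → ℝ → M} {γ₀ : ℝ → M}
    (hγ : ∀ i, IsMIntegralCurve (I := 𝓡 n) (γ i) (frozenField E (c i)))
    (hγ₀ : IsMIntegralCurve (I := 𝓡 n) γ₀ (frozenField E c₀))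
    (h0 : Tendsto (fun i => γ i 0) l (𝓝 (γ₀ 0))) {t : ℝ} (ht : 0 ≤ t) :
    Tendsto (fun i => γ i t) l (𝓝 (γ₀ t)) := by
  set G : Set ℝ := {u | 0 ≤ u ∧ ∀ τ ∈ Icc 0 u, Tendsto (fun i => γ i τ) l (𝓝 (γ₀ τ))} with hG
  have hG0 : (0 : ℝ) ∈ G := ⟨le_rfl, fun τ hτ => by
    rw [show τ = 0 from le_antisymm hτ.2 hτ.1]; exact h0⟩
  suffices h : ¬ BddAbove G by
    obtain ⟨u, hu, htu⟩ := not_bddAbove_iff.1 h t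
    exact hu.2 t ⟨ht, htu.le⟩
  intro hbdd
  obtain ⟨δ, hδ, hprop⟩ := exists_tendsto_propagation hE hB hc hγ hγ₀ (sSup G)
  obtain ⟨s, hs, hs'⟩ := exists_lt_of_lt_csSup ⟨0, hG0⟩ (show sSup G - δ < sSup G by linarith)
  have hle : s ≤ sSup G := le_csSup hbdd hs
  have hmem : sSup G + δ / 2 ∈ G := by
    refine ⟨by linarith [hs.1], fun τ hτ => ?_⟩
    rcases le_total τ s with h | h
    · exact hs.2 τ ⟨hτ.1, h⟩
    · exact hprop s τ hs' h (by linarith [hτ.2]) (hs.2 s ⟨hs.1, le_rfl⟩)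
  linarith [le_csSup hbdd hmem]

/-- The frozen flow depends continuously on the coefficients and on the starting point. -/
theorem continuous_expFlow [CompleteSpace M] (hE : IsFrame E) {B : ℝ} (hB : ∀ d x, ‖E d x‖ ≤ B) :
    Continuous fun q : (Fin D → ℝ) × M => expFlow (frozenField E q.1) q.2 := by
  choose γ h0 hγ h1 using fun q : (Fin D → ℝ) × M => exists_curve_expFlow hE hB q.1 q.2
  simp only [h1]
  refine continuous_iff_continuousAt.2 fun q₀ => ?_
  refine tendsto_frozen_curve hE hB (continuous_fst.tendsto q₀) hγ (hγ q₀) ?_ zero_le_one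
  simp only [h0]
  exact continuous_snd.tendsto q₀

end FlowContinuity

/-! ### Taylor expansion along frozen flows -/

section Taylor

/-- Taylor's formula on `[0, 1]` for a sequence of successive derivatives. -/
theorem abs_sub_taylor_le (m : ℕ) {u : ℕ → ℝ → ℝ}
    (hu : ∀ k < m, ∀ t, HasDerivAt (u k) (u (k + 1) t) t) {A : ℝ}
    (hA : ∀ t ∈ Icc (0 : ℝ) 1, |u m t| ≤ A) :
    ∀ t ∈ Icc (0 : ℝ) 1, |u 0 t - ∑ k ∈ Finset.range m, t ^ k / k.factorial * u k 0| ≤ A := by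
  induction m generalizing u with
  | zero => simpa using hA
  | succ m ih =>
    have hA0 : 0 ≤ A := (abs_nonneg _).trans (hA 0 (by simp))
    have ih' := ih (u := fun k => u (k + 1)) (fun k hk t => hu (k + 1) (by omega) t) hA
    set v : ℝ → ℝ := fun t =>
      u 0 t - ∑ k ∈ Finset.range (m + 1), t ^ k / k.factorial * u k 0 with hv
    have hvd : ∀ t, HasDerivAt v
        (u 1 t - ∑ k ∈ Finset.range m, t ^ k / k.factorial * u (k + 1) 0) t := by
      intro t
      refine (hu 0 (by omega) t).sub ?_
      simp only [Finset.sum_range_succ' _ m]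
      have h1 : ∀ k ∈ Finset.range m, HasDerivAt
          (fun t : ℝ => t ^ (k + 1) / (k + 1).factorial * u (k + 1) 0)
          (t ^ k / k.factorial * u (k + 1) 0) t := by
        intro k _
        have h2 := ((hasDerivAt_pow (k + 1) t).div_const ((k + 1).factorial : ℝ)).mul_const
          (u (k + 1) 0)
        convert! h2 using 1
        rw [Nat.factorial_succ]
        push_cast
        field_simp
      have h3 := HasDerivAt.fun_sum h1
      convert! h3.add_const (u 0 0) using 1
      ext t
      simp
    have hv0 : v 0 = 0 := by
      simp only [hv, Finset.sum_range_succ' _ m]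
      simp
    intro t ht
    have h := (convex_Icc (0 : ℝ) 1).norm_image_sub_le_of_norm_hasDerivWithin_le
      (f := v) (C := A) (fun x _ => (hvd x).hasDerivWithinAt) (fun x hx => ih' x hx)
      (show (0 : ℝ) ∈ Icc (0 : ℝ) 1 by simp) ht
    rw [hv0, sub_zero, sub_zero] at h
    refine h.trans ?_
    rw [Real.norm_eq_abs, abs_of_nonneg ht.1]
    nlinarith [ht.2]

end Taylor

section FrozenTaylor

variable {n : ℕ} {M : Type*} [MetricSpace M] [ChartedSpace (EuclideanSpace ℝ (Fin n)) M]
  {D : ℕ} (E : Fin D → (x : M) → TangentSpace (𝓡 n) x)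

/-- The sum over all words of length `k` of `c_{w_1} ⋯ c_{w_k} E_w[φ]`, that is, the `k`-th iterated
derivative of `φ` along the frozen field with coefficients `c`. -/
noncomputable def wordSum (c : Fin D → ℝ) (k : ℕ) (φ : M → ℝ) (x : M) : ℝ :=
  ∑ w : Fin k → Fin D, (∏ i, c (w i)) * iterD E (List.ofFn w) φ x

theorem wordSum_zero (c : Fin D → ℝ) (φ : M → ℝ) (x : M) : wordSum E c 0 φ x = φ x := by
  simp [wordSum, iterD]

theorem wordSum_succ (c : Fin D → ℝ) (k : ℕ) (φ : M → ℝ) (x : M) :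
    wordSum E c (k + 1) φ x =
      ∑ w : Fin k → Fin D, (∏ i, c (w i)) * ∑ d, c d * lieD (E d) (iterD E (List.ofFn w) φ) x := by
  unfold wordSum
  rw [← (Fin.consEquiv (fun _ : Fin (k + 1) => Fin D)).sum_comp, Fintype.sum_prod_type_right]
  refine Finset.sum_congr rfl fun w _ => ?_
  rw [Finset.mul_sum]
  refine Finset.sum_congr rfl fun d _ => ?_
  simp only [Fin.consEquiv, Equiv.coe_fn_mk, Fin.prod_univ_succ, Fin.cons_zero, Fin.cons_succ,
    List.ofFn_cons, iterD]
  ring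

theorem wordSum_one (c : Fin D → ℝ) (φ : M → ℝ) (x : M) :
    wordSum E c 1 φ x = ∑ d, c d * lieD (E d) φ x := by
  rw [wordSum_succ]
  simp [iterD]

theorem abs_wordSum_le {c : Fin D → ℝ} {k : ℕ} {φ : M → ℝ} {x : M} {A : ℝ}
    (hA : ∀ w : Fin k → Fin D, |iterD E (List.ofFn w) φ x| ≤ A) :
    |wordSum E c k φ x| ≤ (∑ d, |c d|) ^ k * A := by
  rw [Fintype.sum_pow, Finset.sum_mul]
  refine (Finset.abs_sum_le_sum_abs _ _).trans (Finset.sum_le_sum fun w _ => ?_)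
  rw [abs_mul, Finset.abs_prod]
  exact mul_le_mul_of_nonneg_left (hA w) (Finset.prod_nonneg fun _ _ => abs_nonneg _)

variable {E}

theorem flowProd_zero (c : Fin 0 → Fin D → ℝ) (p : M) : flowProd E c p = p := by
  simp [flowProd]

theorem flowProd_succ {K : ℕ} (c : Fin (K + 1) → Fin D → ℝ) (p : M) :
    flowProd E c p = expFlow (frozenField E (c (Fin.last K)))
      (flowProd E (fun k => c k.castSucc) p) := by
  simp [flowProd, Fin.foldl_succ_last]

variable [IsManifold (𝓡 n) ∞ M]

theorem hasDerivAt_wordSum (hE : IsFrame E) {c : Fin D → ℝ} {γ : ℝ → M}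
    (hγ : IsMIntegralCurve (I := 𝓡 n) γ (frozenField E c)) {k : ℕ} {φ : M → ℝ}
    (hφ : ContMDiff (𝓡 n) 𝓘(ℝ, ℝ) ((k + 1 : ℕ) : ℕ∞ω) φ) (t : ℝ) :
    HasDerivAt (fun s => wordSum E c k φ (γ s)) (wordSum E c (k + 1) φ (γ t)) t := by
  rw [wordSum_succ]
  unfold wordSum
  refine HasDerivAt.fun_sum fun w _ => HasDerivAt.const_mul _ ?_
  refine hasDerivAt_comp_frozen hγ ?_ t
  have h := iterD_contMDiff_nat hE hφ (List.ofFn w) (m := 1) (by simp)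
  exact_mod_cast h

variable [Bundle.RiemannianBundle (fun x : M => TangentSpace (𝓡 n) x)]
  [IsRiemannianManifold (𝓡 n) M] [CompleteSpace M] {B : ℝ}

theorem dist_expFlow_le (hE : IsFrame E) (hB : ∀ d x, ‖E d x‖ ≤ B) (c : Fin D → ℝ) (p : M) :
    dist p (expFlow (frozenField E c) p) ≤ B * ∑ d, |c d| := by
  obtain ⟨γ, h0, hγ, h1⟩ := exists_curve_expFlow hE hB c p
  rw [h1, ← h0]
  simpa using dist_frozen_curve_le hE hB hγ 0 1

/-- Taylor expansion of a function along a frozen flow. Only the derivatives along the curve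
enter, so that no differentiability of the flow in its coefficients is needed. -/
theorem abs_expFlow_sub_wordSum_le (hE : IsFrame E) (hB : ∀ d x, ‖E d x‖ ≤ B) {m : ℕ} {φ : M → ℝ}
    (hφ : ContMDiff (𝓡 n) 𝓘(ℝ, ℝ) (m : ℕ∞ω) φ) (c : Fin D → ℝ) (p : M) {A : ℝ}
    (hA : ∀ x, dist p x ≤ B * ∑ d, |c d| → ∀ w : Fin m → Fin D, |iterD E (List.ofFn w) φ x| ≤ A) :
    |φ (expFlow (frozenField E c) p) -
        ∑ k ∈ Finset.range m, (1 / k.factorial : ℝ) * wordSum E c k φ p|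
      ≤ (∑ d, |c d|) ^ m * A := by
  obtain ⟨γ, h0, hγ, h1⟩ := exists_curve_expFlow hE hB c p
  have hdist : ∀ t ∈ Icc (0 : ℝ) 1, dist p (γ t) ≤ B * ∑ d, |c d| := by
    intro t ht
    have h2 := dist_frozen_curve_le hE hB hγ 0 t
    rw [h0, sub_zero, abs_of_nonneg ht.1] at h2
    exact h2.trans
      (mul_le_of_le_one_right ((norm_nonneg _).trans (norm_frozenField_le hB c p)) ht.2)
  have key := abs_sub_taylor_le m (u := fun k t => wordSum E c k φ (γ t))
    (A := (∑ d, |c d|) ^ m * A)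
    (fun k hk t => hasDerivAt_wordSum hE hγ (hφ.of_le (by exact_mod_cast hk)) t)
    (fun t ht => abs_wordSum_le E (hA _ (hdist t ht))) 1 (by simp)
  simpa [wordSum_zero, h0, h1] using key

theorem dist_flowProd_le (hE : IsFrame E) (hB : ∀ d x, ‖E d x‖ ≤ B) {K : ℕ}
    (c : Fin K → Fin D → ℝ) (p : M) :
    dist p (flowProd E c p) ≤ B * ∑ k, ∑ d, |c k d| := by
  induction K with
  | zero => simp [flowProd_zero]
  | succ K ih =>
    rw [flowProd_succ, Fin.sum_univ_castSucc, mul_add]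
    exact (dist_triangle _ _ _).trans (add_le_add (ih _) (dist_expFlow_le hE hB _ _))

theorem continuous_flowProd (hE : IsFrame E) (hB : ∀ d x, ‖E d x‖ ≤ B) {K : ℕ}
    {Z : Type*} [TopologicalSpace Z] {c : Z → Fin K → Fin D → ℝ} (hc : Continuous c)
    {y : Z → M} (hy : Continuous y) : Continuous fun z => flowProd E (c z) (y z) := by
  induction K with
  | zero => simpa [flowProd_zero] using hy
  | succ K ih =>
    simp only [flowProd_succ]
    have h1 : Continuous fun z => flowProd E (fun k => c z k.castSucc) (y z) :=
      ih (c := fun z k => c z k.castSucc) (by fun_prop)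
    have h2 : Continuous fun z => c z (Fin.last K) := by fun_prop
    exact (continuous_expFlow hE hB).comp (h2.prodMk h1)

/-- First-order expansion along a composition of frozen flows, with a quadratic remainder. -/
theorem abs_flowProd_sub_le (hE : IsFrame E) (hB : ∀ d x, ‖E d x‖ ≤ B) (hB0 : 0 ≤ B) {φ : M → ℝ}
    (hφ : ContMDiff (𝓡 n) 𝓘(ℝ, ℝ) ((2 : ℕ) : ℕ∞ω) φ) {K : ℕ} (c : Fin K → Fin D → ℝ) (p : M) {A : ℝ}
    (hA0 : 0 ≤ A) (hA : ∀ x, dist p x ≤ B * ∑ k, ∑ d, |c k d| → ∀ d d', |iterD E [d, d'] φ x| ≤ A) :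
    |φ (flowProd E c p) - φ p - ∑ k, ∑ d, c k d * lieD (E d) φ p| ≤ A * (∑ k, ∑ d, |c k d|) ^ 2 ∧
    ∀ d, |lieD (E d) φ (flowProd E c p) - lieD (E d) φ p| ≤ A * ∑ k, ∑ d, |c k d| := by
  induction K with
  | zero => simp [flowProd_zero]
  | succ K ih =>
    set c' : Fin K → Fin D → ℝ := fun k => c k.castSucc with hc'
    set b : Fin D → ℝ := c (Fin.last K) with hb
    set y := flowProd E c' p with hy
    have hsum : ∑ k, ∑ d, |c k d| = ∑ k, ∑ d, |c' k d| + ∑ d, |b d| := Fin.sum_univ_castSucc _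
    have hσ : 0 ≤ ∑ d, |b d| := Finset.sum_nonneg fun _ _ => abs_nonneg _
    have hS : 0 ≤ ∑ k, ∑ d, |c' k d| :=
      Finset.sum_nonneg fun _ _ => Finset.sum_nonneg fun _ _ => abs_nonneg _
    obtain ⟨ih1, ih2⟩ := ih c' fun x hx => hA x (hx.trans (by
      rw [hsum]; exact mul_le_mul_of_nonneg_left (by linarith) hB0))
    have hnear : ∀ x, dist y x ≤ B * ∑ d, |b d| → ∀ d d', |iterD E [d, d'] φ x| ≤ A := by
      intro x hx
      refine hA x ?_
      rw [hsum, mul_add]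
      exact (dist_triangle p y x).trans (add_le_add (dist_flowProd_le hE hB c' p) hx)
    have h2 := abs_expFlow_sub_wordSum_le hE hB hφ b y (A := A) (fun x hx w => by
      simpa [List.ofFn_succ] using hnear x hx (w 0) (w 1))
    have h1 : ∀ d, |lieD (E d) φ (expFlow (frozenField E b) y) - lieD (E d) φ y|
        ≤ (∑ d, |b d|) * A := by
      intro d
      have h := abs_expFlow_sub_wordSum_le hE hB (m := 1) (φ := lieD (E d) φ)
        (iterD_contMDiff_nat hE hφ [d] (m := 1) (by simp)) b y (A := A) (fun x hx w => by
          simpa [List.ofFn_succ, iterD] using hnear x hx (w 0) d)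
      simpa [wordSum_zero] using h
    simp only [Finset.sum_range_succ, Finset.range_zero, Finset.sum_empty, wordSum_zero,
      wordSum_one] at h2
    rw [flowProd_succ, hsum]
    constructor
    · rw [Fin.sum_univ_castSucc]
      have h3 : |∑ d, b d * (lieD (E d) φ y - lieD (E d) φ p)| ≤
          (∑ d, |b d|) * (A * ∑ k, ∑ d, |c' k d|) := by
        rw [Finset.sum_mul]
        refine (Finset.abs_sum_le_sum_abs _ _).trans (Finset.sum_le_sum fun d _ => ?_)
        rw [abs_mul]
        exact mul_le_mul_of_nonneg_left (ih2 d) (abs_nonneg _)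
      simp only [mul_sub, Finset.sum_sub_distrib] at h3
      have e : φ (expFlow (frozenField E b) y) - φ p -
          (∑ k, ∑ d, c' k d * lieD (E d) φ p + ∑ d, b d * lieD (E d) φ p)
          = (φ (expFlow (frozenField E b) y) - (φ y + ∑ d, b d * lieD (E d) φ y))
            + (∑ d, b d * lieD (E d) φ y - ∑ d, b d * lieD (E d) φ p)
            + (φ y - φ p - ∑ k, ∑ d, c' k d * lieD (E d) φ p) := by ring
      have h2' : |φ (expFlow (frozenField E b) y) - (φ y + ∑ d, b d * lieD (E d) φ y)| ≤
          (∑ d, |b d|) ^ 2 * A := by simpa using h2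
      show |φ (expFlow (frozenField E b) y) - φ p -
          (∑ k, ∑ d, c' k d * lieD (E d) φ p + ∑ d, b d * lieD (E d) φ p)| ≤ _
      rw [e]
      refine (abs_add_three _ _ _).trans ?_
      have : 0 ≤ A * ((∑ d, |b d|) * ∑ k, ∑ d, |c' k d|) := by positivity
      nlinarith
    · intro d
      refine (abs_sub_le _ (lieD (E d) φ y) _).trans ?_
      have := h1 d
      have := ih2 d
      rw [mul_add]
      linarith

end FrozenTaylor

/-! ### Growth of the stages and of the step -/

section Increments

variable {D J K L : ℕ}

/-- The frozen coefficients `h ∑ j, z k j * g d j + √h ∑ l, zh k l * ξ d l` of a composition of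
exponentials. -/
noncomputable def incr (h : ℝ) (z : Fin K → Fin J → ℝ) (zh : Fin K → Fin L → ℝ)
    (g : Fin D → Fin J → ℝ) (ξ : Fin D → Fin L → ℝ) (k : Fin K) (d : Fin D) : ℝ :=
  h * (∑ j, z k j * g d j) + √h * ∑ l, zh k l * ξ d l

theorem abs_apply_le_norm (ξ : Fin D → Fin L → ℝ) (d : Fin D) (l : Fin L) : |ξ d l| ≤ ‖ξ‖ :=
  (norm_le_pi_norm (ξ d) l).trans (norm_le_pi_norm ξ d)

/-- If the noise and the values `g` are of size `W`, the coefficients are of size `ε W`, where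
`ε = √h`. -/
theorem sum_abs_incr_le {H Cg : ℝ} (z : Fin K → Fin J → ℝ) (zh : Fin K → Fin L → ℝ) :
    ∃ C, 0 ≤ C ∧ ∀ ε ∈ Icc 0 H, ∀ (W : ℝ) (g : Fin D → Fin J → ℝ) (ξ : Fin D → Fin L → ℝ),
      ‖ξ‖ ≤ W → (∀ d j, |g d j| ≤ Cg * W) → ∑ k, ∑ d, |incr (ε ^ 2) z zh g ξ k d| ≤ C * ε * W := by
  refine ⟨∑ k, ∑ _d : Fin D, (|H| * (∑ j, |z k j| * |Cg|) + ∑ l, |zh k l|),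
    by positivity, fun ε hε W g ξ hξ hg => ?_⟩
  rw [Finset.sum_mul, Finset.sum_mul]
  refine Finset.sum_le_sum fun k _ => ?_
  rw [Finset.sum_mul, Finset.sum_mul]
  refine Finset.sum_le_sum fun d _ => ?_
  have hW : 0 ≤ W := (norm_nonneg _).trans hξ
  have hg' : ∀ d j, |g d j| ≤ |Cg| * W := fun d j =>
    (hg d j).trans (mul_le_mul_of_nonneg_right (le_abs_self _) hW)
  have h1 : |∑ j, z k j * g d j| ≤ (∑ j, |z k j| * |Cg|) * W := by
    rw [Finset.sum_mul]
    refine (Finset.abs_sum_le_sum_abs _ _).trans (Finset.sum_le_sum fun j _ => ?_)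
    rw [abs_mul, mul_assoc]
    exact mul_le_mul_of_nonneg_left (hg' d j) (abs_nonneg _)
  have h2 : |∑ l, zh k l * ξ d l| ≤ (∑ l, |zh k l|) * W := by
    rw [Finset.sum_mul]
    refine (Finset.abs_sum_le_sum_abs _ _).trans (Finset.sum_le_sum fun l _ => ?_)
    rw [abs_mul]
    exact mul_le_mul_of_nonneg_left ((abs_apply_le_norm ξ d l).trans hξ) (abs_nonneg _)
  unfold incr
  rw [Real.sqrt_sq hε.1]
  refine (abs_add_le _ _).trans ?_
  rw [abs_mul, abs_mul, abs_of_nonneg (sq_nonneg ε), abs_of_nonneg hε.1]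
  have h3 : ε ^ 2 * |∑ j, z k j * g d j| ≤ ε * |H| * ((∑ j, |z k j| * |Cg|) * W) := by
    rw [pow_two]
    exact mul_le_mul (mul_le_mul_of_nonneg_left (hε.2.trans (le_abs_self H)) hε.1) h1
      (abs_nonneg _) (mul_nonneg hε.1 (abs_nonneg _))
  have h4 := mul_le_mul_of_nonneg_left h2 hε.1
  linarith

theorem continuous_incr {Z : Type*} [TopologicalSpace Z] (h : ℝ) (z : Fin K → Fin J → ℝ)
    (zh : Fin K → Fin L → ℝ) {g : Z → Fin D → Fin J → ℝ} (hg : ∀ d j, Continuous fun u => g u d j)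
    {ξ : Z → Fin D → Fin L → ℝ} (hξ : Continuous ξ) :
    Continuous fun u => incr h z zh (g u) (ξ u) := by
  refine continuous_pi fun k => continuous_pi fun d => ?_
  unfold incr
  fun_prop

end Increments

section Growth

variable {n : ℕ} {M : Type*} [MetricSpace M] [ChartedSpace (EuclideanSpace ℝ (Fin n)) M]
  {D s K L : ℕ} {E : Fin D → (x : M) → TangentSpace (𝓡 n) x} {f : Fin D → M → ℝ} {o : M}

theorem stage_eq_incr (m : Tableau s K L) (h : ℝ) (x : M) (ξ : Fin D → Fin L → ℝ) (i : Fin s) :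
    m.stage E f h x ξ i = flowProd E (incr h (fun k j => m.Z0 i j k) (m.Zhat i)
      (fun d j => if j < i then f d (m.stage E f h x ξ j) else 0) ξ) x := by
  rw [Tableau.stage]
  congr 1
  funext k d
  unfold incr
  congr 2
  refine Finset.sum_congr rfl fun j _ => ?_
  by_cases hj : j < i <;> simp [hj]

theorem step_eq_incr (m : Tableau s K L) (h : ℝ) (x : M) (ξ : Fin D → Fin L → ℝ) :
    m.step E f h x ξ = flowProd E (incr h (fun k j => m.z0 j k) m.zhat
      (fun d j => f d (m.stage E f h x ξ j)) ξ) x := rfl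

/-- The weight `(1 + r(x)) (1 + ‖ξ‖)` measuring growth in the position and in the noise. -/
noncomputable def weight (o x : M) (ξ : Fin D → Fin L → ℝ) : ℝ := (1 + dist o x) * (1 + ‖ξ‖)

omit [ChartedSpace (EuclideanSpace ℝ (Fin n)) M] in
theorem one_le_weight (o x : M) (ξ : Fin D → Fin L → ℝ) : 1 ≤ weight o x ξ := by
  have h1 : 0 ≤ dist o x := dist_nonneg
  have h2 : 0 ≤ ‖ξ‖ := norm_nonneg _
  unfold weight; nlinarith [mul_nonneg h1 h2]

omit [ChartedSpace (EuclideanSpace ℝ (Fin n)) M] in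
theorem norm_le_weight (o x : M) (ξ : Fin D → Fin L → ℝ) : ‖ξ‖ ≤ weight o x ξ := by
  have h1 : 0 ≤ dist o x := dist_nonneg
  have h2 : 0 ≤ ‖ξ‖ := norm_nonneg _
  unfold weight; nlinarith [mul_nonneg h1 h2]

omit [ChartedSpace (EuclideanSpace ℝ (Fin n)) M] in
theorem one_add_dist_le_weight (o x : M) (ξ : Fin D → Fin L → ℝ) :
    1 + dist o x ≤ weight o x ξ := by
  have h1 : 0 ≤ dist o x := dist_nonneg
  have h2 : 0 ≤ ‖ξ‖ := norm_nonneg _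
  unfold weight; nlinarith [mul_nonneg h1 h2]

variable [IsManifold (𝓡 n) ∞ M] [Bundle.RiemannianBundle (fun x : M => TangentSpace (𝓡 n) x)]
  [IsRiemannianManifold (𝓡 n) M] [CompleteSpace M] {B : ℝ}

theorem continuous_stage (hE : IsFrame E) (hB : ∀ d x, ‖E d x‖ ≤ B) (hf : ∀ d, Continuous (f d))
    (m : Tableau s K L) (h : ℝ) {Z : Type*} [TopologicalSpace Z] {x : Z → M} (hx : Continuous x)
    {ξ : Z → Fin D → Fin L → ℝ} (hξ : Continuous ξ) (i : Fin s) :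
    Continuous fun u => m.stage E f h (x u) (ξ u) i := by
  induction i using WellFoundedLT.induction with
  | _ i ih =>
    rw [funext fun u => stage_eq_incr (E := E) (f := f) m h (x u) (ξ u) i]
    refine continuous_flowProd hE hB (continuous_incr _ _ _ (fun d j => ?_) hξ) hx
    split_ifs with hj
    · exact (hf d).comp (ih j hj)
    · exact continuous_const

theorem continuous_step (hE : IsFrame E) (hB : ∀ d x, ‖E d x‖ ≤ B) (hf : ∀ d, Continuous (f d))
    (m : Tableau s K L) (h : ℝ) {Z : Type*} [TopologicalSpace Z] {x : Z → M} (hx : Continuous x)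
    {ξ : Z → Fin D → Fin L → ℝ} (hξ : Continuous ξ) :
    Continuous fun u => m.step E f h (x u) (ξ u) := by
  simp only [step_eq_incr m]
  exact continuous_flowProd hE hB (continuous_incr _ _ _ (fun d j =>
    (hf d).comp (continuous_stage hE hB hf m h hx hξ j)) hξ) hx

/-- Compositions of frozen flows with coefficients of size `ε w` grow at most linearly. -/
theorem flowProd_growth (hE : IsFrame E) (hB : ∀ d x, ‖E d x‖ ≤ B) (hB0 : 0 ≤ B) {H C : ℝ}
    (hC : 0 ≤ C) {ε : ℝ} (hε : ε ∈ Icc 0 H) {x : M} {ξ : Fin D → Fin L → ℝ} {c : Fin K → Fin D → ℝ}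
    (hc : ∑ k, ∑ d, |c k d| ≤ C * ε * weight o x ξ) :
    1 + dist o (flowProd E c x) ≤ (1 + B * C * H) * weight o x ξ := by
  have h1 := dist_flowProd_le hE hB c x
  have h2 := dist_triangle o x (flowProd E c x)
  have h3 := one_add_dist_le_weight o x ξ
  have hw : 0 ≤ weight o x ξ := zero_le_one.trans (one_le_weight o x ξ)
  have h4 : C * ε * weight o x ξ ≤ C * H * weight o x ξ :=
    mul_le_mul_of_nonneg_right (mul_le_mul_of_nonneg_left hε.2 hC) hw
  have h5 := mul_le_mul_of_nonneg_left (hc.trans h4) hB0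
  linarith

variable (hE : IsFrame E) (hB : ∀ d x, ‖E d x‖ ≤ B) (hB0 : 0 ≤ B) {A : ℝ} (hA0 : 0 ≤ A)
  (hf : ∀ d x, |f d x| ≤ A * (1 + dist o x)) (m : Tableau s K L) (H : ℝ)

include hE hB hB0 hA0 hf

/-- All stages, and the values of the `f d` there, grow at most linearly. -/
theorem stage_growth (i : Fin s) : ∃ C, 0 ≤ C ∧ ∀ ε ∈ Icc 0 H, ∀ x (ξ : Fin D → Fin L → ℝ),
    1 + dist o (m.stage E f (ε ^ 2) x ξ i) ≤ C * weight o x ξ := by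
  induction i using WellFoundedLT.induction with
  | _ i ih =>
    choose! Cs hCs0 hCs using ih
    obtain ⟨C, hC0, hC⟩ := sum_abs_incr_le (D := D) (H := H) (Cg := A * ∑ j, |Cs j|)
      (fun k j => m.Z0 i j k) (m.Zhat i)
    refine ⟨1 + B * C * |H|, by positivity, fun ε hε x ξ => ?_⟩
    rw [stage_eq_incr]
    have hε' : ε ∈ Icc 0 |H| := ⟨hε.1, hε.2.trans (le_abs_self H)⟩
    refine flowProd_growth hE hB hB0 hC0 hε' (hC ε hε _ _ ξ (norm_le_weight o x ξ) ?_)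
    intro d j
    have hw : 0 ≤ weight o x ξ := zero_le_one.trans (one_le_weight o x ξ)
    split_ifs with hj
    · refine (hf d _).trans ?_
      rw [mul_assoc]
      refine mul_le_mul_of_nonneg_left ((hCs j hj ε hε x ξ).trans ?_) hA0
      refine mul_le_mul_of_nonneg_right ((le_abs_self _).trans ?_) hw
      exact Finset.single_le_sum (f := fun j => |Cs j|) (fun _ _ => abs_nonneg _)
        (Finset.mem_univ j)
    · rw [abs_zero]; positivity

theorem coord_stage_growth : ∃ C, 0 ≤ C ∧ ∀ ε ∈ Icc 0 H, ∀ x (ξ : Fin D → Fin L → ℝ) d i,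
    |f d (m.stage E f (ε ^ 2) x ξ i)| ≤ C * weight o x ξ := by
  choose Cs hCs0 hCs using stage_growth hE hB hB0 hA0 hf m H
  refine ⟨A * ∑ j, Cs j, mul_nonneg hA0 (Finset.sum_nonneg fun j _ => hCs0 j),
    fun ε hε x ξ d i => (hf d _).trans ?_⟩
  rw [mul_assoc]
  refine mul_le_mul_of_nonneg_left ((hCs i ε hε x ξ).trans ?_) hA0
  exact mul_le_mul_of_nonneg_right (Finset.single_le_sum (fun j _ => hCs0 j) (Finset.mem_univ i))
    (zero_le_one.trans (one_le_weight o x ξ))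

theorem step_incr_growth : ∃ C, 0 ≤ C ∧ ∀ ε ∈ Icc 0 H, ∀ x (ξ : Fin D → Fin L → ℝ),
    ∑ k, ∑ d, |incr (ε ^ 2) (fun k j => m.z0 j k) m.zhat
      (fun d j => f d (m.stage E f (ε ^ 2) x ξ j)) ξ k d| ≤ C * ε * weight o x ξ := by
  obtain ⟨Cg, hCg0, hCg⟩ := coord_stage_growth hE hB hB0 hA0 hf m H
  obtain ⟨C, hC0, hC⟩ := sum_abs_incr_le (D := D) (H := H) (Cg := Cg)
    (fun k j => m.z0 j k) m.zhat
  exact ⟨C, hC0, fun ε hε x ξ => hC ε hε _ _ ξ (norm_le_weight o x ξ) (hCg ε hε x ξ)⟩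

end Growth

/-! ### Moments and independence of the noise -/

section Noise

variable {Ω : Type*} [MeasurableSpace Ω] {P : Measure Ω} [IsProbabilityMeasure P] {p D L : ℕ}
  {ξ : ℕ → Fin D → Fin L → Ω → ℝ}

/-- The noise vector of the `N`-th step. -/
abbrev noiseVec (ξ : ℕ → Fin D → Fin L → Ω → ℝ) (N : ℕ) (η : Ω) : Fin D → Fin L → ℝ :=
  fun d l => ξ N d l η

omit [IsProbabilityMeasure P] in
theorem IsNoise.measurable_noiseVec (hξ : IsNoise P p ξ) (N : ℕ) : Measurable (noiseVec ξ N) :=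
  measurable_pi_lambda _ fun d => measurable_pi_lambda _ fun l => hξ.measurable N d l

/-- The noise vectors have finite moments of all orders. -/
theorem IsNoise.memLp (hξ : IsNoise P p ξ) (N : ℕ) (q : ℕ) : MemLp (noiseVec ξ N) q P := by
  rw [memLp_pi_iff]
  intro d
  rw [memLp_pi_iff]
  intro l
  have h1 : MemLp (ξ N d l) ((2 * (q + 1) : ℕ) : ENNReal) P := by
    rw [← integrable_norm_rpow_iff (hξ.measurable N d l).aestronglyMeasurable
      (by simp) (ENNReal.natCast_ne_top _)]
    refine (hξ.integrable N d l (2 * (q + 1))).congr (Eventually.of_forall fun η => ?_)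
    simp only [ENNReal.toReal_natCast, Real.rpow_natCast, Real.norm_eq_abs, pow_mul, sq_abs]
  exact h1.mono_exponent (by exact_mod_cast (by omega : q ≤ 2 * (q + 1)))

theorem IsNoise.integrable_one_add_norm_pow (hξ : IsNoise P p ξ) (N k : ℕ) :
    Integrable (fun η => (1 + ‖noiseVec ξ N η‖) ^ k) P := by
  have h1 : MemLp ((fun _ : Ω => (1 : ℝ)) + fun η => ‖noiseVec ξ N η‖) k P :=
    (memLp_const (1 : ℝ)).add (hξ.memLp N k).norm
  refine h1.integrable_norm_pow'.congr (Eventually.of_forall fun η => ?_)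
  have h2 : (0 : ℝ) ≤ 1 + ‖noiseVec ξ N η‖ := by positivity
  simp only [Pi.add_apply, Real.norm_eq_abs (1 + ‖noiseVec ξ N η‖), abs_of_nonneg h2]

omit [IsProbabilityMeasure P] in
/-- The noise vectors of all steps have the same law. -/
theorem IsNoise.identDistrib_noiseVec (hξ : IsNoise P p ξ) (N : ℕ) :
    IdentDistrib (noiseVec ξ N) (noiseVec ξ 0) P P := by
  have hlaw : ∀ N, P.map (fun η (a : Fin D × Fin L) => ξ N a.1 a.2 η)
      = Measure.pi fun a : Fin D × Fin L => P.map (ξ N a.1 a.2) := fun N =>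
    (hξ.indep.precomp (g := fun a : Fin D × Fin L => (N, a.1, a.2))
      (fun a b h => by simpa [Prod.ext_iff] using h)).map_fun_eq_pi_map
      fun a => (hξ.measurable N a.1 a.2).aemeasurable
  have hm : ∀ N, Measurable (fun η (a : Fin D × Fin L) => ξ N a.1 a.2 η) := fun N =>
    measurable_pi_lambda _ fun a => hξ.measurable N a.1 a.2
  have h : IdentDistrib (fun η (a : Fin D × Fin L) => ξ N a.1 a.2 η)
      (fun η (a : Fin D × Fin L) => ξ 0 a.1 a.2 η) P P := by
    refine ⟨(hm N).aemeasurable, (hm 0).aemeasurable, ?_⟩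
    rw [hlaw, hlaw]
    congr 1
    funext a
    exact (hξ.identDistrib N a.1 a.2).map_eq
  exact h.comp (u := fun (v : Fin D × Fin L → ℝ) d l => v (d, l)) (by fun_prop)

/-- A monomial in the components of the noise. -/
def noiseMonomial (α : Fin D → Fin L → ℕ) (v : Fin D → Fin L → ℝ) : ℝ := ∏ d, ∏ l, v d l ^ α d l

theorem abs_noiseMonomial_le (α : Fin D → Fin L → ℕ) (v : Fin D → Fin L → ℝ) :
    |noiseMonomial α v| ≤ (1 + ‖v‖) ^ (∑ d, ∑ l, α d l) := by
  unfold noiseMonomial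
  rw [Finset.abs_prod, ← Finset.prod_pow_eq_pow_sum]
  refine Finset.prod_le_prod (fun _ _ => abs_nonneg _) fun d _ => ?_
  rw [Finset.abs_prod, ← Finset.prod_pow_eq_pow_sum]
  refine Finset.prod_le_prod (fun _ _ => abs_nonneg _) fun l _ => ?_
  rw [abs_pow]
  exact pow_le_pow_left₀ (abs_nonneg _) ((abs_apply_le_norm v d l).trans (by linarith)) _

theorem continuous_noiseMonomial (α : Fin D → Fin L → ℕ) :
    Continuous (noiseMonomial α : (Fin D → Fin L → ℝ) → ℝ) := by
  unfold noiseMonomial; fun_prop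

theorem IsNoise.integrable_noiseMonomial (hξ : IsNoise P p ξ) (N : ℕ) (α : Fin D → Fin L → ℕ) :
    Integrable (fun η => noiseMonomial α (noiseVec ξ N η)) P :=
  (hξ.integrable_one_add_norm_pow N (∑ d, ∑ l, α d l)).mono'
    ((continuous_noiseMonomial α).measurable.comp
      (hξ.measurable_noiseVec N)).aestronglyMeasurable
    (Eventually.of_forall fun _ => abs_noiseMonomial_le α _)

omit [IsProbabilityMeasure P] in
/-- Monomials of odd total degree have zero expectation, by independence and because the odd
moments vanish. -/
theorem IsNoise.integral_noiseMonomial_of_odd (hξ : IsNoise P p ξ) (N : ℕ)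
    {α : Fin D → Fin L → ℕ} (hα : Odd (∑ d, ∑ l, α d l)) :
    ∫ η, noiseMonomial α (noiseVec ξ N η) ∂P = 0 := by
  have hind : iIndepFun (fun (a : Fin D × Fin L) => ξ N a.1 a.2) P :=
    hξ.indep.precomp (g := fun a : Fin D × Fin L => (N, a.1, a.2))
      (fun a b h => by simpa [Prod.ext_iff] using h)
  have h1 := hind.integral_fun_prod_comp (f := fun a (y : ℝ) => y ^ α a.1 a.2)
    (fun a => (hξ.measurable N a.1 a.2).aemeasurable)
    (fun a => (measurable_id.pow_const _).aestronglyMeasurable)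
  simp only [noiseMonomial, noiseVec]
  simp only [Fintype.prod_prod_type] at h1
  rw [h1]
  obtain ⟨d, -, hd⟩ : ∃ d ∈ Finset.univ, Odd (∑ l, α d l) := by
    by_contra! h
    exact (Nat.not_odd_iff_even.2 (Finset.even_sum _ fun d hd =>
      Nat.not_odd_iff_even.1 (h d hd))) hα
  obtain ⟨l, -, hl⟩ : ∃ l ∈ Finset.univ, Odd (α d l) := by
    by_contra! h
    exact (Nat.not_odd_iff_even.2 (Finset.even_sum _ fun l hl =>
      Nat.not_odd_iff_even.1 (h l hl))) hd
  exact Finset.prod_eq_zero (Finset.mem_univ d)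
    (Finset.prod_eq_zero (Finset.mem_univ l) (hξ.odd_moment N d l _ hl))

end Noise

section Independence

variable {Ω : Type*} [MeasurableSpace Ω] {P : Measure Ω} [IsProbabilityMeasure P]

/-- If `X` is independent of `(Y, Z)` and `Y` of `Z`, then `(X, Y)` is independent of `Z`. -/
theorem IndepFun.prodMk_left_of_indepFun {α β γ : Type*} [MeasurableSpace α] [MeasurableSpace β]
    [MeasurableSpace γ] {X : Ω → α} {Y : Ω → β} {Z : Ω → γ} (hX : Measurable X)
    (hY : Measurable Y) (hZ : Measurable Z) (h1 : IndepFun X (fun η => (Y η, Z η)) P)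
    (h2 : IndepFun Y Z P) : IndepFun (fun η => (X η, Y η)) Z P := by
  have := Measure.isProbabilityMeasure_map (μ := P) hX.aemeasurable
  have := Measure.isProbabilityMeasure_map (μ := P) hY.aemeasurable
  have := Measure.isProbabilityMeasure_map (μ := P) hZ.aemeasurable
  have h3 : IndepFun X Y P := h1.comp measurable_id measurable_fst
  rw [indepFun_iff_map_prod_eq_prod_map_map (hX.prodMk hY).aemeasurable hZ.aemeasurable,
    h3.map_prod_eq_prod_map_map hX.aemeasurable hY.aemeasurable]
  have h4 := h1.map_prod_eq_prod_map_map hX.aemeasurable (hY.prodMk hZ).aemeasurable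
  rw [h2.map_prod_eq_prod_map_map hY.aemeasurable hZ.aemeasurable, ← Measure.prodAssoc_prod] at h4
  have h5 := congrArg (Measure.map MeasurableEquiv.prodAssoc.symm) h4
  rw [MeasurableEquiv.map_symm_map, Measure.map_map (MeasurableEquiv.measurable _)
    (hX.prodMk (hY.prodMk hZ))] at h5
  exact h5

end Independence

section Trajectory

variable {n : ℕ} {M : Type*} [MetricSpace M] [ChartedSpace (EuclideanSpace ℝ (Fin n)) M]
  {D s K L : ℕ} {E : Fin D → (x : M) → TangentSpace (𝓡 n) x} {f : Fin D → M → ℝ}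

theorem traj_congr (m : Tableau s K L) (h : ℝ) (x : M) {ξ ξ' : ℕ → Fin D → Fin L → ℝ} (j : ℕ)
    (hξ : ∀ i < j, ξ i = ξ' i) : m.traj E f h x ξ j = m.traj E f h x ξ' j := by
  induction j with
  | zero => rfl
  | succ j ih =>
    simp only [Tableau.traj]
    rw [ih fun i hi => hξ i (by omega), hξ j (by omega)]

variable [IsManifold (𝓡 n) ∞ M] [Bundle.RiemannianBundle (fun x : M => TangentSpace (𝓡 n) x)]
  [IsRiemannianManifold (𝓡 n) M] [CompleteSpace M] {B : ℝ}

theorem continuous_traj (hE : IsFrame E) (hB : ∀ d x, ‖E d x‖ ≤ B) (hf : ∀ d, Continuous (f d))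
    (m : Tableau s K L) (h : ℝ) (j : ℕ) :
    Continuous fun u : M × (ℕ → Fin D → Fin L → ℝ) => m.traj E f h u.1 u.2 j := by
  induction j with
  | zero => exact continuous_fst
  | succ j ih =>
    simp only [Tableau.traj]
    exact continuous_step hE hB hf m h ih (by fun_prop)

variable [MeasurableSpace M] [BorelSpace M] {Ω : Type*} [MeasurableSpace Ω] {P : Measure Ω}
  [IsProbabilityMeasure P] {p : ℕ} {ξ : ℕ → Fin D → Fin L → Ω → ℝ}

theorem measurable_traj (hE : IsFrame E) (hB : ∀ d x, ‖E d x‖ ≤ B) (hf : ∀ d, Continuous (f d))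
    (m : Tableau s K L) (h : ℝ) (j : ℕ) :
    Measurable fun u : M × (ℕ → Fin D → Fin L → ℝ) => m.traj E f h u.1 u.2 j :=
  (continuous_traj hE hB hf m h j).measurable

/-- The position at step `j` is independent of the noise of step `j`. -/
theorem indepFun_traj (hE : IsFrame E) (hB : ∀ d x, ‖E d x‖ ≤ B) (hf : ∀ d, Continuous (f d))
    (m : Tableau s K L) (h : ℝ) (hξ : IsNoise P p ξ) {X₀ : Ω → M} (hX₀ : Measurable X₀)
    (hind : IndepFun X₀ (fun η (a : ℕ × Fin D × Fin L) => ξ a.1 a.2.1 a.2.2 η) P) (j : ℕ) :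
    IndepFun (fun η => m.traj E f h (X₀ η) (fun i => noiseVec ξ i η) j) (noiseVec ξ j) P := by
  let S : Finset (ℕ × Fin D × Fin L) := Finset.range j ×ˢ Finset.univ
  let T : Finset (ℕ × Fin D × Fin L) := {j} ×ˢ Finset.univ
  let Y : Ω → (S → ℝ) := fun η a => ξ a.1.1 a.1.2.1 a.1.2.2 η
  let Z : Ω → (T → ℝ) := fun η a => ξ a.1.1 a.1.2.1 a.1.2.2 η
  have hST : Disjoint S T := by
    rw [Finset.disjoint_left]
    intro a ha hb
    simp only [S, T, Finset.mem_product, Finset.mem_range, Finset.mem_univ, and_true,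
      Finset.mem_singleton] at ha hb
    omega
  have hYm : Measurable Y := measurable_pi_lambda _ fun a => hξ.measurable _ _ _
  have hZm : Measurable Z := measurable_pi_lambda _ fun a => hξ.measurable _ _ _
  have hYZ : IndepFun Y Z P := hξ.indep.indepFun_finset S T hST fun a => hξ.measurable _ _ _
  have hXYZ : IndepFun X₀ (fun η => (Y η, Z η)) P :=
    hind.comp (φ := id) (ψ := fun v : ℕ × Fin D × Fin L → ℝ =>
      ((fun a : S => v a.1, fun a : T => v a.1) : (S → ℝ) × (T → ℝ))) measurable_id (by fun_prop)
  have key := IndepFun.prodMk_left_of_indepFun hX₀ hYm hZm hXYZ hYZ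
  -- the noise before step `j`, extended by zero, determines the position at step `j`
  let ext : (S → ℝ) → ℕ → Fin D → Fin L → ℝ := fun v i d l =>
    if hi : (i, d, l) ∈ S then v ⟨(i, d, l), hi⟩ else 0
  have hext : Measurable ext := by
    refine measurable_pi_lambda _ fun i => measurable_pi_lambda _ fun d =>
      measurable_pi_lambda _ fun l => ?_
    by_cases hi : (i, d, l) ∈ S
    · simp only [ext, hi, dif_pos]; exact measurable_pi_apply _
    · simp only [ext, hi, dif_neg, not_false_eq_true]; exact measurable_const
  have hT : ∀ d l, (j, d, l) ∈ T := fun d l => by simp [T]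
  have hφ : Measurable fun u : M × (S → ℝ) => m.traj E f h u.1 (ext u.2) j :=
    (measurable_traj hE hB hf m h j).comp (measurable_fst.prodMk (hext.comp measurable_snd))
  have hψ : Measurable fun (v : T → ℝ) (d : Fin D) (l : Fin L) => v ⟨(j, d, l), hT d l⟩ := by
    fun_prop
  have h2 := key.comp hφ hψ
  convert! h2 using 1
  funext η
  refine traj_congr m h (X₀ η) j fun i hi => ?_
  funext d l
  have : (i, d, l) ∈ S := by simpa [S] using hi
  simp [ext, this, Y]

end Trajectory

/-! ### Powers of the distance along one step -/

section Powers

theorem rpow_le_one_add_rpow {r κ q : ℝ} (hr : 0 ≤ r) (hκ : 0 ≤ κ) (hκq : κ ≤ q) :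
    r ^ κ ≤ 1 + r ^ q := by
  rcases le_total r 1 with h | h
  · have := Real.rpow_le_one hr h hκ
    have := Real.rpow_nonneg hr q
    linarith
  · have := Real.rpow_le_rpow_of_exponent_le h hκq
    linarith

theorem one_add_rpow_le {r q : ℝ} (hr : 0 ≤ r) (hq : 0 ≤ q) :
    (1 + r) ^ q ≤ 2 ^ q * (1 + r ^ q) := by
  have h2 : (0 : ℝ) ≤ 2 ^ q := by positivity
  have hrq := Real.rpow_nonneg hr q
  rcases le_total r 1 with h | h
  · calc (1 + r) ^ q ≤ 2 ^ q := Real.rpow_le_rpow (by linarith) (by linarith) hq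
      _ ≤ 2 ^ q * (1 + r ^ q) := by nlinarith
  · calc (1 + r) ^ q ≤ (2 * r) ^ q := Real.rpow_le_rpow (by linarith) (by linarith) hq
      _ = 2 ^ q * r ^ q := Real.mul_rpow (by norm_num) hr
      _ ≤ 2 ^ q * (1 + r ^ q) := by nlinarith

/-- If `0 ≤ r ≤ ρ W` with `1 ≤ W`, then `1 + r ^ a ≤ (1 + ρ ^ a) W ^ a`. -/
theorem one_add_rpow_le_mul {r ρ W a : ℝ} (hr : 0 ≤ r) (hρ : 0 ≤ ρ) (hW : 1 ≤ W) (ha : 0 ≤ a)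
    (h : r ≤ ρ * W) : 1 + r ^ a ≤ (1 + ρ ^ a) * W ^ a := by
  have h1 : r ^ a ≤ ρ ^ a * W ^ a := by
    rw [← Real.mul_rpow hρ (by linarith)]
    exact Real.rpow_le_rpow hr h ha
  have h2 : 1 ≤ W ^ a := Real.one_le_rpow hW ha
  linarith

end Powers

section Moments

variable {n : ℕ} {M : Type*} [MetricSpace M] [ChartedSpace (EuclideanSpace ℝ (Fin n)) M]
  [IsManifold (𝓡 n) ∞ M] [Bundle.RiemannianBundle (fun x : M => TangentSpace (𝓡 n) x)]
  [IsRiemannianManifold (𝓡 n) M] [CompleteSpace M]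
  {D s K L : ℕ} {E : Fin D → (x : M) → TangentSpace (𝓡 n) x} {f : Fin D → M → ℝ} {o : M}
  {B : ℝ} (hE : IsFrame E) (hB : ∀ d x, ‖E d x‖ ≤ B) (hB0 : 0 ≤ B) {A : ℝ} (hA0 : 0 ≤ A)
  (hf : ∀ d x, |f d x| ≤ A * (1 + dist o x)) (m : Tableau s K L) (H : ℝ)

include hE hB hB0 hA0 hf

/-- One step of the method changes `r ^ q` by a linear form in the noise, up to an error of order
`ε² = h` with a weight of degree `q`: each factor `f d`, of linear growth, comes with a frame
derivative, which lowers the degree by one. -/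
theorem step_rpow_dist {q C₀ : ℝ} (hq : 2 ≤ q)
    (hsm : ContMDiff (𝓡 n) 𝓘(ℝ, ℝ) ((2 : ℕ) : ℕ∞ω) (fun x : M => dist o x ^ q))
    (hC₀ : ∀ w : List (Fin D), w.length ≤ 2 → ∀ x,
      |iterD E w (fun y => dist o y ^ q) x| ≤ C₀ * (1 + dist o x ^ (q - (w.length : ℝ)))) :
    ∃ C, 0 ≤ C ∧ ∀ ε ∈ Icc 0 H, ∀ x (ξ : Fin D → Fin L → ℝ),
      |dist o (m.step E f (ε ^ 2) x ξ) ^ q - dist o x ^ q -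
        ε * ∑ d, (∑ k, ∑ l, m.zhat k l * ξ d l) * lieD (E d) (fun y => dist o y ^ q) x|
      ≤ C * ε ^ 2 * weight o x ξ ^ q := by
  obtain ⟨C₁, hC₁0, hC₁⟩ := step_incr_growth hE hB hB0 hA0 hf m H
  obtain ⟨Cg, hCg0, hCg⟩ := coord_stage_growth hE hB hB0 hA0 hf m H
  set ψ : M → ℝ := fun y => dist o y ^ q with hψ
  set ρ := 1 + B * C₁ * |H| with hρ
  have hρ0 : 0 ≤ ρ := by positivity
  set A₂ := |C₀| * (1 + ρ ^ (q - 2)) with hA₂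
  set A₁ := |C₀| * (1 + 1 ^ (q - 1)) with hA₁
  have hA₂0 : 0 ≤ A₂ := by positivity
  set C₃ := ∑ k, ∑ _d : Fin D, (∑ j, |m.z0 j k|) * Cg * A₁ with hC₃
  refine ⟨A₂ * C₁ ^ 2 + C₃, by positivity, fun ε hε x ξ => ?_⟩
  set W := weight o x ξ with hW
  have hW1 : 1 ≤ W := one_le_weight o x ξ
  have hW0 : 0 < W := by linarith
  set c := incr (ε ^ 2) (fun k j => m.z0 j k) m.zhat
      (fun d j => f d (m.stage E f (ε ^ 2) x ξ j)) ξ with hc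
  have hcW : ∑ k, ∑ d, |c k d| ≤ C₁ * ε * W := hC₁ ε hε x ξ
  have hder2 : ∀ y, dist x y ≤ B * ∑ k, ∑ d, |c k d| → ∀ d d',
      |iterD E [d, d'] ψ y| ≤ A₂ * W ^ (q - 2) := by
    intro y hy d d'
    refine (hC₀ [d, d'] (by simp) y).trans ?_
    have h1 : dist o y ≤ ρ * W := by
      have h2 := dist_triangle o x y
      have h3 := one_add_dist_le_weight o x ξ
      have h4 : C₁ * ε * W ≤ C₁ * |H| * W := by
        have := hε.2.trans (le_abs_self H)
        gcongr
      have h5 := mul_le_mul_of_nonneg_left (hcW.trans h4) hB0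
      have : ρ * W = W + B * (C₁ * |H| * W) := by rw [hρ]; ring
      linarith
    have h2 := one_add_rpow_le_mul (a := q - 2) dist_nonneg hρ0 hW1 (by linarith) h1
    have h3 : 0 ≤ 1 + dist o y ^ (q - 2) := by positivity
    simp only [List.length_cons, List.length_nil]
    norm_num
    calc C₀ * (1 + dist o y ^ (q - 2)) ≤ |C₀| * (1 + dist o y ^ (q - 2)) :=
          mul_le_mul_of_nonneg_right (le_abs_self _) h3
      _ ≤ |C₀| * ((1 + ρ ^ (q - 2)) * W ^ (q - 2)) := by gcongr
      _ = A₂ * W ^ (q - 2) := by rw [hA₂]; ring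
  have hder1 : ∀ d, |lieD (E d) ψ x| ≤ A₁ * W ^ (q - 1) := by
    intro d
    refine (hC₀ [d] (by simp) x).trans ?_
    have h1 : dist o x ≤ 1 * W := by linarith [one_add_dist_le_weight o x ξ]
    have h2 := one_add_rpow_le_mul (a := q - 1) dist_nonneg zero_le_one hW1 (by linarith) h1
    have h3 : 0 ≤ 1 + dist o x ^ (q - 1) := by positivity
    simp only [List.length_cons, List.length_nil]
    norm_num only [zero_add, Nat.cast_one]
    calc C₀ * (1 + dist o x ^ (q - 1)) ≤ |C₀| * (1 + dist o x ^ (q - 1)) :=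
          mul_le_mul_of_nonneg_right (le_abs_self _) h3
      _ ≤ |C₀| * ((1 + 1 ^ (q - 1)) * W ^ (q - 1)) := by gcongr
      _ = A₁ * W ^ (q - 1) := by rw [hA₁]; ring
  have hW2 : W ^ (q - 2) * W ^ 2 = W ^ q := by
    rw [← Real.rpow_natCast W 2, ← Real.rpow_add hW0]; norm_num
  have hW3 : W * W ^ (q - 1) = W ^ q := by
    nth_rewrite 1 [← Real.rpow_one W]
    rw [← Real.rpow_add hW0]; norm_num
  have hmain := (abs_flowProd_sub_le hE hB hB0 hsm c x
    (A := A₂ * W ^ (q - 2)) (by positivity) hder2).1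
  have hsq : (∑ k, ∑ d, |c k d|) ^ 2 ≤ (C₁ * ε * W) ^ 2 :=
    pow_le_pow_left₀ (Finset.sum_nonneg fun _ _ => Finset.sum_nonneg fun _ _ => abs_nonneg _) hcW 2
  have hmain' : |ψ (m.step E f (ε ^ 2) x ξ) - ψ x - ∑ k, ∑ d, c k d * lieD (E d) ψ x|
      ≤ A₂ * C₁ ^ 2 * ε ^ 2 * W ^ q := by
    refine hmain.trans ((mul_le_mul_of_nonneg_left hsq (by positivity)).trans (le_of_eq ?_))
    rw [← hW2]; ring
  -- the drift part of the coefficients is of order `ε²`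
  have hdrift : |∑ k, ∑ d, ε ^ 2 * (∑ j, m.z0 j k * f d (m.stage E f (ε ^ 2) x ξ j)) *
      lieD (E d) ψ x| ≤ C₃ * ε ^ 2 * W ^ q := by
    rw [hC₃, Finset.sum_mul, Finset.sum_mul]
    refine (Finset.abs_sum_le_sum_abs _ _).trans (Finset.sum_le_sum fun k _ => ?_)
    rw [Finset.sum_mul, Finset.sum_mul]
    refine (Finset.abs_sum_le_sum_abs _ _).trans (Finset.sum_le_sum fun d _ => ?_)
    have h1 : |∑ j, m.z0 j k * f d (m.stage E f (ε ^ 2) x ξ j)| ≤ (∑ j, |m.z0 j k|) * (Cg * W) := by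
      rw [Finset.sum_mul]
      refine (Finset.abs_sum_le_sum_abs _ _).trans (Finset.sum_le_sum fun j _ => ?_)
      rw [abs_mul]
      exact mul_le_mul_of_nonneg_left (hCg ε hε x ξ d j) (abs_nonneg _)
    rw [abs_mul, abs_mul, abs_of_nonneg (sq_nonneg ε), ← hW3]
    calc ε ^ 2 * |∑ j, m.z0 j k * f d (m.stage E f (ε ^ 2) x ξ j)| * |lieD (E d) ψ x|
        ≤ ε ^ 2 * ((∑ j, |m.z0 j k|) * (Cg * W)) * (A₁ * W ^ (q - 1)) := by
          have := hder1 d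
          gcongr
      _ = _ := by ring
  have hsplit : ∑ k, ∑ d, c k d * lieD (E d) ψ x =
      ∑ k, ∑ d, ε ^ 2 * (∑ j, m.z0 j k * f d (m.stage E f (ε ^ 2) x ξ j)) * lieD (E d) ψ x
      + ε * ∑ d, (∑ k, ∑ l, m.zhat k l * ξ d l) * lieD (E d) ψ x := by
    simp only [hc, incr, Real.sqrt_sq hε.1, add_mul, Finset.sum_add_distrib]
    congr 1
    rw [Finset.sum_comm, Finset.mul_sum]
    refine Finset.sum_congr rfl fun d _ => ?_
    rw [Finset.sum_mul, Finset.mul_sum]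
    refine Finset.sum_congr rfl fun k _ => ?_
    ring
  have hfin : ψ (m.step E f (ε ^ 2) x ξ) - ψ x -
        ε * ∑ d, (∑ k, ∑ l, m.zhat k l * ξ d l) * lieD (E d) ψ x
      = (ψ (m.step E f (ε ^ 2) x ξ) - ψ x - ∑ k, ∑ d, c k d * lieD (E d) ψ x) +
        ∑ k, ∑ d, ε ^ 2 * (∑ j, m.z0 j k * f d (m.stage E f (ε ^ 2) x ξ j)) * lieD (E d) ψ x := by
    rw [hsplit]; ring
  show |ψ (m.step E f (ε ^ 2) x ξ) - ψ x -
        ε * ∑ d, (∑ k, ∑ l, m.zhat k l * ξ d l) * lieD (E d) ψ x| ≤ _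
  rw [hfin]
  refine (abs_add_le _ _).trans ((add_le_add hmain' hdrift).trans (le_of_eq ?_))
  ring

end Moments

/-! ### Bounded moments -/

section Independence

/-- If `X` and `Z` are independent and `Z` has the law of `Z₀`, then a bound on
`∫⁻ F (x, Z₀)` for every fixed `x` integrates to a bound on `∫⁻ F (X, Z)`. -/
theorem lintegral_comp_le_of_indepFun {Ω α β : Type*} [MeasurableSpace Ω] [MeasurableSpace α]
    [MeasurableSpace β] {P : Measure Ω} [IsProbabilityMeasure P] {X : Ω → α} {Z Z₀ : Ω → β}
    (hX : Measurable X) (hZ : Measurable Z) (hZ₀ : Measurable Z₀) (hind : IndepFun X Z P)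
    (hlaw : IdentDistrib Z Z₀ P P) {F : α × β → ENNReal} (hF : Measurable F) {G : α → ENNReal}
    (hG : Measurable G) (h : ∀ x, ∫⁻ η, F (x, Z₀ η) ∂P ≤ G x) :
    ∫⁻ η, F (X η, Z η) ∂P ≤ ∫⁻ η, G (X η) ∂P := by
  have := Measure.isProbabilityMeasure_map (μ := P) hX.aemeasurable
  have := Measure.isProbabilityMeasure_map (μ := P) hZ₀.aemeasurable
  have hprod := hind.map_prod_eq_prod_map_map hX.aemeasurable hZ.aemeasurable
  rw [hlaw.map_eq] at hprod
  rw [← lintegral_map hF (hX.prodMk hZ), hprod, lintegral_prod _ hF.aemeasurable,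
    ← lintegral_map hG hX]
  refine lintegral_mono fun x => ?_
  have hFx : Measurable fun y => F (x, y) := hF.comp measurable_prodMk_left
  rw [lintegral_map hFx hZ₀]
  exact h x

end Independence

section BoundedMoments

variable {n : ℕ} {M : Type*} [MetricSpace M] [ChartedSpace (EuclideanSpace ℝ (Fin n)) M]
  [IsManifold (𝓡 n) ∞ M] [Bundle.RiemannianBundle (fun x : M => TangentSpace (𝓡 n) x)]
  [IsRiemannianManifold (𝓡 n) M] [CompleteSpace M] [MeasurableSpace M] [BorelSpace M]
  {D s K L : ℕ} {E : Fin D → (x : M) → TangentSpace (𝓡 n) x} {f : Fin D → M → ℝ} {o : M}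
  {Ω : Type*} [MeasurableSpace Ω] {P : Measure Ω} [IsProbabilityMeasure P] {p : ℕ}
  {ξ : ℕ → Fin D → Fin L → Ω → ℝ}

theorem measurable_step (hE : IsFrame E) {B : ℝ} (hB : ∀ d x, ‖E d x‖ ≤ B)
    (hf : ∀ d, Continuous (f d)) (m : Tableau s K L) (h : ℝ) :
    Measurable fun u : M × (Fin D → Fin L → ℝ) => m.step E f h u.1 u.2 :=
  (continuous_step hE hB hf m h continuous_fst continuous_snd).measurable

omit [IsProbabilityMeasure P] in
theorem IsNoise.integral_eq_zero (hξ : IsNoise P p ξ) (N : ℕ) (d : Fin D) (l : Fin L) :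
    ∫ η, ξ N d l η ∂P = 0 := by
  simpa using hξ.odd_moment N d l 1 odd_one

omit [IsProbabilityMeasure P] in
theorem IsNoise.integrable_coord (hξ : IsNoise P p ξ) (N : ℕ) (d : Fin D) (l : Fin L) :
    Integrable (ξ N d l) P := by
  simpa using hξ.integrable N d l 1

/-- The one-step Lyapunov estimate: the terms of order `√h` in the expansion of `r ^ q` along one
step are centred. -/
theorem integral_step_rpow_le (hE : IsFrame E) {B : ℝ} (hB : ∀ d x, ‖E d x‖ ≤ B) (hB0 : 0 ≤ B)
    {A : ℝ} (hA0 : 0 ≤ A) (hf : ∀ d x, |f d x| ≤ A * (1 + dist o x))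
    (hfc : ∀ d, Continuous (f d)) (m : Tableau s K L) (H : ℝ) (hξ : IsNoise P p ξ) {q C₀ : ℝ}
    (hq : 2 ≤ q) (hsm : ContMDiff (𝓡 n) 𝓘(ℝ, ℝ) ((2 : ℕ) : ℕ∞ω) (fun x : M => dist o x ^ q))
    (hC₀ : ∀ w : List (Fin D), w.length ≤ 2 → ∀ x,
      |iterD E w (fun y => dist o y ^ q) x| ≤ C₀ * (1 + dist o x ^ (q - (w.length : ℝ)))) :
    ∃ C, 0 ≤ C ∧ ∀ ε ∈ Icc 0 H, ∀ x,
      Integrable (fun η => 1 + dist o (m.step E f (ε ^ 2) x (noiseVec ξ 0 η)) ^ q) P ∧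
      ∫ η, (1 + dist o (m.step E f (ε ^ 2) x (noiseVec ξ 0 η)) ^ q) ∂P
        ≤ (1 + C * ε ^ 2) * (1 + dist o x ^ q) := by
  obtain ⟨C, hC0, hC⟩ := step_rpow_dist hE hB hB0 hA0 hf m H hq hsm hC₀
  set k := ⌈q⌉₊ with hk
  set I := ∫ η, (1 + ‖noiseVec ξ 0 η‖) ^ k ∂P with hI
  have hI0 : 0 ≤ I := integral_nonneg fun η => by positivity
  refine ⟨C * I * 2 ^ q, by positivity, fun ε hε x => ?_⟩
  set lin : Ω → ℝ := fun η => ∑ d, (∑ k, ∑ l, m.zhat k l * noiseVec ξ 0 η d l) *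
    lieD (E d) (fun y => dist o y ^ q) x with hlin
  set Z : Ω → ℝ := fun η => dist o (m.step E f (ε ^ 2) x (noiseVec ξ 0 η)) ^ q - dist o x ^ q -
    ε * lin η with hZ
  have hlin_int : Integrable lin P := by
    refine integrable_finsetSum _ fun d _ => Integrable.mul_const ?_ _
    refine integrable_finsetSum _ fun k _ => integrable_finsetSum _ fun l _ => ?_
    exact (hξ.integrable_coord 0 d l).const_mul _
  have hlin0 : ∫ η, lin η ∂P = 0 := by
    simp only [hlin]
    rw [integral_finsetSum _ fun d _ => Integrable.mul_const (integrable_finsetSum _ fun k _ =>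
      integrable_finsetSum _ fun l _ => (hξ.integrable_coord 0 d l).const_mul _) _]
    refine Finset.sum_eq_zero fun d _ => ?_
    rw [integral_mul_const, integral_finsetSum _ fun k _ =>
      integrable_finsetSum _ fun l _ => (hξ.integrable_coord 0 d l).const_mul _]
    rw [Finset.sum_eq_zero, zero_mul]
    intro k _
    rw [integral_finsetSum _ fun l _ => (hξ.integrable_coord 0 d l).const_mul _]
    refine Finset.sum_eq_zero fun l _ => ?_
    rw [integral_const_mul, hξ.integral_eq_zero, mul_zero]
  have hZle : ∀ η, |Z η| ≤ C * ε ^ 2 * (1 + dist o x) ^ q * (1 + ‖noiseVec ξ 0 η‖) ^ k := by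
    intro η
    refine (hC ε hε x (noiseVec ξ 0 η)).trans ?_
    have h1 : (1 : ℝ) ≤ 1 + ‖noiseVec ξ 0 η‖ := by linarith [norm_nonneg (noiseVec ξ 0 η)]
    have h2 : (1 + ‖noiseVec ξ 0 η‖) ^ q ≤ (1 + ‖noiseVec ξ 0 η‖) ^ k := by
      rw [← Real.rpow_natCast]
      exact Real.rpow_le_rpow_of_exponent_le h1 (Nat.le_ceil q)
    unfold weight
    rw [Real.mul_rpow (by positivity) (by positivity), ← mul_assoc]
    gcongr
  have hmeas : Measurable fun η => dist o (m.step E f (ε ^ 2) x (noiseVec ξ 0 η)) ^ q :=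
    ((continuous_const.dist continuous_id).measurable.comp ((measurable_step hE hB hfc m _).comp
      (measurable_const.prodMk (hξ.measurable_noiseVec 0)))).pow_const q
  have hdom : Integrable (fun η => C * ε ^ 2 * (1 + dist o x) ^ q *
      (1 + ‖noiseVec ξ 0 η‖) ^ k) P := (hξ.integrable_one_add_norm_pow 0 k).const_mul _
  have hZ_int : Integrable Z P := by
    refine hdom.mono' ?_ (Eventually.of_forall hZle)
    exact (hmeas.aestronglyMeasurable.sub aestronglyMeasurable_const).sub
      (hlin_int.aestronglyMeasurable.const_mul ε)
  have hsplit : (fun η => 1 + dist o (m.step E f (ε ^ 2) x (noiseVec ξ 0 η)) ^ q) =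
      fun η => (1 + dist o x ^ q) + (ε * lin η + Z η) := by
    funext η; simp only [hZ]; ring
  rw [hsplit]
  have hint : Integrable (fun η => ε * lin η + Z η) P := (hlin_int.const_mul ε).add hZ_int
  refine ⟨(integrable_const _).add hint, ?_⟩
  rw [integral_add (integrable_const _) hint, integral_add (hlin_int.const_mul ε) hZ_int,
    integral_const_mul, hlin0, mul_zero, zero_add]
  simp only [integral_const, probReal_univ, one_smul]
  have h1 : ∫ η, Z η ∂P ≤ C * ε ^ 2 * (1 + dist o x) ^ q * I := by
    rw [hI, ← integral_const_mul]
    exact integral_mono hZ_int hdom fun η => (le_abs_self _).trans (hZle η)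
  have h2 := one_add_rpow_le (dist_nonneg : 0 ≤ dist o x) (by linarith : 0 ≤ q)
  have h3 : C * ε ^ 2 * (1 + dist o x) ^ q * I ≤
      C * ε ^ 2 * (2 ^ q * (1 + dist o x ^ q)) * I := by gcongr
  linarith

/-- Along a trajectory, `∫⁻ (1 + r ^ q)` grows at most by the one-step factor: the position at step
`j` and the noise of step `j` are independent, so that Tonelli's theorem applies. -/
theorem lintegral_traj_succ_le (hE : IsFrame E) {B : ℝ} (hB : ∀ d x, ‖E d x‖ ≤ B)
    (hfc : ∀ d, Continuous (f d)) (m : Tableau s K L) (h : ℝ) (hξ : IsNoise P p ξ)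
    {X₀ : Ω → M} (hX₀ : Measurable X₀)
    (hind : IndepFun X₀ (fun η (a : ℕ × Fin D × Fin L) => ξ a.1 a.2.1 a.2.2 η) P)
    {ψ : M → ℝ} (hψ : Measurable ψ) {G : ℝ} (hG : 0 ≤ G) (hψ0 : ∀ x, 0 ≤ ψ x)
    (hstep : ∀ x, Integrable (fun η => ψ (m.step E f h x (noiseVec ξ 0 η))) P ∧
      ∫ η, ψ (m.step E f h x (noiseVec ξ 0 η)) ∂P ≤ G * ψ x) (j : ℕ) :
    ∫⁻ η, ENNReal.ofReal (ψ (m.traj E f h (X₀ η) (fun i => noiseVec ξ i η) (j + 1))) ∂P ≤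
      ENNReal.ofReal G *
        ∫⁻ η, ENNReal.ofReal (ψ (m.traj E f h (X₀ η) (fun i => noiseVec ξ i η) j)) ∂P := by
  have hXm : Measurable fun η => m.traj E f h (X₀ η) (fun i => noiseVec ξ i η) j :=
    (measurable_traj hE hB hfc m h j).comp
      (hX₀.prodMk (measurable_pi_lambda _ fun i => hξ.measurable_noiseVec i))
  have hF : Measurable fun u : M × (Fin D → Fin L → ℝ) =>
      ENNReal.ofReal (ψ (m.step E f h u.1 u.2)) :=
    (hψ.comp (measurable_step hE hB hfc m h)).ennreal_ofReal
  have hψX : Measurable fun η =>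
      ENNReal.ofReal (ψ (m.traj E f h (X₀ η) (fun i => noiseVec ξ i η) j)) :=
    (hψ.comp hXm).ennreal_ofReal
  rw [← lintegral_const_mul _ hψX]
  refine lintegral_comp_le_of_indepFun hXm (hξ.measurable_noiseVec j) (hξ.measurable_noiseVec 0)
    (indepFun_traj hE hB hfc m h hξ hX₀ hind j) (hξ.identDistrib_noiseVec j) hF
    (G := fun x => ENNReal.ofReal G * ENNReal.ofReal (ψ x))
    (hψ.ennreal_ofReal.const_mul _) fun x => ?_
  have h1 := ofReal_integral_eq_lintegral_ofReal (hstep x).1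
    (Eventually.of_forall fun _ => hψ0 _)
  have h2 := ENNReal.ofReal_le_ofReal (hstep x).2
  rw [h1, ENNReal.ofReal_mul hG] at h2
  exact h2

/-- The moments of the numerical trajectory are bounded uniformly in the step size. -/
theorem bounded_moments (hE : IsFrame E) {B : ℝ} (hB : ∀ d x, ‖E d x‖ ≤ B) (hB0 : 0 ≤ B)
    {A : ℝ} (hA0 : 0 ≤ A) (hf : ∀ d x, |f d x| ≤ A * (1 + dist o x))
    (hfc : ∀ d, Continuous (f d)) (hr : DistPowerBounds E o) (m : Tableau s K L)
    (hξ : IsNoise P p ξ) {X₀ : Ω → M} (hX₀ : Measurable X₀)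
    (hind : IndepFun X₀ (fun η (a : ℕ × Fin D × Fin L) => ξ a.1 a.2.1 a.2.2 η) P)
    (hmom : ∀ k : ℕ, Integrable (fun η => dist o (X₀ η) ^ k) P) {κ : ℝ} (hκ : 0 ≤ κ)
    {T : ℝ} (hT : 0 < T) :
    ∃ C : ℝ, ∀ N : ℕ, 1 ≤ N → ∀ j ≤ N,
      Integrable (fun η =>
        dist o (m.traj E f (T / N) (X₀ η) (fun i => noiseVec ξ i η) j) ^ κ) P ∧
      ∫ η, dist o (m.traj E f (T / N) (X₀ η) (fun i => noiseVec ξ i η) j) ^ κ ∂P ≤ C := by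
  -- exponents below `2` are excluded so that two derivatives leave a nonnegative exponent
  obtain ⟨q, hq, hsm, C₀, hC₀⟩ := hr (max κ 2)
  have hκq : κ ≤ q := (le_max_left _ _).trans hq
  have hq2 : 2 ≤ q := (le_max_right _ _).trans hq
  obtain ⟨G, hG0, hG⟩ := integral_step_rpow_le hE hB hB0 hA0 hf hfc m (√T) hξ hq2
    (hsm.of_le (by norm_cast)) (fun w hw => hC₀ w (by omega))
  set ψ : M → ℝ := fun x => 1 + dist o x ^ q with hψ
  have hdist : Measurable fun x : M => dist o x := (continuous_const.dist continuous_id).measurable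
  have hψm : Measurable ψ := measurable_const.add (hdist.pow_const q)
  have hψ0 : ∀ x, 0 ≤ ψ x := fun x => by
    have := Real.rpow_nonneg (dist_nonneg : 0 ≤ dist o x) q
    simp only [hψ]; linarith
  set a₀ := ∫⁻ η, ENNReal.ofReal (ψ (X₀ η)) ∂P with ha₀
  have ha₀' : a₀ ≠ ⊤ := by
    have hint : Integrable (fun η => 1 + (1 + dist o (X₀ η) ^ ⌈q⌉₊)) P :=
      (integrable_const _).add ((integrable_const _).add (hmom _))
    refine ne_top_of_le_ne_top hint.lintegral_lt_top.ne (lintegral_mono fun η => ?_)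
    refine ENNReal.ofReal_le_ofReal (add_le_add le_rfl ?_)
    rw [← Real.rpow_natCast]
    exact rpow_le_one_add_rpow dist_nonneg (by linarith) (Nat.le_ceil q)
  refine ⟨(ENNReal.ofReal (Real.exp (G * T)) * a₀).toReal, fun N hN j hj => ?_⟩
  have hN0 : (0 : ℝ) < N := by exact_mod_cast hN
  set h := T / N with hh
  have hh0 : 0 ≤ h := by positivity
  have hε : √h ∈ Icc 0 (√T) :=
    ⟨Real.sqrt_nonneg _, Real.sqrt_le_sqrt (div_le_self hT.le (by exact_mod_cast hN))⟩
  have hstep : ∀ x, Integrable (fun η => ψ (m.step E f h x (noiseVec ξ 0 η))) P ∧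
      ∫ η, ψ (m.step E f h x (noiseVec ξ 0 η)) ∂P ≤ (1 + G * h) * ψ x := by
    intro x
    have := hG (√h) hε x
    rwa [Real.sq_sqrt hh0] at this
  set X : ℕ → Ω → M := fun j η => m.traj E f h (X₀ η) (fun i => noiseVec ξ i η) j with hX
  have hXm : ∀ j, Measurable (X j) := fun j => (measurable_traj hE hB hfc m h j).comp
    (hX₀.prodMk (measurable_pi_lambda _ fun i => hξ.measurable_noiseVec i))
  have hiter : ∀ j, ∫⁻ η, ENNReal.ofReal (ψ (X j η)) ∂P ≤
      ENNReal.ofReal (1 + G * h) ^ j * a₀ := by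
    intro j
    induction j with
    | zero => rw [pow_zero, one_mul]; exact le_rfl
    | succ j ih =>
      refine (lintegral_traj_succ_le hE hB hfc m h hξ hX₀ hind hψm (by positivity) hψ0
        hstep j).trans ?_
      rw [pow_succ', mul_assoc]
      gcongr
  have hle : ∫⁻ η, ENNReal.ofReal (ψ (X j η)) ∂P ≤ ENNReal.ofReal (Real.exp (G * T)) * a₀ := by
    refine (hiter j).trans ?_
    gcongr
    rw [← ENNReal.ofReal_pow (by positivity)]
    refine ENNReal.ofReal_le_ofReal ?_
    calc (1 + G * h) ^ j ≤ Real.exp (G * h) ^ j :=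
          pow_le_pow_left₀ (by positivity) (by linarith [Real.add_one_le_exp (G * h)]) _
      _ = Real.exp (j * (G * h)) := (Real.exp_nat_mul _ _).symm
      _ ≤ Real.exp (G * T) := by
          refine Real.exp_le_exp.2 ?_
          have h1 : (j : ℝ) * h ≤ T := by
            calc (j : ℝ) * h ≤ N * h := by gcongr
              _ = T := by rw [hh]; field_simp
          calc (j : ℝ) * (G * h) = G * (j * h) := by ring
            _ ≤ G * T := by gcongr
  have hfin : ENNReal.ofReal (Real.exp (G * T)) * a₀ ≠ ⊤ :=
    ENNReal.mul_ne_top ENNReal.ofReal_ne_top ha₀'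
  have hκm : Measurable fun η => dist o (X j η) ^ κ := (hdist.comp (hXm j)).pow_const κ
  have hκ0 : ∀ η, 0 ≤ dist o (X j η) ^ κ := fun η => Real.rpow_nonneg dist_nonneg _
  have hκle : ∫⁻ η, ENNReal.ofReal (dist o (X j η) ^ κ) ∂P ≤
      ENNReal.ofReal (Real.exp (G * T)) * a₀ :=
    (lintegral_mono fun η => ENNReal.ofReal_le_ofReal
      (rpow_le_one_add_rpow dist_nonneg hκ hκq)).trans hle
  refine ⟨⟨hκm.aestronglyMeasurable, ?_⟩, ?_⟩
  · rw [hasFiniteIntegral_iff_ofReal (Eventually.of_forall hκ0)]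
    exact lt_of_le_of_lt hκle (lt_top_iff_ne_top.2 hfin)
  · rw [integral_eq_lintegral_of_nonneg_ae (Eventually.of_forall hκ0) hκm.aestronglyMeasurable]
    exact ENNReal.toReal_mono hfin hκle

end BoundedMoments

/-! ### Orders of magnitude, symbols and differential operators -/

section Orders

variable {M : Type*} [MetricSpace M] {D L : ℕ} {o : M}

/-- Functions of polynomial growth in the distance to `o`. -/
def PolyBounded (o : M) (g : M → ℝ) : Prop :=
  ∃ (C : ℝ) (κ : ℕ), 0 ≤ C ∧ ∀ x, |g x| ≤ C * (1 + dist o x) ^ κ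

/-- The data of one step: the square root `ε = √h ∈ [0, 1]` of the step size, the starting point
and the noise. -/
abbrev StepData (M : Type*) (D L : ℕ) : Type _ := Icc (0 : ℝ) 1 × M × (Fin D → Fin L → ℝ)

/-- Functions of the data of one step that are `O(ε ^ m)` with polynomial growth in the starting
point and in the noise. -/
def HasOrder (o : M) (m : ℕ) (G : StepData M D L → ℝ) : Prop :=
  ∃ (C : ℝ) (κ : ℕ), 0 ≤ C ∧ ∀ z, |G z| ≤ C * (z.1 : ℝ) ^ m * weight o z.2.1 z.2.2 ^ κ

theorem PolyBounded.hasOrder_zero {g : M → ℝ} (hg : PolyBounded o g) :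
    HasOrder o 0 fun z : StepData M D L => g z.2.1 := by
  obtain ⟨C, κ, hC, h⟩ := hg
  refine ⟨C, κ, hC, fun z => (h _).trans ?_⟩
  have h1 := one_add_dist_le_weight o z.2.1 z.2.2
  rw [pow_zero, mul_one]
  gcongr

theorem PolyBounded.mul {g g' : M → ℝ} (hg : PolyBounded o g) (hg' : PolyBounded o g') :
    PolyBounded o (g * g') := by
  obtain ⟨C, κ, hC, h⟩ := hg
  obtain ⟨C', κ', hC', h'⟩ := hg'
  refine ⟨C * C', κ + κ', by positivity, fun x => ?_⟩
  rw [Pi.mul_apply, abs_mul, pow_add]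
  calc |g x| * |g' x| ≤ (C * (1 + dist o x) ^ κ) * (C' * (1 + dist o x) ^ κ') :=
        mul_le_mul (h x) (h' x) (abs_nonneg _) (by positivity)
    _ = _ := by ring

theorem PolyBounded.add {g g' : M → ℝ} (hg : PolyBounded o g) (hg' : PolyBounded o g') :
    PolyBounded o (g + g') := by
  obtain ⟨C, κ, hC, h⟩ := hg
  obtain ⟨C', κ', hC', h'⟩ := hg'
  refine ⟨C + C', max κ κ', by positivity, fun x => ?_⟩
  have h1 : (1 : ℝ) ≤ 1 + dist o x := by linarith [(dist_nonneg : 0 ≤ dist o x)]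
  have h2 := pow_le_pow_right₀ h1 (le_max_left κ κ')
  have h3 := pow_le_pow_right₀ h1 (le_max_right κ κ')
  calc |g x + g' x| ≤ |g x| + |g' x| := abs_add_le _ _
    _ ≤ C * (1 + dist o x) ^ κ + C' * (1 + dist o x) ^ κ' := add_le_add (h x) (h' x)
    _ ≤ C * (1 + dist o x) ^ max κ κ' + C' * (1 + dist o x) ^ max κ κ' := by gcongr
    _ = _ := by ring

theorem PolyBounded.const (c : ℝ) : PolyBounded o fun _ => c :=
  ⟨|c|, 0, abs_nonneg _, fun x => by simp⟩

theorem PolyBounded.sum {ι : Type*} {s : Finset ι} {g : ι → M → ℝ}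
    (hg : ∀ i ∈ s, PolyBounded o (g i)) : PolyBounded o fun x => ∑ i ∈ s, g i x := by
  have h := Finset.sum_induction g (PolyBounded o) (fun _ _ => PolyBounded.add)
    (PolyBounded.const 0) hg
  convert! h using 1
  funext x
  simp

theorem PolyBounded.abs {g : M → ℝ} (hg : PolyBounded o g) : PolyBounded o fun x => |g x| := by
  obtain ⟨C, κ, hC, h⟩ := hg
  exact ⟨C, κ, hC, fun x => by rw [abs_abs]; exact h x⟩

theorem HasOrder.of_le {m : ℕ} {G G' : StepData M D L → ℝ} (hG : HasOrder o m G)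
    (h : ∀ z, |G' z| ≤ |G z|) : HasOrder o m G' := by
  obtain ⟨C, κ, hC, h'⟩ := hG
  exact ⟨C, κ, hC, fun z => (h z).trans (h' z)⟩

theorem HasOrder.mono {m m' : ℕ} {G : StepData M D L → ℝ} (hG : HasOrder o m G) (h : m' ≤ m) :
    HasOrder o m' G := by
  obtain ⟨C, κ, hC, h'⟩ := hG
  refine ⟨C, κ, hC, fun z => (h' z).trans ?_⟩
  have h1 := pow_le_pow_of_le_one z.1.2.1 z.1.2.2 h
  have h2 : 0 ≤ weight o z.2.1 z.2.2 := zero_le_one.trans (one_le_weight _ _ _)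
  gcongr

theorem HasOrder.add {m : ℕ} {G G' : StepData M D L → ℝ} (hG : HasOrder o m G)
    (hG' : HasOrder o m G') : HasOrder o m (G + G') := by
  obtain ⟨C, κ, hC, h⟩ := hG
  obtain ⟨C', κ', hC', h'⟩ := hG'
  refine ⟨C + C', max κ κ', by positivity, fun z => ?_⟩
  have h1 := one_le_weight o z.2.1 z.2.2
  have h2 := pow_le_pow_right₀ h1 (le_max_left κ κ')
  have h3 := pow_le_pow_right₀ h1 (le_max_right κ κ')
  have h4 := z.1.2.1
  calc |G z + G' z| ≤ |G z| + |G' z| := abs_add_le _ _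
    _ ≤ C * (z.1 : ℝ) ^ m * weight o z.2.1 z.2.2 ^ κ +
        C' * (z.1 : ℝ) ^ m * weight o z.2.1 z.2.2 ^ κ' := add_le_add (h z) (h' z)
    _ ≤ C * (z.1 : ℝ) ^ m * weight o z.2.1 z.2.2 ^ max κ κ' +
        C' * (z.1 : ℝ) ^ m * weight o z.2.1 z.2.2 ^ max κ κ' := by gcongr
    _ = _ := by ring

theorem HasOrder.mul {m m' : ℕ} {G G' : StepData M D L → ℝ} (hG : HasOrder o m G)
    (hG' : HasOrder o m' G') : HasOrder o (m + m') (G * G') := by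
  obtain ⟨C, κ, hC, h⟩ := hG
  obtain ⟨C', κ', hC', h'⟩ := hG'
  refine ⟨C * C', κ + κ', by positivity, fun z => ?_⟩
  have h1 : 0 ≤ weight o z.2.1 z.2.2 := zero_le_one.trans (one_le_weight _ _ _)
  have h4 := z.1.2.1
  rw [Pi.mul_apply, abs_mul]
  calc |G z| * |G' z| ≤ (C * (z.1 : ℝ) ^ m * weight o z.2.1 z.2.2 ^ κ) *
        (C' * (z.1 : ℝ) ^ m' * weight o z.2.1 z.2.2 ^ κ') :=
        mul_le_mul (h z) (h' z) (abs_nonneg _) (by positivity)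
    _ = _ := by ring

theorem HasOrder.const (c : ℝ) : HasOrder o 0 fun _ : StepData M D L => c :=
  ⟨|c|, 0, abs_nonneg _, fun z => by simp⟩

theorem HasOrder.zero (m : ℕ) : HasOrder o m (0 : StepData M D L → ℝ) :=
  ⟨0, 0, le_rfl, fun z => by simp⟩

theorem HasOrder.const_mul {m : ℕ} {G : StepData M D L → ℝ} (c : ℝ) (hG : HasOrder o m G) :
    HasOrder o m fun z => c * G z := by
  have h := (HasOrder.const c).mul hG
  rw [zero_add] at h
  exact h

theorem HasOrder.sum {m : ℕ} {ι : Type*} {s : Finset ι} {G : ι → StepData M D L → ℝ}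
    (hG : ∀ i ∈ s, HasOrder o m (G i)) : HasOrder o m (∑ i ∈ s, G i) :=
  Finset.sum_induction G (HasOrder o m) (fun _ _ => HasOrder.add) (HasOrder.zero m) hG

theorem HasOrder.abs {m : ℕ} {G : StepData M D L → ℝ} (hG : HasOrder o m G) :
    HasOrder o m fun z => |G z| :=
  hG.of_le fun z => by rw [abs_abs]

theorem HasOrder.pow {m : ℕ} {G : StepData M D L → ℝ} (hG : HasOrder o m G) (k : ℕ) :
    HasOrder o (k * m) (G ^ k) := by
  induction k with
  | zero => rw [pow_zero, zero_mul]; exact HasOrder.const 1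
  | succ k ih => rw [pow_succ, Nat.succ_mul]; exact ih.mul hG

theorem hasOrder_eps_pow (k : ℕ) : HasOrder o k fun z : StepData M D L => (z.1 : ℝ) ^ k :=
  ⟨1, 0, zero_le_one, fun z => by simp [abs_of_nonneg z.1.2.1]⟩

theorem hasOrder_noiseMonomial (α : Fin D → Fin L → ℕ) :
    HasOrder o 0 fun z : StepData M D L => noiseMonomial α z.2.2 := by
  refine ⟨1, ∑ d, ∑ l, α d l, zero_le_one, fun z => (abs_noiseMonomial_le α _).trans ?_⟩
  rw [pow_zero, mul_one, one_mul]
  refine pow_le_pow_left₀ (by positivity) ?_ _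
  unfold weight
  exact le_mul_of_one_le_left (by positivity) (by linarith [(dist_nonneg : 0 ≤ dist o z.2.1)])

end Orders

section Symbols

variable (n : ℕ) {M : Type*} [MetricSpace M] [ChartedSpace (EuclideanSpace ℝ (Fin n)) M]
  {D L : ℕ} {E : Fin D → (x : M) → TangentSpace (𝓡 n) x} {o : M}

/-- A monomial in `ε` and in the noise, with a smooth coefficient of polynomial growth, and with
total degree even. The parity condition makes the expectation contain even powers of `ε` only. -/
def IsSymbolMonomial (o : M) (t : StepData M D L → ℝ) : Prop :=
  ∃ (k : ℕ) (g : M → ℝ) (α : Fin D → Fin L → ℕ), ContMDiff (𝓡 n) 𝓘(ℝ, ℝ) ∞ g ∧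
    PolyBounded o g ∧ Even (k + ∑ d, ∑ l, α d l) ∧
    ∀ z, t z = (z.1 : ℝ) ^ k * g z.2.1 * noiseMonomial α z.2.2

/-- The linear combinations of monomials in `ε` and in the noise, with smooth coefficients of
polynomial growth. -/
def symbols (o : M) : Submodule ℝ (StepData M D L → ℝ) :=
  Submodule.span ℝ {t | IsSymbolMonomial n o t}

variable {n}

theorem noiseMonomial_add (α β : Fin D → Fin L → ℕ) (v : Fin D → Fin L → ℝ) :
    noiseMonomial (α + β) v = noiseMonomial α v * noiseMonomial β v := by
  simp only [noiseMonomial, Pi.add_apply, pow_add, Finset.prod_mul_distrib]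

theorem noiseMonomial_zero (v : Fin D → Fin L → ℝ) : noiseMonomial 0 v = 1 := by
  simp [noiseMonomial]

theorem IsSymbolMonomial.mul {t t' : StepData M D L → ℝ} (ht : IsSymbolMonomial n o t)
    (ht' : IsSymbolMonomial n o t') : IsSymbolMonomial n o (t * t') := by
  obtain ⟨k, g, α, hg, hgb, hk, h⟩ := ht
  obtain ⟨k', g', α', hg', hgb', hk', h'⟩ := ht'
  refine ⟨k + k', g * g', α + α', hg.mul hg', hgb.mul hgb', ?_, fun z => ?_⟩
  · have : k + k' + ∑ d, ∑ l, (α + α') d l = (k + ∑ d, ∑ l, α d l) + (k' + ∑ d, ∑ l, α' d l) := by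
      simp only [Pi.add_apply, Finset.sum_add_distrib]; ring
    rw [this]
    exact hk.add hk'
  · rw [Pi.mul_apply, h, h', noiseMonomial_add, pow_add, Pi.mul_apply]; ring

theorem mul_mem_symbols {t t' : StepData M D L → ℝ} (ht : t ∈ symbols n o)
    (ht' : t' ∈ symbols n o) : t * t' ∈ symbols n o := by
  have h : symbols (D := D) (L := L) n o * symbols n o ≤ symbols n o := by
    unfold symbols
    rw [Submodule.span_mul_span]
    refine Submodule.span_mono ?_
    rintro _ ⟨a, ha, b, hb, rfl⟩
    exact IsSymbolMonomial.mul ha hb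
  exact h (Submodule.mul_mem_mul ht ht')

theorem coeff_mem_symbols {g : M → ℝ} (hg : ContMDiff (𝓡 n) 𝓘(ℝ, ℝ) ∞ g) (hgb : PolyBounded o g) :
    (fun z : StepData M D L => g z.2.1) ∈ symbols n o :=
  Submodule.subset_span ⟨0, g, 0, hg, hgb, by simp, fun z => by simp [noiseMonomial_zero]⟩

theorem const_mem_symbols (c : ℝ) : (fun _ : StepData M D L => c) ∈ symbols n o :=
  coeff_mem_symbols (g := fun _ => c) contMDiff_const (PolyBounded.const c)

theorem eps_sq_mem_symbols : (fun z : StepData M D L => (z.1 : ℝ) ^ 2) ∈ symbols n o :=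
  Submodule.subset_span ⟨2, fun _ => 1, 0, contMDiff_const, PolyBounded.const 1, by simp,
    fun z => by simp [noiseMonomial_zero]⟩

theorem eps_mul_noise_mem_symbols (d : Fin D) (l : Fin L) :
    (fun z : StepData M D L => (z.1 : ℝ) * z.2.2 d l) ∈ symbols n o := by
  refine Submodule.subset_span ⟨1, fun _ => 1, fun d' l' => if d' = d ∧ l' = l then 1 else 0,
    contMDiff_const, PolyBounded.const 1, ?_, fun z => ?_⟩
  · have : ∑ d', ∑ l', (if d' = d ∧ l' = l then 1 else 0) = 1 := by
      simp only [ite_and]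
      simp
    rw [this]
    exact ⟨1, rfl⟩
  · have : noiseMonomial (fun d' l' => if d' = d ∧ l' = l then 1 else 0) z.2.2 = z.2.2 d l := by
      unfold noiseMonomial
      rw [Finset.prod_eq_single d, Finset.prod_eq_single l] <;> simp +contextual
    rw [this, pow_one, mul_one]

theorem hasOrder_zero_of_mem_symbols {t : StepData M D L → ℝ} (ht : t ∈ symbols n o) :
    HasOrder o 0 t := by
  induction ht using Submodule.span_induction with
  | mem t ht =>
    obtain ⟨k, g, α, -, hgb, -, h⟩ := ht
    have h1 : t = ((fun z => (z.1 : ℝ) ^ k) * fun z => g z.2.1) *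
        fun z => noiseMonomial α z.2.2 := funext h
    rw [h1]
    exact (((hasOrder_eps_pow k).mono k.zero_le).mul hgb.hasOrder_zero).mul
      (hasOrder_noiseMonomial α)
  | zero => exact HasOrder.zero 0
  | add x y _ _ hx hy => exact hx.add hy
  | smul a x _ hx => exact hx.const_mul a

/-- Functions of the data of one step that agree with a symbol up to order `m` in `ε`. -/
def HasSymbol (n : ℕ) {M : Type*} [MetricSpace M] [ChartedSpace (EuclideanSpace ℝ (Fin n)) M]
    {D L : ℕ} (o : M) (m : ℕ) (G : StepData M D L → ℝ) : Prop :=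
  ∃ t ∈ symbols n o, HasOrder o m (G - t)

theorem hasSymbol_of_mem {m : ℕ} {t : StepData M D L → ℝ} (ht : t ∈ symbols n o) :
    HasSymbol n o m t :=
  ⟨t, ht, by rw [sub_self]; exact HasOrder.zero m⟩

theorem HasSymbol.hasOrder_zero {m : ℕ} {G : StepData M D L → ℝ} (hG : HasSymbol n o m G) :
    HasOrder o 0 G := by
  obtain ⟨t, ht, h⟩ := hG
  have := (h.mono m.zero_le).add (hasOrder_zero_of_mem_symbols ht)
  rwa [sub_add_cancel] at this

theorem HasSymbol.add {m : ℕ} {G G' : StepData M D L → ℝ} (hG : HasSymbol n o m G)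
    (hG' : HasSymbol n o m G') : HasSymbol n o m (G + G') := by
  obtain ⟨t, ht, h⟩ := hG
  obtain ⟨t', ht', h'⟩ := hG'
  refine ⟨t + t', add_mem ht ht', ?_⟩
  rw [add_sub_add_comm]
  exact h.add h'

theorem HasSymbol.sum {m : ℕ} {ι : Type*} {s : Finset ι} {G : ι → StepData M D L → ℝ}
    (hG : ∀ i ∈ s, HasSymbol n o m (G i)) : HasSymbol n o m (∑ i ∈ s, G i) :=
  Finset.sum_induction G (HasSymbol n o m) (fun _ _ => HasSymbol.add)
    (hasSymbol_of_mem (zero_mem _)) hG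

/-- Replacing both factors of a product by approximations changes it by terms of high order. -/
theorem HasOrder.mul_sub_mul {m : ℕ} {G G' t t' : StepData M D L → ℝ} (hG : HasOrder o 0 G)
    (ht' : HasOrder o 0 t') (h : HasOrder o m (G - t)) (h' : HasOrder o m (G' - t')) :
    HasOrder o m (G * G' - t * t') := by
  have h1 := (hG.mul h').add ((h.mul ht').mono (by simp))
  rw [zero_add] at h1
  have h2 : G * G' - t * t' = G * (G' - t') + (G - t) * t' := by ring
  rw [h2]
  exact h1

theorem HasSymbol.mul {m : ℕ} {G G' : StepData M D L → ℝ} (hG : HasSymbol n o m G)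
    (hG' : HasSymbol n o m G') : HasSymbol n o m (G * G') := by
  have h0 := hG.hasOrder_zero
  obtain ⟨t, ht, h⟩ := hG
  obtain ⟨t', ht', h'⟩ := hG'
  exact ⟨t * t', mul_mem_symbols ht ht', h0.mul_sub_mul (hasOrder_zero_of_mem_symbols ht') h h'⟩

theorem HasSymbol.prod {m : ℕ} {ι : Type*} {s : Finset ι} {G : ι → StepData M D L → ℝ}
    (hG : ∀ i ∈ s, HasSymbol n o m (G i)) : HasSymbol n o m (∏ i ∈ s, G i) :=
  Finset.prod_induction G (HasSymbol n o m) (fun _ _ => HasSymbol.mul)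
    (hasSymbol_of_mem (const_mem_symbols 1)) hG

theorem HasSymbol.const_mul {m : ℕ} {G : StepData M D L → ℝ} (c : ℝ) (hG : HasSymbol n o m G) :
    HasSymbol n o m fun z => c * G z :=
  (hasSymbol_of_mem (const_mem_symbols c)).mul hG

end Symbols

section Operators

variable {n : ℕ} {M : Type*} [MetricSpace M] [ChartedSpace (EuclideanSpace ℝ (Fin n)) M]
  {D L : ℕ} {E : Fin D → (x : M) → TangentSpace (𝓡 n) x} {o : M}

theorem iterD_append (w w' : List (Fin D)) (φ : M → ℝ) :
    iterD E (w ++ w') φ = iterD E w (iterD E w' φ) := by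
  induction w with
  | nil => rfl
  | cons d w ih => rw [List.cons_append, iterD, iterD, ih]

theorem PolyGrowth.polyBounded {φ : M → ℝ} (hφ : PolyGrowth E o φ) (w : List (Fin D)) :
    PolyBounded o (iterD E w φ) := by
  obtain ⟨C, k, h⟩ := hφ.2 w
  refine ⟨2 * |C|, k, by positivity, fun x => (h x).trans ?_⟩
  have h0 : (0 : ℝ) ≤ dist o x := dist_nonneg
  have h1 : dist o x ^ k ≤ (1 + dist o x) ^ k := by gcongr; linarith
  have h2 : 1 ≤ (1 + dist o x) ^ k := one_le_pow₀ (by linarith)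
  calc C * (1 + dist o x ^ k) ≤ |C| * (1 + dist o x ^ k) := by
        gcongr; exact le_abs_self C
    _ ≤ |C| * ((1 + dist o x) ^ k + (1 + dist o x) ^ k) := by gcongr
    _ = _ := by ring

variable (E o) in
/-- The differential operators in the frame whose coefficients are symbols, as maps from functions
on the manifold to functions of the data of one step. -/
def frameOps (L : ℕ) : Submodule ℝ ((M → ℝ) → StepData M D L → ℝ) :=
  Submodule.span ℝ {Λ | ∃ t ∈ symbols n o, ∃ w : List (Fin D),
    Λ = fun φ z => t z * iterD E w φ z.2.1}

theorem mul_comp_iterD_mem_frameOps {t : StepData M D L → ℝ} (ht : t ∈ symbols n o)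
    {Λ : (M → ℝ) → StepData M D L → ℝ} (hΛ : Λ ∈ frameOps E o L) (w : List (Fin D)) :
    (fun φ => t * Λ (iterD E w φ)) ∈ frameOps E o L := by
  induction hΛ using Submodule.span_induction with
  | mem Λ hΛ =>
    obtain ⟨t', ht', w', rfl⟩ := hΛ
    refine Submodule.subset_span ⟨t * t', mul_mem_symbols ht ht', w' ++ w, ?_⟩
    funext φ z
    rw [iterD_append, Pi.mul_apply, Pi.mul_apply, mul_assoc]
  | zero =>
    convert! zero_mem (frameOps E o L) using 1
    funext φ z; simp
  | add x y _ _ hx hy =>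
    convert! add_mem hx hy using 1
    funext φ z; simp [mul_add]
  | smul a x _ hx =>
    convert! Submodule.smul_mem _ a hx using 1
    funext φ z; simp; ring

variable [IsManifold (𝓡 n) ∞ M]

theorem PolyGrowth.iterD (hE : IsFrame E) {φ : M → ℝ} (hφ : PolyGrowth E o φ)
    (w : List (Fin D)) : PolyGrowth E o (iterD E w φ) :=
  ⟨iterD_contMDiff_infty hE hφ.1 w, fun w' => by rw [← iterD_append]; exact hφ.2 _⟩

theorem apply_mem_symbols (hE : IsFrame E) {Λ : (M → ℝ) → StepData M D L → ℝ}
    (hΛ : Λ ∈ frameOps E o L) {φ : M → ℝ} (hφ : PolyGrowth E o φ) : Λ φ ∈ symbols n o := by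
  induction hΛ using Submodule.span_induction with
  | mem Λ hΛ =>
    obtain ⟨t, ht, w, rfl⟩ := hΛ
    exact mul_mem_symbols ht
      (coeff_mem_symbols (iterD_contMDiff_infty hE hφ.1 w) (hφ.polyBounded w))
  | zero => exact zero_mem _
  | add x y _ _ hx hy => exact add_mem hx hy
  | smul a x _ hx => exact Submodule.smul_mem _ a hx

end Operators

section LinDiffOp

variable {n : ℕ} {M : Type*} [MetricSpace M] [ChartedSpace (EuclideanSpace ℝ (Fin n)) M]
  {D : ℕ} {E : Fin D → (x : M) → TangentSpace (𝓡 n) x}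

theorem isLinDiffOp_zero : IsLinDiffOp E 0 :=
  ⟨∅, fun _ _ => 0, by simp, fun φ _ x => by simp⟩

theorem isLinDiffOp_coeff_iterD {g : M → ℝ} (hg : ContMDiff (𝓡 n) 𝓘(ℝ, ℝ) ∞ g)
    (w : List (Fin D)) : IsLinDiffOp E fun φ x => g x * iterD E w φ x :=
  ⟨{w}, fun _ => g, fun _ _ => hg, fun φ _ x => by simp⟩

theorem IsLinDiffOp.add {A A' : (M → ℝ) → M → ℝ} (hA : IsLinDiffOp E A) (hA' : IsLinDiffOp E A') :
    IsLinDiffOp E (A + A') := by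
  obtain ⟨W, a, ha, h⟩ := hA
  obtain ⟨W', a', ha', h'⟩ := hA'
  refine ⟨W ∪ W', fun w x => (if w ∈ W then a w x else 0) + (if w ∈ W' then a' w x else 0),
    fun w _ => ?_, fun φ hφ x => ?_⟩
  · refine ContMDiff.add ?_ ?_
    · by_cases hw : w ∈ W
      · simpa only [hw, if_true] using ha w hw
      · simpa only [hw, if_false] using contMDiff_const
    · by_cases hw : w ∈ W'
      · simpa only [hw, if_true] using ha' w hw
      · simpa only [hw, if_false] using contMDiff_const
  · rw [Pi.add_apply, Pi.add_apply, h φ hφ, h' φ hφ]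
    simp only [add_mul, ite_mul, zero_mul, Finset.sum_add_distrib, Finset.sum_ite_mem,
      Finset.union_inter_cancel_left, Finset.union_inter_cancel_right]

theorem IsLinDiffOp.smul {A : (M → ℝ) → M → ℝ} (c : ℝ) (hA : IsLinDiffOp E A) :
    IsLinDiffOp E (c • A) := by
  obtain ⟨W, a, ha, h⟩ := hA
  refine ⟨W, fun w x => c * a w x, fun w hw => contMDiff_const.mul (ha w hw), fun φ hφ x => ?_⟩
  rw [Pi.smul_apply, Pi.smul_apply, h φ hφ, smul_eq_mul, Finset.mul_sum]
  simp only [mul_assoc]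

end LinDiffOp

/-! ### Expansion of the stages and of the step -/

section Expansion

variable {n : ℕ} {M : Type*} [MetricSpace M] [ChartedSpace (EuclideanSpace ℝ (Fin n)) M]
  {D L : ℕ} {E : Fin D → (x : M) → TangentSpace (𝓡 n) x} {o : M}

/-- A point `Y` depending on the data of one step expands to order `m` if it grows polynomially and
if, for one operator `Λ` with symbols as coefficients, every test function satisfies
`φ(Y) = Λ φ + O(ε ^ m)`. -/
def Expands (E : Fin D → (x : M) → TangentSpace (𝓡 n) x) (o : M) (m : ℕ)
    (Y : StepData M D L → M) : Prop :=
  HasOrder o 0 (fun z => dist o (Y z)) ∧ ∃ Λ ∈ frameOps E o L, ∀ φ, PolyGrowth E o φ →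
    HasOrder o m ((fun z => φ (Y z)) - Λ φ)

theorem expands_start (m : ℕ) : Expands E o m fun z : StepData M D L => z.2.1 := by
  refine ⟨PolyBounded.hasOrder_zero (g := fun x => dist o x) ⟨1, 1, zero_le_one, fun x => ?_⟩,
    fun φ z => 1 * iterD E [] φ z.2.1,
    Submodule.subset_span ⟨fun _ => 1, const_mem_symbols 1, [], rfl⟩, fun φ _ => ?_⟩
  · rw [abs_of_nonneg dist_nonneg]; linarith
  · convert! HasOrder.zero (o := o) (M := M) (D := D) (L := L) m using 1
    funext z
    simp [iterD]

/-- A function of polynomial growth composed with a map of polynomial growth. -/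
theorem HasOrder.of_abs_le_dist {G R : StepData M D L → ℝ} {C : ℝ} (κ : ℕ)
    (hR : HasOrder o 0 R) (hC : 0 ≤ C) (h : ∀ z, |G z| ≤ C * (1 + |R z|) ^ κ) : HasOrder o 0 G := by
  have h1 := ((((HasOrder.const 1).add hR.abs).pow κ).const_mul C)
  rw [mul_zero] at h1
  refine h1.of_le fun z => (h z).trans (le_of_eq ?_)
  have h2 : (0 : ℝ) ≤ C * (1 + |R z|) ^ κ := by positivity
  exact (abs_of_nonneg h2).symm

variable [IsManifold (𝓡 n) ∞ M]

theorem Expands.hasSymbol (hE : IsFrame E) {m : ℕ} {Y : StepData M D L → M}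
    (hY : Expands E o m Y) {φ : M → ℝ} (hφ : PolyGrowth E o φ) :
    HasSymbol n o m fun z => φ (Y z) := by
  obtain ⟨-, Λ, hΛ, h⟩ := hY
  exact ⟨Λ φ, apply_mem_symbols hE hΛ hφ, h φ hφ⟩

variable [Bundle.RiemannianBundle (fun x : M => TangentSpace (𝓡 n) x)]
  [IsRiemannianManifold (𝓡 n) M] [CompleteSpace M] {B : ℝ}

/-- Expansions propagate along frozen flows with small coefficients: by Taylor's formula, the flow
acts on test functions through frame derivatives at its starting point. -/
theorem Expands.expFlow (hE : IsFrame E) (hB : ∀ d x, ‖E d x‖ ≤ B) (hB0 : 0 ≤ B) {m : ℕ}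
    {Y : StepData M D L → M} (hY : Expands E o m Y) {c : Fin D → StepData M D L → ℝ}
    (hc : ∀ d, HasSymbol n o m (c d)) (hc1 : ∀ d, HasOrder o 1 (c d)) :
    Expands E o m fun z => expFlow (frozenField E fun d => c d z) (Y z) := by
  obtain ⟨hY0, Λ, hΛ, hYΛ⟩ := hY
  have hS : HasOrder o 1 (∑ d, fun z => |c d z|) := HasOrder.sum fun d _ => (hc1 d).abs
  have hSz : ∀ z, (∑ d, fun z => |c d z|) z = ∑ d, |c d z| := fun z => by simp
  -- a bound for the distance from `o` to all points reached by the flow up to time `1`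
  set R : StepData M D L → ℝ := (fun z => dist o (Y z)) + fun z => B * (∑ d, fun z => |c d z|) z
    with hRdef
  have hR : HasOrder o 0 R := hY0.add ((hS.mono (Nat.zero_le 1)).const_mul B)
  have hRz : ∀ z, R z = dist o (Y z) + B * ∑ d, |c d z| := fun z => by
    simp only [hRdef, Pi.add_apply, hSz]
  have hR0 : ∀ z, 0 ≤ R z := fun z => by rw [hRz]; positivity
  have hball : ∀ z y, dist (Y z) y ≤ B * ∑ d, |c d z| → dist o y ≤ R z := fun z y hy => by
    rw [hRz]
    exact (dist_triangle o (Y z) y).trans (by gcongr)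
  refine ⟨hR.of_le fun z => ?_, ?_⟩
  · rw [abs_of_nonneg dist_nonneg, abs_of_nonneg (hR0 z)]
    exact hball z _ (dist_expFlow_le hE hB _ _)
  have hprod : ∀ (k : ℕ) (w : Fin k → Fin D), HasSymbol n o m (∏ i, c (w i)) := fun k w =>
    HasSymbol.prod fun i _ => hc (w i)
  choose t ht htc using hprod
  refine ⟨∑ k ∈ Finset.range m, (1 / k.factorial : ℝ) • ∑ w : Fin k → Fin D,
      fun φ => t k w * Λ (iterD E (List.ofFn w) φ), ?_, fun φ hφ => ?_⟩
  · exact sum_mem fun k _ => Submodule.smul_mem _ _ (sum_mem fun w _ =>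
      mul_comp_iterD_mem_frameOps (ht k w) hΛ _)
  -- the Taylor remainder
  have hrem : HasOrder o m fun z => φ (FrozenFlow.expFlow (frozenField E fun d => c d z) (Y z)) -
      ∑ k ∈ Finset.range m, (1 / k.factorial : ℝ) * wordSum E (fun d => c d z) k φ (Y z) := by
    have hpb : PolyBounded o fun x => ∑ w : Fin m → Fin D, |iterD E (List.ofFn w) φ x| :=
      PolyBounded.sum fun w _ => (hφ.polyBounded _).abs
    obtain ⟨C, κ, hC, h⟩ := hpb
    have hA : HasOrder o 0 fun z => C * (1 + |R z|) ^ κ :=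
      HasOrder.of_abs_le_dist κ hR hC fun z => le_of_eq (abs_of_nonneg (by positivity))
    have h1 := (hS.pow m).mul hA
    rw [mul_one, add_zero] at h1
    refine h1.of_le fun z => ?_
    have h2 := abs_expFlow_sub_wordSum_le hE hB (m := m) (φ := φ)
      (hφ.1.of_le (by exact_mod_cast le_top)) (fun d => c d z) (Y z) (A := C * (1 + |R z|) ^ κ) ?_
    · refine h2.trans (le_of_eq ?_)
      rw [Pi.mul_apply, Pi.pow_apply, hSz]
      exact (abs_of_nonneg (by positivity)).symm
    · intro y hy w
      have h3 : |iterD E (List.ofFn w) φ y| ≤ ∑ w : Fin m → Fin D, |iterD E (List.ofFn w) φ y| :=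
        Finset.single_le_sum (f := fun w : Fin m → Fin D => |iterD E (List.ofFn w) φ y|)
          (fun _ _ => abs_nonneg _) (Finset.mem_univ w)
      refine h3.trans ((le_abs_self _).trans ((h y).trans ?_))
      have h4 := (hball z y hy).trans (le_abs_self (R z))
      gcongr
  -- each term of the Taylor polynomial expands
  have hterm : HasOrder o m (∑ k ∈ Finset.range m, fun z => (1 / k.factorial : ℝ) *
      (∑ w : Fin k → Fin D, ((∏ i, c (w i)) * (fun z => iterD E (List.ofFn w) φ (Y z)) -
        t k w * Λ (iterD E (List.ofFn w) φ))) z) := by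
    refine HasOrder.sum fun k _ => HasOrder.const_mul _ (HasOrder.sum fun w _ => ?_)
    have hφw := hφ.iterD hE (List.ofFn w)
    exact HasOrder.mul_sub_mul (HasSymbol.hasOrder_zero (HasSymbol.prod fun i _ => hc (w i)))
      (hasOrder_zero_of_mem_symbols (apply_mem_symbols hE hΛ hφw)) (htc k w) (hYΛ _ hφw)
  convert! hrem.add hterm using 1
  funext z
  simp only [Pi.sub_apply, Pi.add_apply, Finset.sum_apply, Pi.smul_apply, Pi.mul_apply,
    Finset.prod_apply, smul_eq_mul, wordSum, Finset.sum_sub_distrib, mul_sub]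
  ring

theorem Expands.flowProd (hE : IsFrame E) (hB : ∀ d x, ‖E d x‖ ≤ B) (hB0 : 0 ≤ B) {m K : ℕ}
    {Y : StepData M D L → M} (hY : Expands E o m Y) {c : StepData M D L → Fin K → Fin D → ℝ}
    (hc : ∀ k d, HasSymbol n o m fun z => c z k d) (hc1 : ∀ k d, HasOrder o 1 fun z => c z k d) :
    Expands E o m fun z => flowProd E (c z) (Y z) := by
  induction K with
  | zero => simpa only [flowProd_zero] using hY
  | succ K ih =>
    simp only [flowProd_succ]
    exact Expands.expFlow hE hB hB0 (ih (c := fun z k => c z k.castSucc)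
      (fun k d => hc k.castSucc d) (fun k d => hc1 k.castSucc d))
      (c := fun d z => c z (Fin.last K) d) (fun d => hc _ d) fun d => hc1 _ d

omit [IsManifold (𝓡 n) ∞ M] [Bundle.RiemannianBundle (fun x : M => TangentSpace (𝓡 n) x)]
  [IsRiemannianManifold (𝓡 n) M] [CompleteSpace M] in
theorem hasSymbol_incr {m J K : ℕ} (z : Fin K → Fin J → ℝ) (zh : Fin K → Fin L → ℝ)
    {g : StepData M D L → Fin D → Fin J → ℝ} (hg : ∀ d j, HasSymbol n o m fun u => g u d j)
    (k : Fin K) (d : Fin D) :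
    HasSymbol n o m (fun u : StepData M D L => incr ((u.1 : ℝ) ^ 2) z zh (g u) u.2.2 k d) ∧
    HasOrder o 1 (fun u : StepData M D L => incr ((u.1 : ℝ) ^ 2) z zh (g u) u.2.2 k d) := by
  have hsum : HasSymbol n o m (∑ j, fun u => z k j * g u d j) :=
    HasSymbol.sum fun j _ => (hg d j).const_mul _
  have hnoise : ∀ l : Fin L, HasOrder o 1 fun u : StepData M D L => (u.1 : ℝ) * u.2.2 d l := by
    intro l
    refine ⟨1, 1, zero_le_one, fun u => ?_⟩
    rw [abs_mul, abs_of_nonneg u.1.2.1, one_mul, pow_one, pow_one]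
    exact mul_le_mul_of_nonneg_left
      ((abs_apply_le_norm _ d l).trans (norm_le_weight _ _ _)) u.1.2.1
  have heq : (fun u : StepData M D L => incr ((u.1 : ℝ) ^ 2) z zh (g u) u.2.2 k d) =
      (fun u => (u.1 : ℝ) ^ 2) * (∑ j, fun u => z k j * g u d j) +
        ∑ l, fun u => zh k l * ((u.1 : ℝ) * u.2.2 d l) := by
    funext u
    simp only [incr, Real.sqrt_sq u.1.2.1, Pi.add_apply, Pi.mul_apply, Finset.sum_apply,
      Finset.mul_sum]
    congr 1
    exact Finset.sum_congr rfl fun l _ => by ring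
  rw [heq]
  refine ⟨((hasSymbol_of_mem eps_sq_mem_symbols).mul hsum).add (HasSymbol.sum fun l _ =>
    (hasSymbol_of_mem (eps_mul_noise_mem_symbols d l)).const_mul _), ?_⟩
  exact (((hasOrder_eps_pow 2).mul hsum.hasOrder_zero).mono (by norm_num)).add
    (HasOrder.sum fun l _ => (hnoise l).const_mul _)

/-- All stages expand: the coordinates of the drift are test functions, so that their values at the
earlier stages have symbols. -/
theorem expands_stage (hE : IsFrame E) (hB : ∀ d x, ‖E d x‖ ≤ B) (hB0 : 0 ≤ B)
    {f : Fin D → M → ℝ} (hf : ∀ d, PolyGrowth E o (f d)) {s K : ℕ} (T : Tableau s K L) (m : ℕ)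
    (i : Fin s) : Expands E o m fun z => T.stage E f ((z.1 : ℝ) ^ 2) z.2.1 z.2.2 i := by
  induction i using WellFoundedLT.induction with
  | _ i ih =>
    rw [funext fun z : StepData M D L =>
      stage_eq_incr (E := E) (f := f) T ((z.1 : ℝ) ^ 2) z.2.1 z.2.2 i]
    have hg : ∀ d j, HasSymbol n o m fun z : StepData M D L =>
        if j < i then f d (T.stage E f ((z.1 : ℝ) ^ 2) z.2.1 z.2.2 j) else 0 := by
      intro d j
      split_ifs with hj
      · exact (ih j hj).hasSymbol hE (hf d)
      · exact hasSymbol_of_mem (const_mem_symbols 0)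
    exact (expands_start m).flowProd hE hB hB0 (fun k d => (hasSymbol_incr _ _ hg k d).1)
      fun k d => (hasSymbol_incr _ _ hg k d).2

theorem expands_step (hE : IsFrame E) (hB : ∀ d x, ‖E d x‖ ≤ B) (hB0 : 0 ≤ B)
    {f : Fin D → M → ℝ} (hf : ∀ d, PolyGrowth E o (f d)) {s K : ℕ} (T : Tableau s K L) (m : ℕ) :
    Expands E o m fun z => T.step E f ((z.1 : ℝ) ^ 2) z.2.1 z.2.2 := by
  simp only [step_eq_incr T]
  have hg : ∀ d j, HasSymbol n o m fun z : StepData M D L =>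
      f d (T.stage E f ((z.1 : ℝ) ^ 2) z.2.1 z.2.2 j) := fun d j =>
    (expands_stage hE hB hB0 hf T m j).hasSymbol hE (hf d)
  exact (expands_start m).flowProd hE hB hB0 (fun k d => (hasSymbol_incr _ _ hg k d).1)
    fun k d => (hasSymbol_incr _ _ hg k d).2

end Expansion

/-! ### Expectations and the Talay–Tubaro expansion -/

section Expectation

variable {n : ℕ} {M : Type*} [MetricSpace M] [ChartedSpace (EuclideanSpace ℝ (Fin n)) M]
  {D L : ℕ} {E : Fin D → (x : M) → TangentSpace (𝓡 n) x} {o : M}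
  {Ω : Type*} [MeasurableSpace Ω] {P : Measure Ω} {p : ℕ} {ξ : ℕ → Fin D → Fin L → Ω → ℝ}

/-- The expectation of `Λ φ` over the noise is a polynomial in `h = ε ^ 2` whose coefficients are
linear differential operators of polynomial growth applied to `φ`. -/
def HasMeanExpansion (E : Fin D → (x : M) → TangentSpace (𝓡 n) x) (o : M) (P : Measure Ω)
    (ζ : Ω → Fin D → Fin L → ℝ) (Λ : (M → ℝ) → StepData M D L → ℝ) : Prop :=
  ∃ (N₀ : ℕ) (A : ℕ → (M → ℝ) → M → ℝ), (∀ j, IsLinDiffOp E (A j)) ∧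
    ∀ φ, PolyGrowth E o φ → (∀ j, PolyBounded o (A j φ)) ∧
      ∀ (ε : Icc (0 : ℝ) 1) (x : M), Integrable (fun η => Λ φ (ε, x, ζ η)) P ∧
        ∀ N, N₀ ≤ N →
          ∫ η, Λ φ (ε, x, ζ η) ∂P = ∑ j ∈ Finset.range N, (ε : ℝ) ^ (2 * j) * A j φ x

variable {ζ : Ω → Fin D → Fin L → ℝ}

theorem HasMeanExpansion.zero : HasMeanExpansion E o P ζ 0 :=
  ⟨0, 0, fun _ => isLinDiffOp_zero, fun φ _ => ⟨fun _ => PolyBounded.const 0, fun ε x =>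
    ⟨by simp, fun N _ => by simp⟩⟩⟩

theorem HasMeanExpansion.add {Λ Λ' : (M → ℝ) → StepData M D L → ℝ}
    (h : HasMeanExpansion E o P ζ Λ) (h' : HasMeanExpansion E o P ζ Λ') :
    HasMeanExpansion E o P ζ (Λ + Λ') := by
  obtain ⟨N, A, hA, h⟩ := h
  obtain ⟨N', A', hA', h'⟩ := h'
  refine ⟨max N N', A + A', fun j => (hA j).add (hA' j), fun φ hφ => ⟨fun j =>
    ((h φ hφ).1 j).add ((h' φ hφ).1 j), fun ε x => ?_⟩⟩
  obtain ⟨hi, hs⟩ := (h φ hφ).2 ε x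
  obtain ⟨hi', hs'⟩ := (h' φ hφ).2 ε x
  refine ⟨hi.add hi', fun k hk => ?_⟩
  have h1 := hs k ((le_max_left _ _).trans hk)
  have h2 := hs' k ((le_max_right _ _).trans hk)
  simp only [Pi.add_apply]
  rw [integral_add hi hi', h1, h2, ← Finset.sum_add_distrib]
  exact Finset.sum_congr rfl fun j _ => by ring

theorem HasMeanExpansion.smul {Λ : (M → ℝ) → StepData M D L → ℝ} (c : ℝ)
    (h : HasMeanExpansion E o P ζ Λ) : HasMeanExpansion E o P ζ (c • Λ) := by
  obtain ⟨N, A, hA, h⟩ := h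
  refine ⟨N, c • A, fun j => (hA j).smul c, fun φ hφ => ⟨fun j =>
    (PolyBounded.const c).mul ((h φ hφ).1 j), fun ε x => ?_⟩⟩
  obtain ⟨hi, hs⟩ := (h φ hφ).2 ε x
  refine ⟨hi.const_mul c, fun k hk => ?_⟩
  simp only [Pi.smul_apply, smul_eq_mul]
  rw [integral_const_mul, hs k hk, Finset.mul_sum]
  exact Finset.sum_congr rfl fun j _ => by ring

variable [IsProbabilityMeasure P]

/-- The expectation of a monomial with an odd power of `ε` vanishes, because its degree in the noise
is odd; a monomial with an even power of `ε` contributes to a single coefficient. -/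
theorem IsSymbolMonomial.hasMeanExpansion (hξ : IsNoise P p ξ) {t : StepData M D L → ℝ}
    (ht : IsSymbolMonomial n o t) (w : List (Fin D)) :
    HasMeanExpansion E o P (noiseVec ξ 0) fun φ z => t z * iterD E w φ z.2.1 := by
  obtain ⟨k, g, α, hg, hgb, hk, ht⟩ := ht
  have hmean : ∀ (φ : M → ℝ) (ε : Icc (0 : ℝ) 1) (x : M),
      (fun η => t (ε, x, noiseVec ξ 0 η) * iterD E w φ x) =
        fun η => ((ε : ℝ) ^ k * g x * iterD E w φ x) * noiseMonomial α (noiseVec ξ 0 η) :=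
    fun φ ε x => by funext η; rw [ht]; ring
  have hint := hξ.integrable_noiseMonomial 0 α
  rcases Nat.even_or_odd k with hke | hko
  · obtain ⟨i, rfl⟩ := hke
    set b := ∫ η, noiseMonomial α (noiseVec ξ 0 η) ∂P with hb
    refine ⟨i + 1, fun j => if j = i then fun φ x => (b * g x) * iterD E w φ x else 0,
      fun j => ?_, fun φ hφ => ⟨fun j => ?_, fun ε x => ?_⟩⟩
    · dsimp only
      split_ifs
      · exact isLinDiffOp_coeff_iterD (contMDiff_const.mul hg) w
      · exact isLinDiffOp_zero
    · dsimp only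
      split_ifs
      · exact ((PolyBounded.const b).mul hgb).mul (hφ.polyBounded w)
      · exact PolyBounded.const 0
    · dsimp only
      rw [hmean]
      refine ⟨hint.const_mul _, fun N hN => ?_⟩
      rw [integral_const_mul, Finset.sum_eq_single i]
      · rw [if_pos rfl, ← two_mul]; ring
      · intro j _ hj
        rw [if_neg hj]; simp
      · intro hi
        exact absurd (Finset.mem_range.2 (by omega)) hi
  · refine ⟨0, 0, fun _ => isLinDiffOp_zero, fun φ hφ => ⟨fun _ => PolyBounded.const 0,
      fun ε x => ?_⟩⟩
    dsimp only
    rw [hmean]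
    refine ⟨hint.const_mul _, fun N _ => ?_⟩
    rw [integral_const_mul, hξ.integral_noiseMonomial_of_odd 0 ((Nat.even_add'.1 hk).1 hko)]
    simp

/-- Every operator with symbols as coefficients has a mean expansion, by linearity in the symbol and
in the operator. -/
theorem hasMeanExpansion_of_mem (hξ : IsNoise P p ξ) {Λ : (M → ℝ) → StepData M D L → ℝ}
    (hΛ : Λ ∈ frameOps E o L) : HasMeanExpansion E o P (noiseVec ξ 0) Λ := by
  induction hΛ using Submodule.span_induction with
  | mem Λ hΛ =>
    obtain ⟨t, ht, w, rfl⟩ := hΛ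
    induction ht using Submodule.span_induction with
    | mem t ht => exact IsSymbolMonomial.hasMeanExpansion hξ ht w
    | zero =>
      convert! HasMeanExpansion.zero (E := E) (o := o) (P := P) (ζ := noiseVec ξ 0) using 1
      funext φ z; simp
    | add x y _ _ hx hy =>
      convert! hx.add hy using 1
      funext φ z; simp [add_mul]
    | smul a x _ hx =>
      convert! hx.smul a using 1
      funext φ z; simp [mul_assoc]
  | zero => exact HasMeanExpansion.zero
  | add x y _ _ hx hy => exact hx.add hy
  | smul a x _ hx => exact hx.smul a

/-- Integrating an expansion of order `m` over the noise. -/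
theorem HasOrder.abs_integral_sub_le {M : Type*} [MetricSpace M] {o : M} (hξ : IsNoise P p ξ)
    {m : ℕ} {F G : StepData M D L → ℝ}
    (hF : ∀ ε x, AEStronglyMeasurable (fun η => F (ε, x, noiseVec ξ 0 η)) P)
    (hG : ∀ ε x, Integrable (fun η => G (ε, x, noiseVec ξ 0 η)) P) (h : HasOrder o m (F - G)) :
    ∃ (C : ℝ) (κ : ℕ), 0 ≤ C ∧ ∀ (ε : Icc (0 : ℝ) 1) (x : M),
      Integrable (fun η => F (ε, x, noiseVec ξ 0 η)) P ∧
      |∫ η, F (ε, x, noiseVec ξ 0 η) ∂P - ∫ η, G (ε, x, noiseVec ξ 0 η) ∂P|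
        ≤ C * (ε : ℝ) ^ m * (1 + dist o x) ^ κ := by
  obtain ⟨C, κ, hC, h⟩ := h
  set I := ∫ η, (1 + ‖noiseVec ξ 0 η‖) ^ κ ∂P with hI
  have hI0 : 0 ≤ I := integral_nonneg fun η => by positivity
  refine ⟨C * I, κ, by positivity, fun ε x => ?_⟩
  have hdom : Integrable (fun η => C * (ε : ℝ) ^ m * (1 + dist o x) ^ κ *
      (1 + ‖noiseVec ξ 0 η‖) ^ κ) P := (hξ.integrable_one_add_norm_pow 0 κ).const_mul _
  have hle : ∀ η, ‖F (ε, x, noiseVec ξ 0 η) - G (ε, x, noiseVec ξ 0 η)‖ ≤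
      C * (ε : ℝ) ^ m * (1 + dist o x) ^ κ * (1 + ‖noiseVec ξ 0 η‖) ^ κ := fun η => by
    refine (h (ε, x, noiseVec ξ 0 η)).trans (le_of_eq ?_)
    simp only [weight, mul_pow]
    ring
  have hdiff : Integrable (fun η => F (ε, x, noiseVec ξ 0 η) - G (ε, x, noiseVec ξ 0 η)) P :=
    hdom.mono' ((hF ε x).sub (hG ε x).aestronglyMeasurable) (Eventually.of_forall hle)
  have hFi : Integrable (fun η => F (ε, x, noiseVec ξ 0 η)) P :=
    (hdiff.add (hG ε x)).congr (Eventually.of_forall fun η => by simp)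
  refine ⟨hFi, ?_⟩
  rw [← integral_sub hFi (hG ε x)]
  refine (norm_integral_le_of_norm_le hdom (Eventually.of_forall hle)).trans (le_of_eq ?_)
  rw [integral_const_mul]
  ring

end Expectation

section TalayTubaro

variable {n : ℕ} {M : Type*} [MetricSpace M] [ChartedSpace (EuclideanSpace ℝ (Fin n)) M]
  [IsManifold (𝓡 n) ∞ M] [Bundle.RiemannianBundle (fun x : M => TangentSpace (𝓡 n) x)]
  [IsRiemannianManifold (𝓡 n) M] [CompleteSpace M]
  {D s K L : ℕ} {E : Fin D → (x : M) → TangentSpace (𝓡 n) x} {f : Fin D → M → ℝ} {o : M}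
  {Ω : Type*} [MeasurableSpace Ω] {P : Measure Ω} [IsProbabilityMeasure P] {p : ℕ}
  {ξ : ℕ → Fin D → Fin L → Ω → ℝ}

theorem step_zero (hE : IsFrame E) {B : ℝ} (hB : ∀ d x, ‖E d x‖ ≤ B) (m : Tableau s K L) (x : M)
    (v : Fin D → Fin L → ℝ) : m.step E f 0 x v = x := by
  rw [step_eq_incr]
  have h := dist_flowProd_le hE hB (incr 0 (fun k j => m.z0 j k) m.zhat
      (fun d j => f d (m.stage E f 0 x v j)) v) x
  have h0 : ∀ k d, incr 0 (fun k j => m.z0 j k) m.zhat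
      (fun d j => f d (m.stage E f 0 x v j)) v k d = 0 := fun k d => by simp [incr]
  simp only [h0, abs_zero, Finset.sum_const_zero, mul_zero] at h
  exact (dist_le_zero.1 h).symm

/-- The expansion in powers of `h = ε ^ 2`. It is run to order `2 (p + 1)` in `ε`, and the terms of
the mean expansion beyond `h ^ p` go into the remainder. -/
theorem talay_tubaro (hE : IsFrame E) {B : ℝ} (hB : ∀ d x, ‖E d x‖ ≤ B) (hB0 : 0 ≤ B)
    (hf : ∀ d, PolyGrowth E o (f d)) (T : Tableau s K L) (hξ : IsNoise P p ξ) :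
    ∃ A : ℕ → (M → ℝ) → (M → ℝ), (∀ j, IsLinDiffOp E (A j)) ∧
      ∀ φ : M → ℝ, PolyGrowth E o φ → ∃ (C : ℝ) (κ : ℕ), ∀ x : M, ∀ h : ℝ, 0 < h → h ≤ 1 →
        Integrable (fun η => φ (T.step E f h x (noiseVec ξ 0 η))) P ∧
        ∃ R : ℝ, |R| ≤ C * (1 + dist o x ^ κ) ∧
          ∫ η, φ (T.step E f h x (noiseVec ξ 0 η)) ∂P
            = φ x + ∑ j ∈ Finset.Icc 1 p, h ^ j * A j φ x + h ^ (p + 1) * R := by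
  obtain ⟨-, Λ, hΛ, hstep⟩ := expands_step hE hB hB0 hf T (2 * (p + 1))
  obtain ⟨N₀, A, hA, hmean⟩ := hasMeanExpansion_of_mem hξ hΛ
  refine ⟨A, hA, fun φ hφ => ?_⟩
  obtain ⟨hAb, hmean⟩ := hmean φ hφ
  have hmeas : ∀ h x, Measurable fun η => φ (T.step E f h x (noiseVec ξ 0 η)) := fun h x =>
    (hφ.1.continuous.comp (continuous_step hE hB (fun d => (hf d).1.continuous) T h
      continuous_const continuous_id)).measurable.comp (hξ.measurable_noiseVec 0)
  obtain ⟨C, κ, hC, herr⟩ := HasOrder.abs_integral_sub_le hξ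
    (F := fun z => φ (T.step E f ((z.1 : ℝ) ^ 2) z.2.1 z.2.2))
    (fun ε x => (hmeas ((ε : ℝ) ^ 2) x).aestronglyMeasurable) (fun ε x => (hmean ε x).1)
    (hstep φ hφ)
  set N := N₀ + (p + 1) with hN
  -- the coefficient of order zero is found by setting `ε = 0`
  have hA0 : ∀ x, A 0 φ x = φ x := by
    intro x
    have h1 := (herr ⟨0, by simp⟩ x).2
    rw [(hmean ⟨0, by simp⟩ x).2 N (by omega), hN, ← add_assoc, Finset.sum_range_succ'] at h1
    have h3 : ∀ j, (0 : ℝ) ^ (2 * (j + 1)) = 0 := fun j => zero_pow (by omega)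
    simp only [ne_eq, OfNat.ofNat_ne_zero, not_false_eq_true, zero_pow, step_zero hE hB,
      integral_const, probReal_univ, one_smul, h3, zero_mul, Finset.sum_const_zero, mul_zero,
      pow_zero, one_mul, zero_add] at h1
    linarith [abs_le.1 h1]
  have hrest : PolyBounded o fun x => C * (1 + dist o x) ^ κ +
      ∑ j ∈ Finset.Ico (p + 1) N, |A j φ x| :=
    PolyBounded.add (g := fun x => C * (1 + dist o x) ^ κ) ⟨C, κ, hC, fun x => by
      rw [abs_of_nonneg (by positivity)]⟩ (PolyBounded.sum fun j _ => (hAb j).abs)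
  obtain ⟨C', κ', hC', hrest⟩ := hrest
  refine ⟨C' * 2 ^ κ', κ', fun x h hh hh1 => ?_⟩
  have hε : √h ∈ Icc (0 : ℝ) 1 := ⟨Real.sqrt_nonneg _, Real.sqrt_le_one.2 hh1⟩
  have hsq : √h ^ 2 = h := Real.sq_sqrt hh.le
  obtain ⟨hint, hle⟩ := herr ⟨√h, hε⟩ x
  rw [(hmean ⟨√h, hε⟩ x).2 N (by omega)] at hle
  simp only [pow_mul, hsq] at hint hle
  refine ⟨hint, ?_⟩
  set J := ∫ η, φ (T.step E f h x (noiseVec ξ 0 η)) ∂P with hJ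
  have hsum : ∑ j ∈ Finset.range N, h ^ j * A j φ x =
      φ x + ∑ j ∈ Finset.Icc 1 p, h ^ j * A j φ x +
        ∑ j ∈ Finset.Ico (p + 1) N, h ^ j * A j φ x := by
    rw [Finset.range_eq_Ico, Finset.sum_eq_sum_Ico_succ_bot (by omega), pow_zero, one_mul, hA0,
      ← Finset.sum_Ico_consecutive _ (by omega : 0 + 1 ≤ p + 1) (by omega : p + 1 ≤ N), add_assoc]
    rfl
  have hhp : 0 < h ^ (p + 1) := by positivity
  refine ⟨(J - (φ x + ∑ j ∈ Finset.Icc 1 p, h ^ j * A j φ x)) / h ^ (p + 1), ?_, ?_⟩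
  · have h1 : |J - (φ x + ∑ j ∈ Finset.Icc 1 p, h ^ j * A j φ x)| ≤
        (C * (1 + dist o x) ^ κ + ∑ j ∈ Finset.Ico (p + 1) N, |A j φ x|) * h ^ (p + 1) := by
      have h2 : J - (φ x + ∑ j ∈ Finset.Icc 1 p, h ^ j * A j φ x) =
          (J - ∑ j ∈ Finset.range N, h ^ j * A j φ x) +
            ∑ j ∈ Finset.Ico (p + 1) N, h ^ j * A j φ x := by rw [hsum]; ring
      rw [h2, add_mul]
      refine (abs_add_le _ _).trans (add_le_add (hle.trans (le_of_eq (by ring))) ?_)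
      rw [Finset.sum_mul]
      refine (Finset.abs_sum_le_sum_abs _ _).trans (Finset.sum_le_sum fun j hj => ?_)
      rw [abs_mul, abs_of_nonneg (by positivity), mul_comm]
      exact mul_le_mul_of_nonneg_left
        (pow_le_pow_of_le_one hh.le hh1 (Finset.mem_Ico.1 hj).1) (abs_nonneg _)
    rw [abs_div, abs_of_pos hhp, div_le_iff₀ hhp]
    refine h1.trans (mul_le_mul_of_nonneg_right ?_ hhp.le)
    refine (le_abs_self _).trans ((hrest x).trans ?_)
    have h3 := one_add_rpow_le (dist_nonneg : 0 ≤ dist o x) (κ'.cast_nonneg : (0 : ℝ) ≤ κ')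
    simp only [Real.rpow_natCast] at h3
    rw [mul_assoc]
    exact mul_le_mul_of_nonneg_left h3 hC'
  · rw [mul_div_cancel₀ _ hhp.ne']
    ring

end TalayTubaro

section Glue

variable {n : ℕ} {M : Type*} [MetricSpace M] [ChartedSpace (EuclideanSpace ℝ (Fin n)) M]
  [Bundle.RiemannianBundle (fun x : M => TangentSpace (𝓡 n) x)] [IsRiemannianManifold (𝓡 n) M]
  {D : ℕ} {E : Fin D → (x : M) → TangentSpace (𝓡 n) x} {f : Fin D → M → ℝ} {o : M}

/-- The coordinates of the drift are Lipschitz, hence of linear growth. -/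
theorem Regular.exists_coord_le (hreg : Regular E f o) :
    ∃ A, 0 ≤ A ∧ ∀ d x, |f d x| ≤ A * (1 + dist o x) := by
  obtain ⟨C, hC⟩ := hreg.coord_lip
  refine ⟨(∑ d, |f d o|) + |C|, by positivity, fun d x => ?_⟩
  have h1 := abs_sub_le_of_dAt_le ((hreg.coord_poly d).1.of_le (by norm_cast)) (abs_nonneg C)
    (fun x v => (hC d x v).trans (by gcongr; exact le_abs_self C)) x o
  have h2 : |f d o| ≤ ∑ d, |f d o| :=
    Finset.single_le_sum (f := fun d => |f d o|) (fun _ _ => abs_nonneg _) (Finset.mem_univ d)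
  have h3 : |f d x| ≤ |f d x - f d o| + |f d o| := by
    simpa using abs_add_le (f d x - f d o) (f d o)
  have h4 : 0 ≤ (∑ d, |f d o|) * dist o x := by positivity
  rw [dist_comm] at h1
  nlinarith [abs_nonneg C]

end Glue

end FrozenFlow

open MeasureTheory ProbabilityTheory FrozenFlow in
theorem proposition2p2
    -- a smooth connected complete Riemannian manifold `M` of dimension `n`
    {n : ℕ} {M : Type*} [MetricSpace M] [ChartedSpace (EuclideanSpace ℝ (Fin n)) M]
    [IsManifold (𝓡 n) ∞ M]
    [Bundle.RiemannianBundle (fun x : M => TangentSpace (𝓡 n) x)]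
    [IsContMDiffRiemannianBundle (𝓡 n) ∞ (EuclideanSpace ℝ (Fin n))
      (fun x : M => TangentSpace (𝓡 n) x)]
    [IsRiemannianManifold (𝓡 n) M] [ConnectedSpace M] [CompleteSpace M]
    [MeasurableSpace M] [BorelSpace M]
    -- the frame, the coordinates of the drift, and the base point of the distance function
    {D : ℕ} (E : Fin D → (x : M) → TangentSpace (𝓡 n) x) (f : Fin D → M → ℝ) (o : M)
    (hE : IsFrame E) (hreg : Regular E f o)
    (hf : ∃ C : ℝ, ∀ d₁ d x, |iterD E [d₁, d₁] (f d) x| ≤ C)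
    (hr : DistPowerBounds E o)
    -- a consistent explicit frozen flow method
    {s K L : ℕ} (m : Tableau s K L) (hexp : m.IsExplicit) (hcons : m.IsConsistent)
    -- its driving noise
    {Ω : Type*} [MeasurableSpace Ω] (P : Measure Ω) [IsProbabilityMeasure P]
    (p : ℕ) (hp : 1 ≤ p) (ξ : ℕ → Fin D → Fin L → Ω → ℝ) (hξ : IsNoise P p ξ) :
    -- bounded moments
    (∀ X₀ : Ω → M, Measurable X₀ →
      IndepFun X₀ (fun η (a : ℕ × Fin D × Fin L) => ξ a.1 a.2.1 a.2.2 η) P →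
      (∀ k : ℕ, Integrable (fun η => dist o (X₀ η) ^ k) P) →
      ∀ κ : ℝ, 0 ≤ κ → ∀ T : ℝ, 0 < T → ∃ C : ℝ, ∀ N : ℕ, 1 ≤ N → ∀ j ≤ N,
        Integrable (fun η =>
          dist o (m.traj E f (T / N) (X₀ η) (fun i d l => ξ i d l η) j) ^ κ) P ∧
        ∫ η, dist o (m.traj E f (T / N) (X₀ η) (fun i d l => ξ i d l η) j) ^ κ ∂P ≤ C) ∧
    -- Talay-Tubaro expansion
    (∃ h₀ : ℝ, 0 < h₀ ∧ ∃ A : ℕ → (M → ℝ) → (M → ℝ), (∀ j, IsLinDiffOp E (A j)) ∧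
      ∀ φ : M → ℝ, PolyGrowth E o φ → ∃ (C : ℝ) (κ : ℕ), ∀ x : M, ∀ h : ℝ, 0 < h → h ≤ h₀ →
        Integrable (fun η => φ (m.step E f h x (fun d l => ξ 0 d l η))) P ∧
        ∃ R : ℝ, |R| ≤ C * (1 + dist o x ^ κ) ∧
          ∫ η, φ (m.step E f h x (fun d l => ξ 0 d l η)) ∂P
            = φ x + ∑ j ∈ Finset.Icc 1 p, h ^ j * A j φ x + h ^ (p + 1) * R) := by
  obtain ⟨C, hC⟩ := hreg.frame_bdd
  have hB : ∀ d x, ‖E d x‖ ≤ max C 0 := fun d x => (hC d x).trans (le_max_left _ _)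
  obtain ⟨A, hA0, hA⟩ := hreg.exists_coord_le
  refine ⟨fun X₀ hX₀ hind hmom κ hκ T hT => ?_, 1, one_pos, ?_⟩
  · exact bounded_moments hE hB (le_max_right _ _) hA0 hA
      (fun d => (hreg.coord_poly d).1.continuous) hr m hξ hX₀ hind hmom hκ hT
  · exact talay_tubaro hE hB (le_max_right _ _) hreg.coord_poly m hξ
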